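/- Let $d\ge 3$. Consider the cable system $\tilde{\mathbb Z}^d$, i.e. $\mathbb Z^d$ with every nearest-neighbour edge replaced by an interval of length $\tfrac12$, and the continuous diffusion on it that is a Brownian motion on each edge and, at each vertex, behaves symmetrically with respect to the $2d$ adjacent edges without spending positive time there. Let $\tilde P_x$ be its law when started at $x$. For finite $K\subset\mathbb Z^d$ and $x\in K$, let $e_K(x)=2d\cdot P_x[\text{simple random walk never visits }K\text{ at times }n\ge1]$ be the equilibrium measure. Random interlacements on $\tilde{\mathbb Z}^d$, under $\tilde{\mathbb P}^I$, is the Poisson point process on $\tilde W^*\times[0,\infty)$, where $\tilde W^*$ is the set of doubly infinite continuous trajectories on $\tilde{\mathbb Z}^d$ that leave every compact set in both time directions, modulo time-shift. Its intensity is $\nu\otimes du$, where $\nu$ is determined by the following property: for every box $\tilde K=[N_1,N_2]^d\cap\tilde{\mathbb Z}^d$ with integers $N_1\le N_2$ and $K=\tilde K\cap\mathbb Z^d$, the forward parts, started at the first hitting time of $\tilde K$, of the trajectories hitting $\tilde K$ have intensity $\sum_{x\in K}e_K(x)\tilde P_x$ under $\nu$. For $u>0$ and $x\in\tilde{\mathbb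 Z}^d$, let $\tilde\ell_{x,u}$ be the sum of the local times at $x$ (relative to Lebesgue measure on $\tilde{\mathbb Z}^d$) of all trajectories with label at most $u$. **Lemma.** Let $d\ge3$ and $\varepsilon\in(0,1)$. There exist constants $c=c(d,\varepsilon)>0$ and $C=C(d,\varepsilon)<\infty$ such that for all real $u>0$ and all integers $R\ge1$, $$\tilde{\mathbb P}^I\Big(\Big|\frac1{R^d}\sum_{x\in[0,R)^d\cap\mathbb Z^d}\tilde\ell_{x,u}-u\Big|>\varepsilon u\Big)\le C\exp\big(-cR^{d-2}u\big).$$ -/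

import Mathlib

open MeasureTheory ProbabilityTheory Filter Topology Set
open scoped NNReal ENNReal

namespace Interlacement

noncomputable section

/-! ### The lattice and the cable system -/

/-- The `2d` oriented lattice directions: a coordinate and a sign. -/
abbrev Dir (d : ℕ) : Type := Fin d × Bool

/-- The unit vector of `ℤ^d` in a given direction. -/
def unitVec {d : ℕ} (v : Dir d) : Fin d → ℤ :=
  Pi.single v.1 (if v.2 then 1 else -1)

/-- The cable system of `ℤ^d`, realised as the set of points of `ℝ^d` with at most one non-integer
coordinate, i.e. as the union of the closed segments between nearest neighbours.  A segment is
assigned length `1/2`, so length along the cable is half of the length in `ℝ^d`.  The topology and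
the Borel `σ`-algebra are those induced by `ℝ^d`. -/
abbrev Cable (d : ℕ) : Type :=
  {z : Fin d → ℝ // ∀ i j, i ≠ j → (∃ n : ℤ, z i = n) ∨ (∃ n : ℤ, z j = n)}

/-- A vertex of `ℤ^d` as a point of the cable system. -/
def vertex {d : ℕ} (x : Fin d → ℤ) : Cable d :=
  ⟨fun j => (x j : ℝ), fun i _ _ => Or.inl ⟨x i, rfl⟩⟩

/-- The point at cable-distance `t ∈ [0, 1/2]` from `x` on the edge leaving `x` in direction `v`. -/
def edgePoint {d : ℕ} (x : Fin d → ℤ) (v : Dir d) (t : ℝ) : Cable d :=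
  ⟨fun j => (x j : ℝ) + 2 * t * (unitVec v j : ℝ), by
    intro i j hij
    by_cases h : i = v.1
    · right
      have hj : j ≠ v.1 := fun hj => hij (h.trans hj.symm)
      exact ⟨x j, by simp [unitVec, hj]⟩
    · left
      exact ⟨x i, by simp [unitVec, h]⟩⟩

/-- Lebesgue (length) measure on the cable system; every edge, listed once through its lower
endpoint `x` and its coordinate direction `i`, has length `1/2`. -/
def cableLebesgue (d : ℕ) : Measure (Cable d) :=
  Measure.sum fun e : (Fin d → ℤ) × Fin d =>
    (volume.restrict (Icc (0 : ℝ) (1 / 2))).map (edgePoint e.1 (e.2, true))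

/-! ### The diffusion on the cable system

It is Brownian motion on each edge and picks one of the `2d` edges at a vertex uniformly, spending
no time at vertices.  Its law is defined by the martingale problem for its generator
`f ↦ f'' / 2` on functions whose outward slopes at each vertex add up to zero. -/

/-- `f` is in the (compactly supported, `C²` on closed edges) domain of the second derivative on
the cable system with the Kirchhoff condition at the vertices, and `h = f''`. -/
structure IsTestPair {d : ℕ} (f h : Cable d → ℝ) : Prop where
  continuous_fun : Continuous f
  compact_support : HasCompactSupport f
  continuous_second : Continuous h
  slopes : ∃ D : (Fin d → ℤ) → Dir d → ℝ → ℝ,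
    (∀ x v, ∀ t ∈ Icc (0 : ℝ) (1 / 2),
      HasDerivWithinAt (fun s => f (edgePoint x v s)) (D x v t) (Icc (0 : ℝ) (1 / 2)) t ∧
      HasDerivWithinAt (D x v) (h (edgePoint x v t)) (Icc (0 : ℝ) (1 / 2)) t) ∧
    ∀ x, ∑ v : Dir d, D x v 0 = 0

/-- Continuous paths on the cable system indexed by `[0, ∞)`, with the `σ`-algebra generated by
the coordinates. -/
abbrev ForwardPath (d : ℕ) : Type := {w : ℝ≥0 → Cable d // Continuous w}

/-- The canonical filtration on the space of forward paths. -/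
def pathFiltration (d : ℕ) :
    Filtration ℝ≥0 (inferInstance : MeasurableSpace (ForwardPath d)) where
  seq t := ⨆ s : Iic t, MeasurableSpace.comap (fun w : ForwardPath d => w.1 s.1) inferInstance
  mono' := by
    intro t t' h
    refine iSup_le fun s => ?_
    exact le_iSup (fun s : Iic t' =>
      MeasurableSpace.comap (fun w : ForwardPath d => w.1 s.1) inferInstance)
      ⟨s.1, le_trans s.2 h⟩
  le' := by
    intro t
    refine iSup_le fun s => ?_
    exact Measurable.comap_le ((measurable_pi_apply s.1).comp measurable_subtype_coe)

/-- `P` is the law of the cable system diffusion started at `z`. -/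
structure IsDiffusionLaw {d : ℕ} (z : Cable d) (P : Measure (ForwardPath d)) : Prop where
  isProbability : IsProbabilityMeasure P
  start : ∀ᵐ w ∂P, w.1 0 = z
  martingale : ∀ f h : Cable d → ℝ, IsTestPair f h →
    Martingale
      (fun (t : ℝ≥0) (w : ForwardPath d) =>
        f (w.1 t) - ∫ s in (0 : ℝ)..t, (1 / 2) * h (w.1 s.toNNReal))
      (pathFiltration d) P

/-! ### Equilibrium measure of a finite subset of `ℤ^d` -/

/-- The law of the sequence of steps of simple random walk on `ℤ^d`: independent uniform unit
vectors. -/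
def walkSteps (d : ℕ) : Measure (ℕ → Dir d) :=
  Measure.infinitePi fun _ => uniformOn univ

/-- Position after `n` steps of the walk started at `x`. -/
def walkPosition {d : ℕ} (x : Fin d → ℤ) (ξ : ℕ → Dir d) (n : ℕ) : Fin d → ℤ :=
  x + ∑ k ∈ Finset.range n, unitVec (ξ k)

/-- The equilibrium measure of `K ⊂ ℤ^d` for unit edge weights (total weight `2d` at each vertex):
`e_K(x) = 2d · P_x[the walk does not visit K at any time n ≥ 1]` for `x ∈ K`. It is only evaluated
at points of `K`. -/
def equilibrium {d : ℕ} (K : Finset (Fin d → ℤ)) (x : Fin d → ℤ) : ℝ≥0∞ :=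
  2 * d * walkSteps d {ξ | ∀ n, 1 ≤ n → walkPosition x ξ n ∉ K}

/-! ### Doubly infinite trajectories modulo time-shift -/

/-- Doubly infinite continuous trajectories leaving every compact set in both time directions,
with the `σ`-algebra generated by the coordinates. -/
abbrev Trajectory (d : ℕ) : Type :=
  {w : ℝ → Cable d //
    Continuous w ∧ Tendsto w atTop (cocompact (Cable d)) ∧ Tendsto w atBot (cocompact (Cable d))}

/-- Equality up to a time-shift. -/
instance timeShift (d : ℕ) : Setoid (Trajectory d) where
  r w w' := ∃ s : ℝ, ∀ t, w'.1 t = w.1 (t + s)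
  iseqv :=
    { refl := fun w => ⟨0, fun t => by simp⟩
      symm := by
        rintro w w' ⟨s, hs⟩
        exact ⟨-s, fun t => by rw [hs]; simp⟩
      trans := by
        rintro w w' w'' ⟨s, hs⟩ ⟨s', hs'⟩
        exact ⟨s' + s, fun t => by rw [hs', hs, add_assoc]⟩ }

/-- Trajectories modulo time-shift, with the quotient `σ`-algebra. -/
abbrev TrajectoryMod (d : ℕ) : Type := Quotient (timeShift d)

/-- The part of a trajectory after time `0`. -/
def forwardPart {d : ℕ} (w : Trajectory d) : ForwardPath d :=
  ⟨fun t => w.1 t, w.2.1.comp NNReal.continuous_coe⟩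

/-- The closed box `[N₁, N₂]^d` in the cable system. -/
def cableBox (d : ℕ) (N₁ N₂ : ℤ) : Set (Cable d) :=
  {z | ∀ j, (N₁ : ℝ) ≤ z.1 j ∧ z.1 j ≤ N₂}

/-- The lattice points of `[N₁, N₂]^d`. -/
def latticeBox (d : ℕ) (N₁ N₂ : ℤ) : Finset (Fin d → ℤ) :=
  Fintype.piFinset fun _ => Finset.Icc N₁ N₂

/-- Trajectories modulo time-shift that hit `K` and whose part after the first hitting time of `K`
belongs to `A` (the representative is the one that hits `K` first at time `0`). -/
def hitsThenIn {d : ℕ} (K : Set (Cable d)) (A : Set (ForwardPath d)) : Set (TrajectoryMod d) :=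
  {q | ∃ w : Trajectory d, Quotient.mk (timeShift d) w = q ∧
    w.1 0 ∈ K ∧ (∀ r < 0, w.1 r ∉ K) ∧ forwardPart w ∈ A}

/-- `ν` is the intensity measure of random interlacements on the cable system: for every box `K`,
the image of `ν`, restricted to the trajectories hitting `K`, under the map to the forward
trajectory from the first hitting time of `K` is `∑ x ∈ K, e_K(x) P_x`, where `P_x` is the law of
the diffusion started at `x`. -/
def IsInterlacementIntensity {d : ℕ} (ν : Measure (TrajectoryMod d)) : Prop :=
  ∃ P : (Fin d → ℤ) → Measure (ForwardPath d),
    (∀ x, IsDiffusionLaw (vertex x) (P x)) ∧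
    ∀ N₁ N₂ : ℤ, N₁ ≤ N₂ → ∀ A : Set (ForwardPath d), MeasurableSet A →
      ν (hitsThenIn (cableBox d N₁ N₂) A) =
        ∑ x ∈ latticeBox d N₁ N₂, equilibrium (latticeBox d N₁ N₂) x * P x A

/-! ### Poisson point processes and random interlacements -/

/-- `N` is, under `μ`, a Poisson point process with intensity measure `Λ`. -/
structure IsPoissonPointProcess {Ω S : Type*} [MeasurableSpace Ω] [MeasurableSpace S]
    (μ : Measure Ω) (N : Ω → Measure S) (Λ : Measure S) : Prop where
  measurable : Measurable N
  point_measure : ∀ᵐ ω ∂μ, ∃ (J : Set ℕ) (p : ℕ → S),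
    N ω = Measure.sum fun j : J => Measure.dirac (p j)
  poisson : ∀ A : Set S, MeasurableSet A → Λ A ≠ ∞ →
    μ.map (fun ω => N ω A) = (poissonMeasure (Λ A).toNNReal).map (fun n : ℕ => (n : ℝ≥0∞))
  independent : ∀ (n : ℕ) (A : Fin n → Set S), (∀ i, MeasurableSet (A i)) →
    Pairwise (fun i j => Disjoint (A i) (A j)) → iIndepFun (fun i ω => N ω (A i)) μ

/-- `N` is, under `μ`, the interlacement process on the cable system of `ℤ^d`: a Poisson point
process of trajectories modulo time-shift with labels in `[0, ∞)`. -/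
def IsRandomInterlacement {Ω : Type*} [MeasurableSpace Ω] {d : ℕ} (μ : Measure Ω)
    (N : Ω → Measure (TrajectoryMod d × ℝ)) : Prop :=
  ∃ ν : Measure (TrajectoryMod d), IsInterlacementIntensity ν ∧
    IsPoissonPointProcess μ N (ν.prod (volume.restrict (Ici (0 : ℝ))))

/-- The local time at `z` of a two-sided path, relative to Lebesgue measure on the cable system:
the time spent in a ball around `z` over the length of the ball, as the radius tends to zero
(a `limsup`, so that it is defined for every path). Small balls are taken in the
sup-distance of `ℝ^d`; they are the small balls of the length distance on the cable system. -/
def pathLocalTime {d : ℕ} (w : ℝ → Cable d) (z : Cable d) : ℝ≥0∞ :=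
  limsup (fun r : ℝ => volume {t : ℝ | w t ∈ Metric.ball z r} / cableLebesgue d (Metric.ball z r))
    (𝓝[>] 0)

/-- The local time at `z` of a trajectory modulo time-shift. -/
def trajectoryLocalTime {d : ℕ} (z : Cable d) : TrajectoryMod d → ℝ≥0∞ :=
  Quotient.lift (fun w : Trajectory d => pathLocalTime w.1 z) (by
    rintro w w' ⟨s, hs⟩
    have key : ∀ B : Set (Cable d), volume {t : ℝ | w'.1 t ∈ B} = volume {t : ℝ | w.1 t ∈ B} := by
      intro B
      have : {t : ℝ | w'.1 t ∈ B} = (fun t => t + s) ⁻¹' {t : ℝ | w.1 t ∈ B} := by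
        ext t; simp [hs]
      rw [this, measure_preimage_add_right]
    simp only [pathLocalTime, key])

/-- The local time at `z` of random interlacements at level `u`: the sum of the local times at `z`
of all trajectories of the point measure `N` with label at most `u`. -/
def localTime {d : ℕ} (N : Measure (TrajectoryMod d × ℝ)) (u : ℝ) (z : Cable d) : ℝ≥0∞ :=
  ∫⁻ p in {p : TrajectoryMod d × ℝ | p.2 ≤ u}, trajectoryLocalTime z p.1 ∂N

end

end Interlacement

/-!
The sum of the local times over the box is an integral `∫ H dN` against the Poisson point process
`N`, where `H` is the total local time that one labelled trajectory leaves on the vertices of the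
box, so it has an explicit Laplace functional. Both tails then follow from Chernoff's bound, once
`∫ (exp (θ H) - 1) dΛ` and `∫ (1 - exp (-θ H)) dΛ` are known up to a factor `1 + O(θ R²)`; the
choice `θ = δ / R²` with a small `δ` gives the rate `θ u R ^ d = δ u R ^ (d - 2)`
(`IsPoissonPointProcess.measure_lt_lintegral_le`, `IsPoissonPointProcess.measure_lintegral_lt_le`,
`IsRandomInterlacement.measure_deviation_le`).

Off the value `0`, the intensity measure sends `H` to the law of the local time `L` of the forward
diffusion under `∑ x ∈ K, e_K(x) P_x`, where `K` is a larger box: a trajectory leaves local time at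
vertices well inside `K` only after its first hitting time of `K` (`preimage_boxLocalTime`). It
remains to estimate the moments of `L` under `P_x`. Let `a(x)` be the Green potential of the box
`B`, that is, `(2d)⁻¹` times the expected number of visits of simple random walk to `B`.

* Sweeping: `∑ x ∈ K, e_K(x) a(x) = |B|` (`sum_equilibrium_mul_green`), by symmetry of the Green
  function and the last exit decomposition of the hitting probability of `K`.
* `sup a = O(R²)` (`exists_green_box_le`): the function `(m + |x|²) ^ (-1/4)` is superharmonic in
  every dimension `d ≥ 3`, with an explicit defect, and is compared with the Green function. This
  avoids heat kernel estimates.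
* Martingale problem: a continuous density `φ ≥ 0` close to the sum of the point masses at the
  vertices of `B` has a bounded potential `g` on the cable system, `g'' / 2 = -φ` with Kirchhoff's
  condition, close to `a` at the vertices; `g(w_t) + ∫₀ᵗ φ(w_s) ds` is a martingale
  (`hasPotential`). Taylor expansion of `exp (± θ ∫ φ)` to second order along the path, together
  with `0 ≤ g ≤ A`, gives
  `E exp (θ ∫ φ) ≤ 1 + θ g(x) / (1 - θ A)` and `E exp (-θ ∫ φ) ≤ 1 - θ (1 - θ A) g(x)`
  (`HasPotential.integral_exp_occ_le`, `HasPotential.integral_exp_neg_occ_le`). The strong Markov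
  property is not needed.
* The local time is a `limsup` along balls. The same expansion with the square function bounds the
  second moment of the difference of two occupation integrals by the distance of their potentials,
  so the smoothed local times along a fast sequence of radii converge almost surely
  (`ae_cauchySeq_totalTime`) and the exponential bounds pass to the limit by Fatou's lemma.

The lower tail uses in addition that `g(w_t) → 0`. Transience of `P_x` is read off from the
intensity measure, which charges only trajectories that leave every compact set
(`ae_tendsto_cocompact`).
-/

namespace Interlacement

noncomputable section

variable {d : ℕ}

/-! ### The Green operator of simple random walk -/

/-- Average over the `2d` neighbours: the transition operator of simple random walk, acting on
`[0, ∞]`-valued functions. -/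
def stepMean (φ : (Fin d → ℤ) → ℝ≥0∞) (x : Fin d → ℤ) : ℝ≥0∞ :=
  (2 * d : ℝ≥0∞)⁻¹ * ∑ v : Dir d, φ (x + unitVec v)

/-- The Green operator `∑ n, stepMean^[n]`: the expected sum of `φ` along the walk from `x`. -/
def green (φ : (Fin d → ℤ) → ℝ≥0∞) (x : Fin d → ℤ) : ℝ≥0∞ :=
  ∑' n, stepMean^[n] φ x

lemma stepMean_mono : Monotone (stepMean (d := d)) := fun φ ψ h x => by
  unfold stepMean; gcongr; exact h _

lemma stepMean_add (φ ψ : (Fin d → ℤ) → ℝ≥0∞) : stepMean (φ + ψ) = stepMean φ + stepMean ψ := by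
  ext x; simp [stepMean, Finset.sum_add_distrib, mul_add]

lemma stepMean_tsum (φ : ℕ → (Fin d → ℤ) → ℝ≥0∞) :
    stepMean (fun x => ∑' n, φ n x) = fun x => ∑' n, stepMean (φ n) x := by
  ext x
  simp only [stepMean]
  rw [← Summable.tsum_finsetSum (fun _ _ => ENNReal.summable), ENNReal.tsum_mul_left]

lemma stepMean_iterate_add (n : ℕ) (φ ψ : (Fin d → ℤ) → ℝ≥0∞) :
    stepMean^[n] (φ + ψ) = stepMean^[n] φ + stepMean^[n] ψ := by
  induction n generalizing φ ψ with
  | zero => rfl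
  | succ n ih => simp [Function.iterate_succ_apply, stepMean_add, ih]

lemma stepMean_iterate_mono (n : ℕ) : Monotone (stepMean (d := d))^[n] := stepMean_mono.iterate n

lemma green_eq (φ : (Fin d → ℤ) → ℝ≥0∞) : green φ = φ + stepMean (green φ) := by
  ext x
  have : stepMean (green φ) = fun x => ∑' n, stepMean (stepMean^[n] φ) x := stepMean_tsum _
  rw [Pi.add_apply, this]
  simp only [← Function.iterate_succ_apply' stepMean]
  unfold green
  rw [tsum_eq_zero_add' ENNReal.summable]
  rfl

lemma sum_add_iterate_le {φ ψ : (Fin d → ℤ) → ℝ≥0∞} (h : φ + stepMean ψ ≤ ψ) (n : ℕ) :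
    (∑ k ∈ Finset.range n, stepMean^[k] φ) + stepMean^[n] ψ ≤ ψ := by
  induction n with
  | zero => simp
  | succ n ih =>
    refine le_trans ?_ ih
    rw [Finset.sum_range_succ, add_assoc]
    gcongr
    have := stepMean_iterate_mono n h
    refine le_trans (le_of_eq ?_) this
    rw [stepMean_iterate_add, Function.iterate_succ_apply]

/-- Comparison principle: a nonnegative `ψ` with `ψ - stepMean ψ ≥ φ` dominates the Green function
of `φ`. -/
lemma green_le_of_superharmonic {φ ψ : (Fin d → ℤ) → ℝ≥0∞} (h : φ + stepMean ψ ≤ ψ) :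
    green φ ≤ ψ := fun x => by
  refine ENNReal.tsum_le_of_sum_range_le fun n => ?_
  have := sum_add_iterate_le h n x
  simp only [Pi.add_apply, Finset.sum_apply] at this
  exact le_self_add.trans this

/-- The involution that reverses a direction. -/
def oppDir : Dir d ≃ Dir d := (Equiv.refl _).prodCongr Equiv.boolNot

lemma unitVec_oppDir (v : Dir d) : unitVec (oppDir v) = -unitVec v := by
  change unitVec (v.1, !v.2) = -unitVec v
  ext j
  simp only [unitVec, Pi.neg_apply]
  by_cases h : j = v.1
  · subst h; cases v.2 <;> simp
  · simp [h]

/-- Reversibility of the walk. -/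
lemma tsum_mul_stepMean (φ ψ : (Fin d → ℤ) → ℝ≥0∞) :
    ∑' x, φ x * stepMean ψ x = ∑' x, stepMean φ x * ψ x := by
  have h1 : ∀ x, φ x * stepMean ψ x =
      (2 * d : ℝ≥0∞)⁻¹ * ∑ v : Dir d, φ x * ψ (x + unitVec v) := fun x => by
    simp only [stepMean, ← Finset.mul_sum]; ring
  have h2 : ∀ x, stepMean φ x * ψ x =
      (2 * d : ℝ≥0∞)⁻¹ * ∑ v : Dir d, φ (x + unitVec v) * ψ x := fun x => by
    simp only [stepMean, ← Finset.sum_mul]; ring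
  simp only [h1, h2, ENNReal.tsum_mul_left]
  congr 1
  rw [Summable.tsum_finsetSum (fun _ _ => ENNReal.summable),
    Summable.tsum_finsetSum (fun _ _ => ENNReal.summable)]
  rw [← Equiv.sum_comp oppDir]
  refine Finset.sum_congr rfl fun v _ => ?_
  rw [← Equiv.tsum_eq (Equiv.addRight (unitVec v))]
  simp [unitVec_oppDir]

lemma tsum_mul_green (φ ψ : (Fin d → ℤ) → ℝ≥0∞) :
    ∑' x, φ x * green ψ x = ∑' x, green φ x * ψ x := by
  have h : ∀ n (φ ψ : (Fin d → ℤ) → ℝ≥0∞),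
      ∑' x, φ x * stepMean^[n] ψ x = ∑' x, stepMean^[n] φ x * ψ x := by
    intro n
    induction n with
    | zero => intros; rfl
    | succ n ih =>
      intro φ ψ
      rw [Function.iterate_succ_apply, ih, tsum_mul_stepMean, Function.iterate_succ_apply']
  simp only [green, ← ENNReal.tsum_mul_left, ← ENNReal.tsum_mul_right]
  rw [ENNReal.tsum_comm, ENNReal.tsum_comm (f := fun x n => stepMean^[n] φ x * ψ x)]
  exact tsum_congr fun n => h n φ ψ

/-! ### Hitting probabilities of simple random walk -/

/-- The step sequence that starts with `v` and goes on with `ξ`. -/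
def stepCons (v : Dir d) (ξ : ℕ → Dir d) : ℕ → Dir d := fun n => Nat.casesOn n v ξ

lemma measurable_stepCons : Measurable (fun p : Dir d × (ℕ → Dir d) => stepCons p.1 p.2) := by
  refine measurable_pi_lambda _ fun n => ?_
  cases n with
  | zero => exact measurable_fst
  | succ n => exact (measurable_pi_apply n).comp measurable_snd

instance [NeZero d] : IsProbabilityMeasure (walkSteps d) := by
  unfold walkSteps; infer_instance

/-- Markov property of the walk at time `1`, on the level of step sequences. -/
lemma walkSteps_eq_map_cons [NeZero d] :
    ((uniformOn (univ : Set (Dir d))).prod (walkSteps d)).map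
      (fun p => stepCons p.1 p.2) = walkSteps d := by
  unfold walkSteps
  refine Measure.eq_infinitePi _ fun s t ht => ?_
  classical
  -- pad the index set to an initial segment
  obtain ⟨N, hN⟩ : ∃ N, s ⊆ Finset.range (N + 1) :=
    ⟨s.sup id, fun n hn => Finset.mem_range.2 (Nat.lt_succ_of_le (Finset.le_sup (f := id) hn))⟩
  set t' : ℕ → Set (Dir d) := fun n => if n ∈ s then t n else univ with ht'
  have hpi : Set.pi (s : Set ℕ) t = Set.pi (Finset.range (N + 1) : Set ℕ) t' := by
    ext f
    simp only [Set.mem_pi, Finset.mem_coe, ht']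
    constructor
    · intro h n _
      by_cases hn : n ∈ s <;> simp [hn, h]
    · intro h n hn
      have := h n (hN hn)
      simpa [hn] using this
  have hprod : ∏ i ∈ s, uniformOn (univ : Set (Dir d)) (t i) =
      ∏ i ∈ Finset.range (N + 1), uniformOn (univ : Set (Dir d)) (t' i) := by
    rw [← Finset.prod_subset hN]
    · exact Finset.prod_congr rfl fun i hi => by simp [ht', hi]
    · intro i _ hi; simp [ht', hi]
  have ht'm : ∀ i, MeasurableSet (t' i) := fun i => MeasurableSet.of_discrete
  rw [hpi, hprod, Measure.map_apply measurable_stepCons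
    (MeasurableSet.pi (Finset.countable_toSet _) fun i _ => ht'm i)]
  have hpre : (fun p : Dir d × (ℕ → Dir d) => stepCons p.1 p.2) ⁻¹'
      Set.pi (Finset.range (N + 1) : Set ℕ) t' =
      t' 0 ×ˢ Set.pi (Finset.range N : Set ℕ) (fun n => t' (n + 1)) := by
    ext ⟨v, ξ⟩
    simp only [Set.mem_preimage, Set.mem_pi, Finset.mem_coe, Finset.mem_range, Set.mem_prod]
    constructor
    · intro h
      exact ⟨h 0 (Nat.succ_pos _), fun n hn => h (n + 1) (Nat.succ_lt_succ hn)⟩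
    · rintro ⟨h0, h1⟩ n hn
      cases n with
      | zero => exact h0
      | succ n => exact h1 n (Nat.lt_of_succ_lt_succ hn)
  rw [hpre, Measure.prod_prod, Measure.infinitePi_pi _ (fun i _ => ht'm _),
    Finset.prod_range_succ', mul_comm]

lemma walkSteps_apply_eq [NeZero d] {S : Set (ℕ → Dir d)} (hS : MeasurableSet S) :
    walkSteps d S = (2 * d : ℝ≥0∞)⁻¹ * ∑ v : Dir d, walkSteps d {ξ | stepCons v ξ ∈ S} := by
  conv_lhs => rw [← walkSteps_eq_map_cons]
  rw [Measure.map_apply measurable_stepCons hS, Measure.prod_apply (measurable_stepCons hS),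
    lintegral_fintype, Finset.mul_sum]
  refine Finset.sum_congr rfl fun v _ => ?_
  rw [mul_comm]
  congr 1
  rw [uniformOn_univ]
  simp [mul_comm]

lemma walkPosition_stepCons (x : Fin d → ℤ) (v : Dir d) (ξ : ℕ → Dir d) (n : ℕ) :
    walkPosition x (stepCons v ξ) (n + 1) = walkPosition (x + unitVec v) ξ n := by
  simp only [walkPosition, Finset.sum_range_succ', add_assoc]
  congr 1
  rw [add_comm]
  rfl

lemma walkPosition_zero (x : Fin d → ℤ) (ξ : ℕ → Dir d) : walkPosition x ξ 0 = x := by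
  simp [walkPosition]

lemma measurable_walkPosition (x : Fin d → ℤ) (n : ℕ) :
    Measurable fun ξ : ℕ → Dir d => walkPosition x ξ n := by
  unfold walkPosition
  refine measurable_const.add (Finset.measurable_sum _ fun k _ => ?_)
  exact (measurable_of_countable unitVec).comp (measurable_pi_apply k)

/-- The probability that the walk from `x` visits `K` at time `n`. -/
lemma walkSteps_position_mem [NeZero d] (K : Finset (Fin d → ℤ)) (n : ℕ) (x : Fin d → ℤ) :
    walkSteps d {ξ | walkPosition x ξ n ∈ K} =
      stepMean^[n] (indicator (K : Set (Fin d → ℤ)) 1) x := by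
  induction n generalizing x with
  | zero =>
    by_cases h : x ∈ K <;> simp [walkPosition_zero, h]
  | succ n ih =>
    rw [walkSteps_apply_eq (S := {ξ | walkPosition x ξ (n + 1) ∈ K})
      (measurable_walkPosition x _ K.measurableSet),
      Function.iterate_succ_apply']
    simp only [mem_ofPred_eq, walkPosition_stepCons, stepMean]
    simp only [ih]

/-- The probability that the walk from `x` visits `K`, time `0` included. -/
def hitProb (K : Finset (Fin d → ℤ)) (x : Fin d → ℤ) : ℝ≥0∞ :=
  walkSteps d {ξ | ∃ n, walkPosition x ξ n ∈ K}

/-- The probability that the walk from `x` does not visit `K` at positive times. -/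
def escapeProb (K : Finset (Fin d → ℤ)) (x : Fin d → ℤ) : ℝ≥0∞ :=
  walkSteps d {ξ | ∀ n, 1 ≤ n → walkPosition x ξ n ∉ K}

lemma hitProb_le_green [NeZero d] (K : Finset (Fin d → ℤ)) (x : Fin d → ℤ) :
    hitProb K x ≤ green (indicator (K : Set (Fin d → ℤ)) 1) x := by
  unfold hitProb green
  rw [ofPred_exists]
  refine (measure_iUnion_le _).trans (le_of_eq (tsum_congr fun n => ?_))
  exact walkSteps_position_mem K n x

lemma measurableSet_hit_pos (K : Finset (Fin d → ℤ)) (x : Fin d → ℤ) :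
    MeasurableSet {ξ : ℕ → Dir d | ∃ n, walkPosition x ξ (n + 1) ∈ K} := by
  rw [ofPred_exists]
  exact MeasurableSet.iUnion fun n =>
    measurable_walkPosition x (n + 1) K.measurableSet

lemma hit_pos_eq [NeZero d] (K : Finset (Fin d → ℤ)) (x : Fin d → ℤ) :
    walkSteps d {ξ | ∃ n, walkPosition x ξ (n + 1) ∈ K} = stepMean (hitProb K) x := by
  rw [walkSteps_apply_eq (measurableSet_hit_pos K x)]
  simp only [mem_ofPred_eq, walkPosition_stepCons, stepMean, hitProb]

/-- A walk that hits `K` either starts in `K` and never returns, or hits `K` at a positive time. -/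
lemma hitProb_eq [NeZero d] (K : Finset (Fin d → ℤ)) :
    hitProb K = indicator (K : Set (Fin d → ℤ)) (escapeProb K) + stepMean (hitProb K) := by
  ext x
  rw [Pi.add_apply, ← hit_pos_eq]
  by_cases h : x ∈ K
  · rw [indicator_of_mem (by simpa using h)]
    have h1 : hitProb K x = 1 := by
      unfold hitProb
      have : {ξ : ℕ → Dir d | ∃ n, walkPosition x ξ n ∈ K} = univ := by
        ext ξ; simp only [mem_ofPred_eq, mem_univ, iff_true]; exact ⟨0, by rwa [walkPosition_zero]⟩
      rw [this, measure_univ]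
    have h2 : {ξ : ℕ → Dir d | ∀ n, 1 ≤ n → walkPosition x ξ n ∉ K} =
        {ξ : ℕ → Dir d | ∃ n, walkPosition x ξ (n + 1) ∈ K}ᶜ := by
      ext ξ
      simp only [mem_ofPred_eq, mem_compl_iff, not_exists]
      constructor
      · intro h n; exact h (n + 1) (by omega)
      · intro h n hn
        obtain ⟨m, rfl⟩ := Nat.exists_eq_add_of_le' hn
        exact h m
    rw [h1, escapeProb, h2, add_comm, prob_add_prob_compl (measurableSet_hit_pos K x)]
  · rw [indicator_of_notMem (by simpa using h), zero_add]
    unfold hitProb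
    congr 1
    ext ξ
    simp only [mem_ofPred_eq]
    constructor
    · rintro ⟨n, hn⟩
      cases n with
      | zero => rw [walkPosition_zero] at hn; exact absurd hn h
      | succ n => exact ⟨n, hn⟩
    · rintro ⟨n, hn⟩; exact ⟨n + 1, hn⟩

lemma stepMean_iterate_green (φ : (Fin d → ℤ) → ℝ≥0∞) (n : ℕ) (x : Fin d → ℤ) :
    stepMean^[n] (green φ) x = ∑' k, stepMean^[k + n] φ x := by
  induction n generalizing x with
  | zero => rfl
  | succ n ih =>
    rw [Function.iterate_succ_apply']
    have : stepMean^[n] (green φ) = fun x => ∑' k, stepMean^[k + n] φ x := funext ih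
    rw [this, stepMean_tsum]
    simp only [← add_assoc, Function.iterate_succ_apply']

/-- Last exit decomposition: the Green function of the escape probability on `K` is the hitting
probability. The remainder `stepMean^[n] (hitProb K)` vanishes because it is at most a tail of the
convergent series for the expected number of visits to `K`. -/
lemma green_escapeProb [NeZero d] (K : Finset (Fin d → ℤ))
    (hK : ∀ x, green (indicator (K : Set (Fin d → ℤ)) 1) x ≠ ∞) :
    green (indicator (K : Set (Fin d → ℤ)) (escapeProb K)) = hitProb K := by
  set b := indicator (K : Set (Fin d → ℤ)) (escapeProb K) with hb
  have hsum : ∀ n, (∑ k ∈ Finset.range n, stepMean^[k] b) + stepMean^[n] (hitProb K) =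
      hitProb K := by
    intro n
    induction n with
    | zero => simp
    | succ n ih =>
      conv_rhs => rw [← ih]
      rw [Finset.sum_range_succ, add_assoc, Function.iterate_succ_apply, ← stepMean_iterate_add,
        ← hitProb_eq]
  ext x
  have h1 : Tendsto (fun n => ∑ k ∈ Finset.range n, stepMean^[k] b x) atTop (𝓝 (green b x)) :=
    ENNReal.tendsto_nat_tsum _
  have h2 : Tendsto (fun n => stepMean^[n] (hitProb K) x) atTop (𝓝 0) := by
    refine tendsto_of_tendsto_of_tendsto_of_le_of_le tendsto_const_nhds
      (ENNReal.tendsto_sum_nat_add _ (hK x)) (fun _ => bot_le) fun n => ?_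
    rw [← stepMean_iterate_green]
    exact stepMean_iterate_mono n (hitProb_le_green K) x
  have h3 := h1.add h2
  rw [add_zero] at h3
  refine tendsto_nhds_unique h3 ?_
  refine (tendsto_congr fun n => ?_).2 tendsto_const_nhds
  have := congrFun (hsum n) x
  simpa using this

/-- The equilibrium measure of `K`, integrated against the Green potential of `B ⊆ K`, counts the
points of `B`. The factor `(2d)⁻¹` cancels the total edge weight `2d` in `equilibrium`. -/
lemma sum_equilibrium_mul_green [NeZero d] (K B : Finset (Fin d → ℤ)) (hB : B ⊆ K)
    (hK : ∀ x, green (indicator (K : Set (Fin d → ℤ)) 1) x ≠ ∞) :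
    ∑ x ∈ K, equilibrium K x * ((2 * d : ℝ≥0∞)⁻¹ * green (indicator (B : Set (Fin d → ℤ)) 1) x) =
      B.card := by
  have hd : (2 * d : ℝ≥0∞) ≠ 0 := by simp [NeZero.ne d]
  have hd' : (2 * d : ℝ≥0∞) ≠ ∞ := ENNReal.mul_ne_top (by simp) (by simp)
  have h1 : ∀ x ∈ K, equilibrium K x *
      ((2 * d : ℝ≥0∞)⁻¹ * green (indicator (B : Set (Fin d → ℤ)) 1) x) =
      indicator (K : Set (Fin d → ℤ)) (escapeProb K) x * green (indicator (B : Set (Fin d → ℤ)) 1) x := by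
    intro x hx
    rw [indicator_of_mem (by simpa using hx)]
    change 2 * d * escapeProb K x * _ = _
    rw [mul_comm (2 * (d : ℝ≥0∞)), mul_assoc, ← mul_assoc (2 * (d : ℝ≥0∞)),
      ENNReal.mul_inv_cancel hd hd', one_mul]
  rw [Finset.sum_congr rfl h1]
  have h2 := tsum_mul_green (indicator (K : Set (Fin d → ℤ)) (escapeProb K))
    (indicator (B : Set (Fin d → ℤ)) 1)
  rw [tsum_eq_sum (s := K) (fun x hx => by simp [hx]), green_escapeProb K hK,
    tsum_eq_sum (s := B) (fun x hx => by simp [hx])] at h2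
  rw [h2]
  have h3 : ∀ x ∈ B, hitProb K x * indicator (B : Set (Fin d → ℤ)) 1 x = 1 := by
    intro x hx
    have : {ξ : ℕ → Dir d | ∃ n, walkPosition x ξ n ∈ K} = univ := by
      ext ξ; simp only [mem_ofPred_eq, mem_univ, iff_true]
      exact ⟨0, by rw [walkPosition_zero]; exact hB hx⟩
    rw [indicator_of_mem (by simpa using hx), hitProb, this, measure_univ]; simp
  rw [Finset.sum_congr rfl h3]; simp

/-! ### A superharmonic function and bounds on the Green function -/

/-- Second-order Taylor bound; the exact coefficient of `s ^ 2` would be `5 / 32`, and the excess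
absorbs the remainder for `|s| ≤ 1 / 40`. Any coefficient below `3 / 16` suffices for
`sum_lyapunov_le` in dimension `3`. -/
lemma one_add_rpow_neg_quarter_le {s : ℝ} (hs : |s| ≤ 1 / 40) :
    (1 + s) ^ (-(1 / 4) : ℝ) ≤ 1 - s / 4 + 17 / 100 * s ^ 2 := by
  obtain ⟨h1, h2⟩ := abs_le.1 hs
  have hB : 0 ≤ 1 - s / 4 + 17 / 100 * s ^ 2 := by nlinarith [sq_nonneg s]
  have hs0 : 0 < 1 + s := by linarith
  have hs2 : s ^ 2 ≤ 1 / 1600 := by nlinarith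
  have key : 1 ≤ (1 + s) * (1 - s / 4 + 17 / 100 * s ^ 2) ^ 4 := by
    have hq : 1 - s + (211 / 200) * s ^ 2 - (6 / 10) * s ^ 2 * |s| ≤
        (1 - s / 4 + 17 / 100 * s ^ 2) ^ 4 := by
      have hβ : (1 - s / 4 + 17 / 100 * s ^ 2) ^ 4 = 1 - s + (211 / 200) * s ^ 2 +
          s ^ 2 * (-(229 / 400) * s + (0.17 ^ 2 * 6 + 4 * 3 * 0.17 / 16 + 1 / 256) * s ^ 2 +
            (- 3 * 0.17 ^ 2 - 0.17 / 16) * s ^ 3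
            + (4 * 0.17 ^ 3 + 6 / 16 * 0.17 ^ 2) * s ^ 4 - 0.17 ^ 3 * s ^ 5
            + 0.17 ^ 4 * s ^ 6) := by ring
      rw [hβ]
      have : -(6 / 10) * |s| ≤ (-(229 / 400) * s +
          (0.17 ^ 2 * 6 + 4 * 3 * 0.17 / 16 + 1 / 256) * s ^ 2 + (- 3 * 0.17 ^ 2 - 0.17 / 16) * s ^ 3
            + (4 * 0.17 ^ 3 + 6 / 16 * 0.17 ^ 2) * s ^ 4 - 0.17 ^ 3 * s ^ 5
            + 0.17 ^ 4 * s ^ 6) := by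
        have e1 : s ≤ |s| := le_abs_self s
        have h3 : s ^ 3 ≤ s ^ 2 / 10 := by nlinarith [sq_nonneg s]
        have h5 : s ^ 5 ≤ s ^ 2 / 10 := by
          have : s ^ 5 = s ^ 2 * (s ^ 2 * s) := by ring
          rw [this]
          have : s ^ 2 * s ≤ 1 / 10 := by nlinarith [sq_nonneg s]
          nlinarith [sq_nonneg s]
        have h4 : 0 ≤ s ^ 4 := by positivity
        have h6 : 0 ≤ s ^ 6 := by positivity
        have := sq_nonneg s
        have := abs_nonneg s
        norm_num
        linarith
      nlinarith [sq_nonneg s]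
    have ha : |s| ≤ 1 / 40 := hs
    have := abs_nonneg s
    have h3 : -(s ^ 2 / 40) ≤ s ^ 3 := by nlinarith [sq_nonneg s]
    calc (1 : ℝ) ≤ (1 + s) * (1 - s + (211 / 200) * s ^ 2 - (6 / 10) * s ^ 2 * |s|) := by
          rcases abs_cases s with ⟨h, _⟩ | ⟨h, _⟩ <;> rw [h] at * <;>
            nlinarith [sq_nonneg s, mul_nonneg (sq_nonneg s) (sub_nonneg.2 h2), mul_nonneg (sq_nonneg s) (sq_nonneg s)]
      _ ≤ _ := by gcongr
  have hle : (1 + s)⁻¹ ≤ (1 - s / 4 + 17 / 100 * s ^ 2) ^ 4 := by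
    rw [inv_le_iff_one_le_mul₀' hs0]; exact key
  have := Real.rpow_le_rpow (by positivity) hle (show (0 : ℝ) ≤ 1 / 4 by norm_num)
  rw [← Real.rpow_natCast, ← Real.rpow_mul hB] at this
  norm_num at this
  rw [Real.inv_rpow hs0.le, ← Real.rpow_neg hs0.le] at this
  norm_num at this ⊢
  linarith

/-- The squared Euclidean norm of a lattice point. -/
def sqNorm (x : Fin d → ℤ) : ℝ := ∑ i, (x i : ℝ) ^ 2

lemma sqNorm_nonneg (x : Fin d → ℤ) : 0 ≤ sqNorm x := Finset.sum_nonneg fun _ _ => sq_nonneg _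

lemma sq_le_sqNorm (x : Fin d → ℤ) (i : Fin d) : (x i : ℝ) ^ 2 ≤ sqNorm x :=
  Finset.single_le_sum (f := fun i => (x i : ℝ) ^ 2) (fun _ _ => sq_nonneg _) (Finset.mem_univ i)

/-- The sign of a direction, as a real number. -/
def dirSign (v : Dir d) : ℝ := if v.2 then 1 else -1

lemma sqNorm_add_unitVec (x : Fin d → ℤ) (v : Dir d) :
    sqNorm (x + unitVec v) = sqNorm x + (1 + 2 * dirSign v * x v.1) := by
  have : ∀ i, ((x + unitVec v) i : ℝ) ^ 2 =
      (x i : ℝ) ^ 2 + if i = v.1 then (1 + 2 * dirSign v * x v.1) else 0 := by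
    intro i
    by_cases h : i = v.1
    · subst h
      cases hv : v.2 <;> simp [unitVec, dirSign, hv] <;> ring
    · simp [unitVec, h]
  simp only [sqNorm, this, Finset.sum_add_distrib, Finset.sum_ite_eq', Finset.mem_univ, if_true]

/-- The function `(m + |x|²) ^ (-1/4)`, superharmonic for simple random walk when `d ≥ 3` and `m` is
large. The exponent is chosen in `(-1/2, 0)`, so that it works in all dimensions at once. -/
def lyapunov (m : ℝ) (x : Fin d → ℤ) : ℝ := (m + sqNorm x) ^ (-(1 / 4) : ℝ)

lemma lyapunov_nonneg {m : ℝ} (hm : 0 ≤ m) (x : Fin d → ℤ) : 0 ≤ lyapunov m x :=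
  Real.rpow_nonneg (add_nonneg hm (sqNorm_nonneg x)) _

/-- Superharmonicity of `lyapunov m` with a quantitative defect. -/
lemma sum_lyapunov_le (hd : 3 ≤ d) {m : ℝ} (hm : 14400 ≤ m) (x : Fin d → ℤ) :
    (2 * d : ℝ)⁻¹ * ∑ v : Dir d, lyapunov m (x + unitVec v) ≤
      lyapunov m x - (m + sqNorm x) ^ (-(5 / 4) : ℝ) / 50 := by
  set n := m + sqNorm x with hn
  have hx0 := sqNorm_nonneg x
  have hn9 : 14400 ≤ n := by linarith
  have hn0 : 0 < n := by linarith
  have hd0 : (3 : ℝ) ≤ d := by exact_mod_cast hd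
  have hstep : ∀ v : Dir d, lyapunov m (x + unitVec v) ≤ n ^ (-(1 / 4) : ℝ) *
      (1 - (1 + 2 * dirSign v * x v.1) / n / 4
        + 17 / 100 * ((1 + 2 * dirSign v * x v.1) / n) ^ 2) := by
    intro v
    set s := (1 + 2 * dirSign v * x v.1) / n with hs
    have hsmall : |s| ≤ 1 / 40 := by
      have h1 : |(x v.1 : ℝ)| ≤ n / 120 := by
        apply abs_le_of_sq_le_sq _ (by linarith)
        have := sq_le_sqNorm x v.1
        nlinarith
      have hd1 : |dirSign v| = 1 := by unfold dirSign; split_ifs <;> simp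
      have h2 : |1 + 2 * dirSign v * x v.1| ≤ n / 40 := by
        refine (abs_add_le _ _).trans ?_
        rw [abs_mul, abs_mul, hd1]
        norm_num
        linarith
      rw [hs, abs_div, abs_of_pos hn0, div_le_iff₀ hn0]
      linarith
    have hfac : m + sqNorm (x + unitVec v) = n * (1 + s) := by
      rw [sqNorm_add_unitVec, hs]; field_simp; linarith
    have h1s : 0 ≤ 1 + s := by have := (abs_le.1 hsmall).1; linarith
    rw [lyapunov, hfac, Real.mul_rpow hn0.le h1s]
    exact mul_le_mul_of_nonneg_left (one_add_rpow_neg_quarter_le hsmall)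
      (Real.rpow_nonneg hn0.le _)
  have hsum1 : ∑ v : Dir d, (1 + 2 * dirSign v * (x v.1 : ℝ)) = 2 * d := by
    rw [Fintype.sum_prod_type]
    simp [dirSign]; ring_nf; simp
  have hsum2 : ∑ v : Dir d, (1 + 2 * dirSign v * (x v.1 : ℝ)) ^ 2 = 2 * d + 8 * sqNorm x := by
    rw [Fintype.sum_prod_type, sqNorm, Finset.mul_sum]
    have : ∀ i : Fin d, ∑ b : Bool, (1 + 2 * dirSign (i, b) * (x i : ℝ)) ^ 2 =
        2 + 8 * (x i : ℝ) ^ 2 := by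
      intro i; simp [dirSign]; ring
    simp only [this, Finset.sum_add_distrib]
    simp [mul_comm]
  have hpow : n ^ (-(5 / 4) : ℝ) = n ^ (-(1 / 4) : ℝ) * n⁻¹ := by
    rw [← Real.rpow_neg_one, ← Real.rpow_add hn0]; norm_num
  have hA : 0 < n ^ (-(1 / 4) : ℝ) := Real.rpow_pos_of_pos hn0 _
  calc _ ≤ (2 * d : ℝ)⁻¹ * ∑ v : Dir d, n ^ (-(1 / 4) : ℝ) *
        (1 - (1 + 2 * dirSign v * x v.1) / n / 4
        + 17 / 100 * ((1 + 2 * dirSign v * x v.1) / n) ^ 2) := by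
        gcongr with v; exact hstep v
    _ = n ^ (-(1 / 4) : ℝ) * (1 - n⁻¹ / 4 + 17 / 100 * n⁻¹ ^ 2 * (1 + 4 * sqNorm x / d)) := by
        rw [← Finset.mul_sum, Finset.sum_add_distrib, Finset.sum_sub_distrib]
        simp only [div_pow, ← Finset.sum_div, ← Finset.mul_sum, hsum1, hsum2]
        simp only [Finset.sum_const, Finset.card_univ, Fintype.card_prod, Fintype.card_fin,
          Fintype.card_bool, nsmul_eq_mul]
        push_cast
        field_simp
        ring
    _ ≤ n ^ (-(1 / 4) : ℝ) * (1 - n⁻¹ / 50) := by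
        gcongr
        have h1 : sqNorm x / d ≤ n / 3 := by
          gcongr; linarith
        have h2 : n⁻¹ * n = 1 := inv_mul_cancel₀ hn0.ne'
        have h3 : n⁻¹ ≤ 1 / 14400 := by rw [inv_le_comm₀ hn0 (by norm_num)]; simpa using hn9
        have h4 : 0 < n⁻¹ := inv_pos.2 hn0
        have h5 : n⁻¹ ^ 2 * (1 + 4 * sqNorm x / d) ≤ n⁻¹ ^ 2 * (1 + 4 * (n / 3)) := by
          gcongr
          rw [mul_div_assoc]; linarith
        have h6 : n⁻¹ ^ 2 * (1 + 4 * (n / 3)) = n⁻¹ ^ 2 + 4 / 3 * n⁻¹ * (n⁻¹ * n) := by ring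
        rw [h6, h2] at h5
        nlinarith
    _ = _ := by rw [hpow, lyapunov]; ring

/-- The Green function of a set inside the ball `|x|² ≤ r` is dominated by a multiple of
`lyapunov m`. -/
lemma green_le_lyapunov (hd : 3 ≤ d) {m r : ℝ} (hm : 14400 ≤ m) (hr : 0 ≤ r)
    (B : Finset (Fin d → ℤ)) (hB : ∀ x ∈ B, sqNorm x ≤ r) (x : Fin d → ℤ) :
    green (indicator (B : Set (Fin d → ℤ)) 1) x ≤
      ENNReal.ofReal (50 * (m + r) ^ (5 / 4 : ℝ) * lyapunov m x) := by
  have hm0 : (0 : ℝ) ≤ m := by linarith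
  refine green_le_of_superharmonic (ψ := fun x => ENNReal.ofReal (50 * (m + r) ^ (5 / 4 : ℝ) *
    lyapunov m x)) (fun x => ?_) x
  set c := 50 * (m + r) ^ (5 / 4 : ℝ) with hc
  have hc0 : 0 ≤ c := by positivity
  have hnonneg : ∀ y : Fin d → ℤ, 0 ≤ c * lyapunov m y := fun y => mul_nonneg hc0 (lyapunov_nonneg hm0 y)
  have hd0 : (0 : ℝ) < 2 * d := by
    have : (3 : ℝ) ≤ d := by exact_mod_cast hd
    linarith
  have hstep : stepMean (fun x => ENNReal.ofReal (c * lyapunov m x)) x =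
      ENNReal.ofReal (c * ((2 * d : ℝ)⁻¹ * ∑ v : Dir d, lyapunov m (x + unitVec v))) := by
    unfold stepMean
    rw [← ENNReal.ofReal_sum_of_nonneg (fun v _ => hnonneg _), ← Finset.mul_sum,
      mul_left_comm, ENNReal.ofReal_mul (inv_nonneg.2 hd0.le), ENNReal.ofReal_inv_of_pos hd0,
      ENNReal.ofReal_mul hc0]
    simp
  rw [Pi.add_apply, hstep]
  have hind : indicator (B : Set (Fin d → ℤ)) (1 : (Fin d → ℤ) → ℝ≥0∞) x ≤
      ENNReal.ofReal (c * ((m + sqNorm x) ^ (-(5 / 4) : ℝ) / 50)) := by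
    by_cases hx : x ∈ B
    · rw [indicator_of_mem (by simpa using hx), Pi.one_apply, ENNReal.one_le_ofReal]
      have h0 : 0 < m + sqNorm x := by have := sqNorm_nonneg x; linarith
      have h1 : (m + sqNorm x) ^ (5 / 4 : ℝ) ≤ (m + r) ^ (5 / 4 : ℝ) := by
        have := hB x hx
        gcongr
      have h2 : (m + sqNorm x) ^ (5 / 4 : ℝ) * (m + sqNorm x) ^ (-(5 / 4) : ℝ) = 1 := by
        rw [← Real.rpow_add h0]; norm_num
      have h3 : 0 < (m + sqNorm x) ^ (-(5 / 4) : ℝ) := Real.rpow_pos_of_pos h0 _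
      calc (1 : ℝ) = (m + sqNorm x) ^ (5 / 4 : ℝ) * (m + sqNorm x) ^ (-(5 / 4) : ℝ) := h2.symm
        _ ≤ (m + r) ^ (5 / 4 : ℝ) * (m + sqNorm x) ^ (-(5 / 4) : ℝ) := by gcongr
        _ = _ := by rw [hc]; ring
    · rw [indicator_of_notMem (by simpa using hx)]; exact bot_le
  refine (add_le_add_left hind _).trans ?_
  rw [← ENNReal.ofReal_add]
  · refine ENNReal.ofReal_le_ofReal ?_
    have := mul_le_mul_of_nonneg_left (sum_lyapunov_le hd hm x) hc0
    linarith
  · have := sqNorm_nonneg x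
    positivity
  · refine mul_nonneg hc0 (mul_nonneg (inv_nonneg.2 hd0.le) (Finset.sum_nonneg fun v _ => ?_))
    exact lyapunov_nonneg hm0 _

lemma tendsto_lyapunov (m : ℝ) :
    Tendsto (lyapunov (d := d) m) cofinite (𝓝 0) := by
  have h : Tendsto (fun x : Fin d → ℤ => m + sqNorm x) cofinite atTop := by
    refine tendsto_atTop_add_const_left _ _ ?_
    refine tendsto_atTop.2 fun b => ?_
    obtain ⟨M, hM⟩ := exists_nat_ge (max b 1)
    have hfin : ((Fintype.piFinset fun _ : Fin d => Finset.Icc (-(M : ℤ)) M : Finset _) : Set (Fin d → ℤ)).Finite :=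
      Finset.finite_toSet _
    filter_upwards [hfin.compl_mem_cofinite] with x hx
    simp only [Finset.mem_coe, mem_compl_iff, Fintype.mem_piFinset, Finset.mem_Icc, not_forall] at hx
    obtain ⟨i, hi⟩ := hx
    have h1 : (M : ℝ) ≤ |(x i : ℝ)| := by
      have : (M : ℤ) ≤ |x i| := by
        rw [← abs_le, not_le] at hi
        exact hi.le
      exact_mod_cast this
    have hM1 : (1 : ℝ) ≤ M := (le_max_right _ _).trans hM
    have hMb : b ≤ M := (le_max_left _ _).trans hM
    have h2 := sq_le_sqNorm x i
    rw [← sq_abs] at h2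
    nlinarith
  exact (tendsto_rpow_neg_atTop (show (0 : ℝ) < 1 / 4 by norm_num)).comp h

lemma finset_sqNorm_bdd (B : Finset (Fin d → ℤ)) : ∃ r : ℝ, 0 ≤ r ∧ ∀ x ∈ B, sqNorm x ≤ r :=
  ⟨∑ x ∈ B, sqNorm x, Finset.sum_nonneg fun _ _ => sqNorm_nonneg _, fun _ hx =>
    Finset.single_le_sum (f := sqNorm) (fun _ _ => sqNorm_nonneg _) hx⟩

/-- Transience: the walk makes finitely many visits to `B` in expectation. -/
lemma green_indicator_ne_top (hd : 3 ≤ d) (B : Finset (Fin d → ℤ)) (x : Fin d → ℤ) :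
    green (indicator (B : Set (Fin d → ℤ)) 1) x ≠ ∞ := by
  obtain ⟨r, hr, hB⟩ := finset_sqNorm_bdd B
  exact ne_top_of_le_ne_top ENNReal.ofReal_ne_top (green_le_lyapunov hd le_rfl hr B hB x)

lemma tendsto_green_indicator (hd : 3 ≤ d) (B : Finset (Fin d → ℤ)) :
    Tendsto (fun x => (green (indicator (B : Set (Fin d → ℤ)) 1) x).toReal) cofinite (𝓝 0) := by
  obtain ⟨r, hr, hB⟩ := finset_sqNorm_bdd B
  have h := (tendsto_lyapunov (d := d) 14400).const_mul
    (50 * (14400 + r) ^ (5 / 4 : ℝ))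
  rw [mul_zero] at h
  refine squeeze_zero (fun _ => ENNReal.toReal_nonneg) (fun x => ?_) h
  refine ENNReal.toReal_le_of_le_ofReal ?_ (green_le_lyapunov hd le_rfl hr B hB x)
  exact mul_nonneg (by positivity) (lyapunov_nonneg (by norm_num) x)

/-- The walk spends an expected time `O(R²)` in a box of side `R`. -/
lemma exists_green_box_le (hd : 3 ≤ d) : ∃ C : ℝ, 0 < C ∧ ∀ R : ℕ, 1 ≤ R → ∀ x : Fin d → ℤ,
    green (indicator ((Fintype.piFinset fun _ : Fin d => Finset.Ico (0 : ℤ) R : Finset _) :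
      Set (Fin d → ℤ)) 1) x ≤ ENNReal.ofReal (C * (R : ℝ) ^ 2) := by
  refine ⟨50 * (14400 + d) ^ (5 / 4 : ℝ), by positivity, fun R hR x => ?_⟩
  have hR1 : (1 : ℝ) ≤ R := by exact_mod_cast hR
  have hR2 : (1 : ℝ) ≤ (R : ℝ) ^ 2 := one_le_pow₀ hR1
  -- at the scale `m ≍ R²` the bound `(m + r) ^ (5 / 4) * m ^ (-1 / 4)` is of order `R²`
  have h := green_le_lyapunov hd (m := 14400 * (R : ℝ) ^ 2) (r := d * (R : ℝ) ^ 2) (by nlinarith)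
    (by positivity) (Fintype.piFinset fun _ : Fin d => Finset.Ico (0 : ℤ) R) (fun y hy => by
      rw [Fintype.mem_piFinset] at hy
      have : ∀ i, (y i : ℝ) ^ 2 ≤ (R : ℝ) ^ 2 := by
        intro i
        have := hy i
        rw [Finset.mem_Ico] at this
        have h0 : (0 : ℝ) ≤ y i := by exact_mod_cast this.1
        have h1 : (y i : ℝ) ≤ R := by exact_mod_cast this.2.le
        gcongr
      calc sqNorm y ≤ ∑ _i : Fin d, (R : ℝ) ^ 2 := Finset.sum_le_sum fun i _ => this i
        _ = _ := by simp) x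
  refine h.trans (ENNReal.ofReal_le_ofReal ?_)
  have h1 : lyapunov (14400 * (R : ℝ) ^ 2) x ≤ ((R : ℝ) ^ 2) ^ (-(1 / 4) : ℝ) := by
    unfold lyapunov
    refine Real.rpow_le_rpow_of_nonpos (by positivity) ?_ (by norm_num)
    have := sqNorm_nonneg x
    nlinarith
  have h2 : (14400 * (R : ℝ) ^ 2 + d * (R : ℝ) ^ 2) ^ (5 / 4 : ℝ) =
      (14400 + d) ^ (5 / 4 : ℝ) * ((R : ℝ) ^ 2) ^ (5 / 4 : ℝ) := by
    rw [← add_mul, Real.mul_rpow (by positivity) (by positivity)]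
  have h3 : ((R : ℝ) ^ 2) ^ (5 / 4 : ℝ) * ((R : ℝ) ^ 2) ^ (-(1 / 4) : ℝ) = (R : ℝ) ^ 2 := by
    rw [← Real.rpow_add (by positivity)]; norm_num
  rw [h2]
  calc _ ≤ 50 * ((14400 + d : ℝ) ^ (5 / 4 : ℝ) * ((R : ℝ) ^ 2) ^ (5 / 4 : ℝ)) *
        ((R : ℝ) ^ 2) ^ (-(1 / 4) : ℝ) := by gcongr
    _ = 50 * (14400 + d : ℝ) ^ (5 / 4 : ℝ) * (((R : ℝ) ^ 2) ^ (5 / 4 : ℝ) *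
        ((R : ℝ) ^ 2) ^ (-(1 / 4) : ℝ)) := by ring
    _ = _ := by rw [h3]

/-! ### Geometry of the cable system and radial sums -/

lemma continuous_edgePoint (x : Fin d → ℤ) (v : Dir d) : Continuous (edgePoint x v) := by
  unfold edgePoint
  fun_prop

lemma unitVec_self (v : Dir d) : (unitVec v v.1 : ℤ) = if v.2 then 1 else -1 := by simp [unitVec]

lemma unitVec_of_ne (v : Dir d) {j : Fin d} (h : j ≠ v.1) : unitVec v j = 0 := by simp [unitVec, h]

lemma abs_unitVec_self (v : Dir d) : |((unitVec v v.1 : ℤ) : ℝ)| = 1 := by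
  rw [unitVec_self]; split_ifs <;> simp

/-- A point that differs from the vertex `y` in one coordinate only. -/
lemma dist_cable_eq_of (z : Cable d) (y : Fin d → ℤ) (i : Fin d)
    (h : ∀ j, j ≠ i → z.1 j = y j) : dist z (vertex y) = |z.1 i - y i| := by
  rw [Subtype.dist_eq]
  refine le_antisymm ((dist_pi_le_iff (abs_nonneg _)).2 fun j => ?_) ?_
  · by_cases hj : j = i
    · subst hj; exact le_of_eq (Real.dist_eq _ _)
    · rw [h j hj]; simp [vertex]
  · rw [← Real.dist_eq]
    exact dist_le_pi_dist z.1 (vertex y).1 i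

lemma dist_edgePoint_left (x : Fin d → ℤ) (v : Dir d) {t : ℝ} (ht : 0 ≤ t) :
    dist (edgePoint x v t) (vertex x) = 2 * t := by
  rw [dist_cable_eq_of _ _ v.1 (fun j hj => by simp [edgePoint, unitVec_of_ne v hj])]
  simp [edgePoint, abs_mul, abs_unitVec_self, abs_of_nonneg ht]

lemma dist_edgePoint_right (x : Fin d → ℤ) (v : Dir d) {t : ℝ} (ht : t ≤ 1 / 2) :
    dist (edgePoint x v t) (vertex (x + unitVec v)) = 1 - 2 * t := by
  rw [dist_cable_eq_of _ _ v.1 (fun j hj => by simp [edgePoint, unitVec_of_ne v hj])]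
  have : (edgePoint x v t).1 v.1 - ((x + unitVec v) v.1 : ℤ) =
      -((1 - 2 * t) * ((unitVec v v.1 : ℤ) : ℝ)) := by
    simp [edgePoint]; ring
  rw [this, abs_neg, abs_mul, abs_unitVec_self, mul_one, abs_of_nonneg (by linarith)]

/-- The only vertices at distance less than `1` from a point of an edge are its endpoints. -/
lemma one_le_dist_edgePoint (x : Fin d → ℤ) (v : Dir d) {t : ℝ} (ht : t ∈ Icc (0 : ℝ) (1 / 2))
    {y : Fin d → ℤ} (h1 : y ≠ x) (h2 : y ≠ x + unitVec v) :
    1 ≤ dist (edgePoint x v t) (vertex y) := by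
  have hcoord : ∀ i, |(edgePoint x v t).1 i - y i| ≤ dist (edgePoint x v t) (vertex y) := fun i => by
    rw [Subtype.dist_eq, ← Real.dist_eq]
    exact dist_le_pi_dist (edgePoint x v t).1 (vertex y).1 i
  by_cases h : ∃ i, i ≠ v.1 ∧ y i ≠ x i
  · obtain ⟨i, hi, hne⟩ := h
    refine le_trans ?_ (hcoord i)
    simp only [edgePoint, unitVec_of_ne v hi, Int.cast_zero, mul_zero, add_zero]
    have : 1 ≤ |x i - y i| := Int.one_le_abs (sub_ne_zero.2 (Ne.symm hne))
    exact_mod_cast this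
  · push Not at h
    refine le_trans ?_ (hcoord v.1)
    have e1 : y v.1 ≠ x v.1 := fun e => h1 (funext fun i => by
      by_cases hi : i = v.1
      · rw [hi, e]
      · exact h i hi)
    have e2 : y v.1 ≠ x v.1 + unitVec v v.1 := fun e => h2 (funext fun i => by
      by_cases hi : i = v.1
      · rw [hi, e]; rfl
      · rw [h i hi, Pi.add_apply, unitVec_of_ne v hi, add_zero])
    simp only [edgePoint]
    rw [unitVec_self] at e2 ⊢
    obtain ⟨ht0, ht1⟩ := ht
    rcases v with ⟨i, s⟩
    cases s <;> simp only [Bool.false_eq_true, if_true, if_false] at e1 e2 ⊢ <;> push_cast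
    · rcases lt_or_gt_of_ne e1 with hl | hl
      · have : y i + 2 ≤ x i := by omega
        have : (y i : ℝ) + 2 ≤ x i := by exact_mod_cast this
        rw [abs_of_nonneg (by linarith)]; linarith
      · have : x i + 1 ≤ y i := by omega
        have : (x i : ℝ) + 1 ≤ y i := by exact_mod_cast this
        rw [abs_of_nonpos (by linarith)]; linarith
    · rcases lt_or_gt_of_ne e1 with hl | hl
      · have : y i + 1 ≤ x i := by omega
        have : (y i : ℝ) + 1 ≤ x i := by exact_mod_cast this
        rw [abs_of_nonneg (by linarith)]; linarith
      · have : x i + 2 ≤ y i := by omega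
        have : (x i : ℝ) + 2 ≤ y i := by exact_mod_cast this
        rw [abs_of_nonpos (by linarith)]; linarith

lemma add_unitVec_ne (x : Fin d → ℤ) (v : Dir d) : x + unitVec v ≠ x := by
  intro h
  have := congrFun h v.1
  simp only [Pi.add_apply, unitVec_self] at this
  split_ifs at this <;> omega

lemma exists_edgePoint [NeZero d] (z : Cable d) :
    ∃ (x : Fin d → ℤ) (v : Dir d) (t : ℝ), t ∈ Icc (0 : ℝ) (1 / 2) ∧ z = edgePoint x v t := by
  have key : ∃ i, ∀ j, j ≠ i → ∃ n : ℤ, z.1 j = n := by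
    by_cases h : ∃ i, ¬ ∃ n : ℤ, z.1 i = n
    · obtain ⟨i, hi⟩ := h
      exact ⟨i, fun j hj => (z.2 j i hj).resolve_right hi⟩
    · push Not at h
      exact ⟨0, fun j _ => h j⟩
  obtain ⟨i, hi⟩ := key
  refine ⟨fun j => ⌊z.1 j⌋, (i, true), Int.fract (z.1 i) / 2,
    ⟨by have := Int.fract_nonneg (z.1 i); linarith,
      by have := (Int.fract_lt_one (z.1 i)).le; linarith⟩, ?_⟩
  refine Subtype.ext (funext fun j => ?_)
  simp only [edgePoint]
  by_cases hj : j = i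
  · subst hj
    simp only [unitVec, Pi.single_eq_same, if_true]
    push_cast
    rw [mul_one, mul_div_cancel₀ _ (two_ne_zero), Int.floor_add_fract]
  · obtain ⟨n, hn⟩ := hi j hj
    simp [unitVec, hj, hn]

lemma isClosed_cable : IsClosed {z : Fin d → ℝ | ∀ i j, i ≠ j →
    (∃ n : ℤ, z i = n) ∨ (∃ n : ℤ, z j = n)} := by
  have h : ∀ i, IsClosed {z : Fin d → ℝ | ∃ n : ℤ, z i = n} := fun i => by
    have : {z : Fin d → ℝ | ∃ n : ℤ, z i = n} = (fun z => z i) ⁻¹' range ((↑) : ℤ → ℝ) := by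
      ext z; simp [eq_comm]
    rw [this]
    exact Int.isClosedEmbedding_coe_real.isClosed_range.preimage (continuous_apply i)
  simp only [ofPred_forall, ofPred_or]
  exact isClosed_iInter fun i => isClosed_iInter fun j => isClosed_iInter fun _ => (h i).union (h j)

instance : ProperSpace (Cable d) := by
  have := (isClosed_cable (d := d)).isClosedEmbedding_subtypeVal
  exact ⟨fun x r => by
    have h := this.isCompact_preimage (isCompact_closedBall x.1 r)
    exact h⟩

/-- The sum over vertices `x` of a radial profile `p x` around `x`. It is used for profiles supported
in `[0, 1)`, so that on an edge only the two endpoints contribute. Distances are those of `ℝ^d`,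
twice the length on the cable. -/
def radialSum (p : (Fin d → ℤ) → ℝ → ℝ) (z : Cable d) : ℝ := ∑' x, p x (dist z (vertex x))

lemma radialSum_edgePoint {p : (Fin d → ℤ) → ℝ → ℝ} (hp : ∀ x s, 1 ≤ s → p x s = 0)
    (x : Fin d → ℤ) (v : Dir d) {t : ℝ} (ht : t ∈ Icc (0 : ℝ) (1 / 2)) :
    radialSum p (edgePoint x v t) = p x (2 * t) + p (x + unitVec v) (1 - 2 * t) := by
  classical
  unfold radialSum
  rw [tsum_eq_sum (s := {x, x + unitVec v}) (fun y hy => ?_),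
    Finset.sum_pair (add_unitVec_ne x v).symm, dist_edgePoint_left x v ht.1,
    dist_edgePoint_right x v ht.2]
  simp only [Finset.mem_insert, Finset.mem_singleton, not_or] at hy
  exact hp _ _ (one_le_dist_edgePoint x v ht hy.1 hy.2)

lemma radialSum_vertex [NeZero d] {p : (Fin d → ℤ) → ℝ → ℝ} (hp : ∀ x s, 1 ≤ s → p x s = 0)
    (x : Fin d → ℤ) : radialSum p (vertex x) = p x 0 := by
  have h := radialSum_edgePoint hp x (0, true) (t := 0) (by norm_num)
  have e : edgePoint x (0, true) 0 = vertex x := Subtype.ext (by simp [edgePoint, vertex])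
  rw [e] at h
  rw [h, hp _ (1 - 2 * 0) (by norm_num)]
  simp

lemma radialSum_eq_sum {p : (Fin d → ℤ) → ℝ → ℝ} {S : Finset (Fin d → ℤ)}
    (hS : ∀ x ∉ S, ∀ s, p x s = 0) :
    radialSum p = fun z => ∑ x ∈ S, p x (dist z (vertex x)) := by
  ext z
  exact tsum_eq_sum fun x hx => hS x hx _

lemma continuous_radialSum {p : (Fin d → ℤ) → ℝ → ℝ} {S : Finset (Fin d → ℤ)}
    (hS : ∀ x ∉ S, ∀ s, p x s = 0) (hc : ∀ x, Continuous (p x)) : Continuous (radialSum p) := by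
  rw [radialSum_eq_sum hS]
  exact continuous_finsetSum _ fun x _ => (hc x).comp (by fun_prop)

lemma hasCompactSupport_radialSum {p : (Fin d → ℤ) → ℝ → ℝ} (hp : ∀ x s, 1 ≤ s → p x s = 0)
    {S : Finset (Fin d → ℤ)} (hS : ∀ x ∉ S, ∀ s, p x s = 0) : HasCompactSupport (radialSum p) := by
  refine HasCompactSupport.intro (K := ⋃ x ∈ S, Metric.closedBall (vertex x) 1)
    (S.isCompact_biUnion fun x _ => isCompact_closedBall _ _) fun z hz => ?_
  rw [radialSum_eq_sum hS]
  refine Finset.sum_eq_zero fun x hx => hp x _ ?_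
  simp only [mem_iUnion, Metric.mem_closedBall, not_exists, not_le] at hz
  exact (hz x hx).le

/-! ### Bump functions and their iterated integrals -/

/-- `k` is a continuous probability density on `[0, 1]` supported in `[0, ρ]`; it is a smooth
substitute for the point mass at `0`. Only its values at nonnegative arguments are used. -/
structure IsBump (k : ℝ → ℝ) (ρ : ℝ) : Prop where
  continuous : Continuous k
  nonneg : ∀ s, 0 ≤ k s
  eq_zero : ∀ s, ρ ≤ s → k s = 0
  integral_eq : ∫ s in (0 : ℝ)..1, k s = 1
  pos : 0 < ρ
  le_one : ρ ≤ 1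

/-- The tail `∫ₛ¹ k`, a primitive of `-k`. -/
def tail1 (k : ℝ → ℝ) (s : ℝ) : ℝ := ∫ τ in s..1, k τ

/-- The integrated tail: `tail2 k` has second derivative `k` and vanishes to first order beyond the
support of `k`. -/
def tail2 (k : ℝ → ℝ) (s : ℝ) : ℝ := ∫ τ in s..1, tail1 k τ

lemma hasDerivAt_tail {k : ℝ → ℝ} (hk : Continuous k) (s : ℝ) :
    HasDerivAt (fun s => ∫ τ in s..1, k τ) (-k s) s :=
  intervalIntegral.integral_hasDerivAt_left (hk.intervalIntegrable _ _)
    hk.stronglyMeasurable.stronglyMeasurableAtFilter hk.continuousAt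

lemma continuous_tail1 {k : ℝ → ℝ} (hk : Continuous k) : Continuous (tail1 k) :=
  continuous_iff_continuousAt.2 fun s => (hasDerivAt_tail hk s).continuousAt

namespace IsBump
variable {k : ℝ → ℝ} {ρ : ℝ}

lemma hasDerivAt_tail1 (hk : IsBump k ρ) (s : ℝ) : HasDerivAt (tail1 k) (-k s) s :=
  hasDerivAt_tail hk.continuous s

lemma hasDerivAt_tail2 (hk : IsBump k ρ) (s : ℝ) : HasDerivAt (tail2 k) (-tail1 k s) s :=
  hasDerivAt_tail (continuous_tail1 hk.continuous) s

lemma continuous_tail2 (hk : IsBump k ρ) : Continuous (tail2 k) :=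
  continuous_iff_continuousAt.2 fun s => (hk.hasDerivAt_tail2 s).continuousAt

lemma tail1_zero (hk : IsBump k ρ) : tail1 k 0 = 1 := hk.integral_eq

lemma tail1_of_ge (hk : IsBump k ρ) {s : ℝ} (hs : ρ ≤ s) : tail1 k s = 0 := by
  unfold tail1
  refine intervalIntegral.integral_zero_ae (ae_of_all _ fun τ hτ => hk.eq_zero _ ?_)
  have := hk.le_one
  rw [mem_uIoc] at hτ
  rcases hτ with h | h <;> linarith [h.1]

lemma tail2_of_ge (hk : IsBump k ρ) {s : ℝ} (hs : ρ ≤ s) : tail2 k s = 0 := by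
  unfold tail2
  refine intervalIntegral.integral_zero_ae (ae_of_all _ fun τ hτ => hk.tail1_of_ge ?_)
  have := hk.le_one
  rw [mem_uIoc] at hτ
  rcases hτ with h | h <;> linarith [h.1]

lemma tail1_nonneg (hk : IsBump k ρ) (s : ℝ) : 0 ≤ tail1 k s := by
  rcases le_or_gt ρ s with h | h
  · rw [hk.tail1_of_ge h]
  · exact intervalIntegral.integral_nonneg (h.le.trans hk.le_one) fun _ _ => hk.nonneg _

lemma tail1_le_one (hk : IsBump k ρ) {s : ℝ} (hs : 0 ≤ s) : tail1 k s ≤ 1 := by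
  have h := intervalIntegral.integral_add_adjacent_intervals
    (hk.continuous.intervalIntegrable (μ := volume) 0 s) (hk.continuous.intervalIntegrable s 1)
  have h0 : 0 ≤ ∫ τ in (0 : ℝ)..s, k τ := intervalIntegral.integral_nonneg hs fun _ _ => hk.nonneg _
  rw [hk.integral_eq] at h
  unfold tail1
  linarith

lemma tail2_nonneg (hk : IsBump k ρ) (s : ℝ) : 0 ≤ tail2 k s := by
  rcases le_or_gt ρ s with h | h
  · rw [hk.tail2_of_ge h]
  · exact intervalIntegral.integral_nonneg (h.le.trans hk.le_one) fun _ _ => hk.tail1_nonneg _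

lemma tail2_le (hk : IsBump k ρ) {s : ℝ} (hs : 0 ≤ s) : tail2 k s ≤ max (ρ - s) 0 := by
  rcases le_or_gt ρ s with h | h
  · rw [hk.tail2_of_ge h]; exact le_max_right _ _
  · have hc := continuous_tail1 hk.continuous
    have h1 := intervalIntegral.integral_add_adjacent_intervals
      (hc.intervalIntegrable (μ := volume) s ρ) (hc.intervalIntegrable ρ 1)
    have h2 : ∫ τ in ρ..1, tail1 k τ = 0 := hk.tail2_of_ge le_rfl
    have h3 : ∫ τ in s..ρ, tail1 k τ ≤ ∫ τ in s..ρ, (1 : ℝ) :=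
      intervalIntegral.integral_mono_on h.le (hc.intervalIntegrable _ _)
        (continuous_const.intervalIntegrable _ _) fun τ hτ => hk.tail1_le_one (hs.trans hτ.1)
    rw [intervalIntegral.integral_const, smul_eq_mul, mul_one] at h3
    refine le_trans ?_ (le_max_left _ _)
    unfold tail2
    linarith

lemma tail2_le_tent (hk : IsBump k ρ) {s : ℝ} (hs : 0 ≤ s) : tail2 k s ≤ max (1 - s) 0 :=
  (hk.tail2_le hs).trans (max_le_max (by linarith [hk.le_one]) le_rfl)

lemma tail2_le_radius (hk : IsBump k ρ) {s : ℝ} (hs : 0 ≤ s) : tail2 k s ≤ ρ :=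
  (hk.tail2_le hs).trans (max_le (by linarith) hk.pos.le)

end IsBump

/-! ### Potentials on the cable system -/

/-- The negative discrete Laplacian `a - P a`, where `P` is the average over neighbours. -/
def negLaplace (a : (Fin d → ℤ) → ℝ) (x : Fin d → ℤ) : ℝ :=
  a x - (2 * d : ℝ)⁻¹ * ∑ v : Dir d, a (x + unitVec v)

/-- The radial profile of `potential` at `x`: the tent function interpolates `a` linearly along the
edges, and the correction `tail2` spreads the kink `a x - P a x` at the vertex over a
neighbourhood. -/
def potentialProfile (k : ℝ → ℝ) (a : (Fin d → ℤ) → ℝ) (x : Fin d → ℤ) (s : ℝ) : ℝ :=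
  a x * max (1 - s) 0 - negLaplace a x * tail2 k s

/-- The function on the cable system that is linear along edges with vertex values `a`, smoothed at
the vertices so as to satisfy Kirchhoff's condition. -/
def potential (k : ℝ → ℝ) (a : (Fin d → ℤ) → ℝ) : Cable d → ℝ := radialSum (potentialProfile k a)

/-- The density `∑ x, 2 b_x k(dist z x)`; `charge k (negLaplace a)` is the charge of `potential k a`. -/
def charge (k : ℝ → ℝ) (b : (Fin d → ℤ) → ℝ) : Cable d → ℝ := radialSum fun x s => 2 * b x * k s

lemma potentialProfile_eq_zero {k : ℝ → ℝ} {ρ : ℝ} (hk : IsBump k ρ) (a : (Fin d → ℤ) → ℝ)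
    (x : Fin d → ℤ) (s : ℝ) (hs : 1 ≤ s) : potentialProfile k a x s = 0 := by
  rw [potentialProfile, hk.tail2_of_ge (hk.le_one.trans hs), max_eq_right (by linarith)]; simp

lemma charge_eq_zero {k : ℝ → ℝ} {ρ : ℝ} (hk : IsBump k ρ) (b : (Fin d → ℤ) → ℝ)
    (x : Fin d → ℤ) (s : ℝ) (hs : 1 ≤ s) : 2 * b x * k s = 0 := by
  rw [hk.eq_zero s (hk.le_one.trans hs), mul_zero]

lemma negLaplace_eq_zero {a : (Fin d → ℤ) → ℝ} {S : Finset (Fin d → ℤ)} (hS : ∀ x ∉ S, a x = 0) :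
    ∃ S' : Finset (Fin d → ℤ), S ⊆ S' ∧ ∀ x ∉ S', negLaplace a x = 0 := by
  classical
  refine ⟨S ∪ (Finset.univ : Finset (Dir d)).biUnion fun v => S.image (· - unitVec v),
    Finset.subset_union_left, fun x hx => ?_⟩
  simp only [Finset.mem_union, Finset.mem_biUnion, Finset.mem_univ, true_and, Finset.mem_image,
    not_or, not_exists, not_and] at hx
  rw [negLaplace, hS x hx.1, Finset.sum_eq_zero fun v _ => hS _ fun h => hx.2 v _ h (by simp)]
  simp

/-- `potential k a` has second derivative `-2 * charge k (negLaplace a)`. The correction `tail2` has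
slope `tail1 k 0 = 1` at each vertex, which turns the sum of the outward slopes of the linear
interpolation, a multiple of the discrete Laplacian, into zero. -/
lemma isTestPair_potential [NeZero d] {k : ℝ → ℝ} {ρ : ℝ} (hk : IsBump k ρ)
    {a : (Fin d → ℤ) → ℝ} {S : Finset (Fin d → ℤ)} (hS : ∀ x ∉ S, a x = 0) :
    IsTestPair (potential k a) (fun z => -2 * charge k (negLaplace a) z) := by
  obtain ⟨S', hSS, hS'⟩ := negLaplace_eq_zero hS
  have ha' : ∀ x ∉ S', ∀ s, potentialProfile k a x s = 0 := fun x hx s => by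
    rw [potentialProfile, hS x (fun h => hx (hSS h)), hS' x hx]; simp
  have hb' : ∀ x ∉ S', ∀ s, 2 * negLaplace a x * k s = 0 := fun x hx s => by
    rw [hS' x hx]; simp
  have hpc : ∀ x, Continuous (potentialProfile k a x) := fun x => by
    unfold potentialProfile
    have := hk.continuous_tail2
    fun_prop
  refine ⟨continuous_radialSum ha' hpc,
    hasCompactSupport_radialSum (potentialProfile_eq_zero hk a) ha',
    continuous_const.mul (continuous_radialSum hb' fun x => by
      have := hk.continuous
      fun_prop), ?_⟩
  set b := negLaplace a with hb
  refine ⟨fun x v t => -2 * a x + 2 * a (x + unitVec v) + 2 * b x * tail1 k (2 * t)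
    - 2 * b (x + unitVec v) * tail1 k (1 - 2 * t), fun x v t ht => ⟨?_, ?_⟩, fun x => ?_⟩
  · have h1 : HasDerivAt (fun s : ℝ => tail2 k (2 * s)) (-tail1 k (2 * t) * 2) t :=
      (hk.hasDerivAt_tail2 (2 * t)).comp t (by simpa using (hasDerivAt_id t).const_mul 2)
    have h2 : HasDerivAt (fun s : ℝ => tail2 k (1 - 2 * s)) (-tail1 k (1 - 2 * t) * (-2)) t :=
      HasDerivAt.comp (h₂ := tail2 k) (h := fun s : ℝ => 1 - 2 * s) t
        (hk.hasDerivAt_tail2 (1 - 2 * t)) (by simpa using ((hasDerivAt_id t).const_mul 2).const_sub 1)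
    have h3 : HasDerivAt (fun s : ℝ => a x * (1 - 2 * s) + a (x + unitVec v) * (2 * s)
        - b x * tail2 k (2 * s) - b (x + unitVec v) * tail2 k (1 - 2 * s))
        (a x * (-2) + a (x + unitVec v) * 2 - b x * (-tail1 k (2 * t) * 2)
          - b (x + unitVec v) * (-tail1 k (1 - 2 * t) * (-2))) t := by
      refine (((HasDerivAt.const_mul _ ?_).add (HasDerivAt.const_mul _ ?_)).sub
        (h1.const_mul _)).sub (h2.const_mul _)
      · simpa using ((hasDerivAt_id t).const_mul 2).const_sub 1
      · simpa using (hasDerivAt_id t).const_mul 2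
    have h4 : ∀ s ∈ Icc (0 : ℝ) (1 / 2), potential k a (edgePoint x v s) =
        a x * (1 - 2 * s) + a (x + unitVec v) * (2 * s)
        - b x * tail2 k (2 * s) - b (x + unitVec v) * tail2 k (1 - 2 * s) := by
      intro s hs
      rw [potential, radialSum_edgePoint (potentialProfile_eq_zero hk a) x v hs]
      obtain ⟨hs0, hs1⟩ := hs
      rw [potentialProfile, potentialProfile, max_eq_left (by linarith), max_eq_left (by linarith),
        ← hb]
      ring
    refine (h3.hasDerivWithinAt.congr h4 (h4 t ht)).congr_deriv ?_
    ring
  · have h1 : HasDerivAt (fun s : ℝ => tail1 k (2 * s)) (-k (2 * t) * 2) t :=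
      (hk.hasDerivAt_tail1 (2 * t)).comp t (by simpa using (hasDerivAt_id t).const_mul 2)
    have h2 : HasDerivAt (fun s : ℝ => tail1 k (1 - 2 * s)) (-k (1 - 2 * t) * (-2)) t :=
      HasDerivAt.comp (h₂ := tail1 k) (h := fun s : ℝ => 1 - 2 * s) t
        (hk.hasDerivAt_tail1 (1 - 2 * t)) (by simpa using ((hasDerivAt_id t).const_mul 2).const_sub 1)
    have h3 := (((hasDerivAt_const t (-2 * a x + 2 * a (x + unitVec v))).add
      (h1.const_mul (2 * b x))).sub (h2.const_mul (2 * b (x + unitVec v)))).hasDerivWithinAt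
        (s := Icc (0 : ℝ) (1 / 2))
    refine h3.congr_deriv ?_
    rw [charge, radialSum_edgePoint (charge_eq_zero hk b) x v ht]
    ring
  · have h0 : tail1 k 1 = 0 := hk.tail1_of_ge hk.le_one
    have h1 : tail1 k 0 = 1 := hk.tail1_zero
    have hd0 : (d : ℝ) ≠ 0 := by exact_mod_cast NeZero.ne d
    simp only [mul_zero, sub_zero, h0, h1, mul_one, Finset.sum_add_distrib, ← Finset.mul_sum,
      Finset.sum_const, Finset.card_univ, Fintype.card_prod, Fintype.card_fin, Fintype.card_bool,
      nsmul_eq_mul]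
    rw [hb, negLaplace]
    push_cast
    field_simp
    ring

/-! ### Length of balls around vertices -/

/-- A ball of radius `r ≤ 1` around `y` meets an edge in length `r / 2` at each endpoint equal to
`y`. -/
lemma volume_edge_ball (x y : Fin d → ℤ) (i : Fin d) {r : ℝ} (hr : r ≤ 1) :
    (volume.restrict (Icc (0 : ℝ) (1 / 2))).map (edgePoint x (i, true)) (Metric.ball (vertex y) r) =
      (if x = y then ENNReal.ofReal (r / 2) else 0) +
      (if x = y - unitVec (i, true) then ENNReal.ofReal (r / 2) else 0) := by
  rw [Measure.map_apply (continuous_edgePoint _ _).measurable measurableSet_ball,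
    Measure.restrict_apply ((continuous_edgePoint _ _).measurable measurableSet_ball)]
  by_cases h1 : x = y
  · subst h1
    have hne : x ≠ x - unitVec (i, true) := by
      intro h
      have h' : x = x + unitVec (i, true) := by
        conv_lhs => rw [← sub_add_cancel x (unitVec (i, true)), ← h]
      exact add_unitVec_ne x (i, true) h'.symm
    rw [if_pos rfl, if_neg hne, add_zero]
    have : edgePoint x (i, true) ⁻¹' Metric.ball (vertex x) r ∩ Icc (0 : ℝ) (1 / 2) =
        Ico 0 (r / 2) := by
      ext t
      simp only [mem_inter_iff, mem_preimage, Metric.mem_ball, mem_Icc, mem_Ico]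
      constructor
      · rintro ⟨h, h0, _⟩
        rw [dist_edgePoint_left x _ h0] at h
        exact ⟨h0, by linarith⟩
      · rintro ⟨h0, h⟩
        rw [dist_edgePoint_left x _ h0]
        exact ⟨by linarith, h0, by linarith⟩
    rw [this, Real.volume_Ico, sub_zero]
  · rw [if_neg h1, zero_add]
    by_cases h2 : x = y - unitVec (i, true)
    · rw [if_pos h2]
      have hy : y = x + unitVec (i, true) := by rw [h2]; simp
      rw [hy]
      have : edgePoint x (i, true) ⁻¹' Metric.ball (vertex (x + unitVec (i, true))) r ∩
          Icc (0 : ℝ) (1 / 2) = Ioc (1 / 2 - r / 2) (1 / 2) := by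
        ext t
        simp only [mem_inter_iff, mem_preimage, Metric.mem_ball, mem_Icc, mem_Ioc]
        constructor
        · rintro ⟨h, _, h0⟩
          rw [dist_edgePoint_right x _ h0] at h
          exact ⟨by linarith, h0⟩
        · rintro ⟨h, h0⟩
          rw [dist_edgePoint_right x _ h0]
          exact ⟨by linarith, by linarith, h0⟩
      rw [this, Real.volume_Ioc]
      congr 1; ring
    · rw [if_neg h2]
      have : edgePoint x (i, true) ⁻¹' Metric.ball (vertex y) r ∩ Icc (0 : ℝ) (1 / 2) = ∅ := by
        ext t
        simp only [mem_inter_iff, mem_preimage, Metric.mem_ball, mem_empty_iff_false, iff_false,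
          not_and]
        intro h ht
        have := one_le_dist_edgePoint x (i, true) ht (y := y) (Ne.symm h1)
          (fun e => h2 (by rw [e]; simp))
        linarith
      rw [this, measure_empty]

lemma cableLebesgue_ball (y : Fin d → ℤ) {r : ℝ} (hr0 : 0 < r) (hr : r ≤ 1) :
    cableLebesgue d (Metric.ball (vertex y) r) = ENNReal.ofReal (d * r) := by
  rw [cableLebesgue, Measure.sum_apply _ measurableSet_ball]
  simp only [volume_edge_ball _ y _ hr]
  rw [ENNReal.tsum_prod (f := fun (x : Fin d → ℤ) (i : Fin d) =>
    (if x = y then ENNReal.ofReal (r / 2) else 0) +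
      (if x = y - unitVec (i, true) then ENNReal.ofReal (r / 2) else 0)), ENNReal.tsum_comm]
  simp only [ENNReal.tsum_add, tsum_ite_eq, tsum_fintype, Finset.sum_const, Finset.card_univ,
    Fintype.card_fin, nsmul_eq_mul]
  rw [← ENNReal.ofReal_add (by positivity) (by positivity), add_halves,
    ENNReal.ofReal_mul (by positivity), ENNReal.ofReal_natCast]

/-! ### Occupation integrals and the martingale problem -/

/-- A forward path as a function on `ℝ`, constant on negative times. -/
def pathAt (w : ForwardPath d) (s : ℝ) : Cable d := w.1 s.toNNReal

lemma continuous_pathAt (w : ForwardPath d) : Continuous (pathAt w) :=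
  w.2.comp continuous_real_toNNReal

lemma measurable_pathAt_filtration {s t : ℝ} (h : s ≤ t) :
    Measurable[pathFiltration d t.toNNReal] fun w : ForwardPath d => pathAt w s := by
  have h1 : s.toNNReal ≤ t.toNNReal := Real.toNNReal_le_toNNReal h
  have h2 : MeasurableSpace.comap (fun w : ForwardPath d => w.1 s.toNNReal) inferInstance ≤
      (pathFiltration d t.toNNReal) :=
    le_iSup (fun r : Iic t.toNNReal =>
      MeasurableSpace.comap (fun w : ForwardPath d => w.1 r.1) inferInstance) ⟨s.toNNReal, h1⟩
  exact (measurable_iff_comap_le).2 h2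

lemma measurable_pathAt (s : ℝ) : Measurable fun w : ForwardPath d => pathAt w s :=
  (measurable_pi_apply s.toNNReal).comp measurable_subtype_coe

lemma measurable_uncurry_pathAt :
    Measurable (Function.uncurry fun (s : ℝ) (w : ForwardPath d) => pathAt w s) :=
  measurable_uncurry_of_continuous_of_measurable continuous_pathAt measurable_pathAt

/-- The occupation integral of `φ` up to time `t`. -/
def occ (φ : Cable d → ℝ) (t : ℝ) (w : ForwardPath d) : ℝ := ∫ s in (0 : ℝ)..t, φ (pathAt w s)

lemma measurable_intervalIntegral_of_uncurry {Ω : Type*} {m : MeasurableSpace Ω} {F : ℝ → Ω → ℝ}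
    (hF : Measurable (Function.uncurry F)) (a b : ℝ) :
    Measurable fun ω => ∫ s in a..b, F s ω := by
  have h : StronglyMeasurable fun p : Ω × ℝ => F p.2 p.1 :=
    (hF.comp measurable_swap).stronglyMeasurable
  unfold intervalIntegral
  exact (h.integral_prod_right' (ν := volume.restrict (Ioc a b))).measurable.sub
    (h.integral_prod_right' (ν := volume.restrict (Ioc b a))).measurable

lemma measurable_occ_filtration {φ : Cable d → ℝ} (hφ : Measurable φ) {t : ℝ} (ht : 0 ≤ t) :
    Measurable[pathFiltration d t.toNNReal] (occ φ t) := by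
  have h : occ φ t = fun w : ForwardPath d => ∫ s in (0 : ℝ)..t, φ (pathAt w (min s t)) := by
    ext w
    refine intervalIntegral.integral_congr fun s hs => ?_
    rw [uIcc_of_le ht] at hs
    simp only [min_eq_left hs.2]
  rw [h]
  refine measurable_intervalIntegral_of_uncurry (m := pathFiltration d t.toNNReal)
    (F := fun s w => φ (pathAt w (min s t))) ?_ 0 t
  refine hφ.comp ?_
  exact measurable_uncurry_of_continuous_of_measurable (m := pathFiltration d t.toNNReal)
    (u := fun s w => pathAt w (min s t))
    (fun w => (continuous_pathAt w).comp (by fun_prop))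
    fun s => measurable_pathAt_filtration (min_le_right _ _)

lemma measurable_occ {φ : Cable d → ℝ} (hφ : Measurable φ) (t : ℝ) : Measurable (occ φ t) :=
  measurable_intervalIntegral_of_uncurry (F := fun s w => φ (pathAt w s))
    (hφ.comp measurable_uncurry_pathAt) 0 t

lemma abs_occ_le {φ : Cable d → ℝ} {c : ℝ} (hc : ∀ z, |φ z| ≤ c) {t : ℝ} (ht : 0 ≤ t)
    (w : ForwardPath d) : |occ φ t w| ≤ c * t := by
  have := intervalIntegral.norm_integral_le_of_norm_le_const (a := 0) (b := t)
    (f := fun s => φ (pathAt w s)) (C := c) fun s _ => hc _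
  rwa [sub_zero, abs_of_nonneg ht] at this

lemma occ_zero (φ : Cable d → ℝ) (w : ForwardPath d) : occ φ 0 w = 0 := by simp [occ]

lemma hasDerivAt_occ {φ : Cable d → ℝ} (hφ : Continuous φ) (w : ForwardPath d) (t : ℝ) :
    HasDerivAt (fun t => occ φ t w) (φ (pathAt w t)) t :=
  intervalIntegral.integral_hasDerivAt_right ((hφ.comp (continuous_pathAt w)).intervalIntegrable _ _)
    (hφ.comp (continuous_pathAt w)).stronglyMeasurable.stronglyMeasurableAtFilter
    (hφ.comp (continuous_pathAt w)).continuousAt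

lemma continuous_occ {φ : Cable d → ℝ} (hφ : Continuous φ) (w : ForwardPath d) :
    Continuous fun t => occ φ t w :=
  continuous_iff_continuousAt.2 fun t => (hasDerivAt_occ hφ w t).continuousAt

/-- `g` is a potential of the density `φ` for the diffusion with law `P`: both are bounded, and
`g(w_t) + ∫₀ᵗ φ(w_s) ds` is a martingale. The martingale property is stated as orthogonality of the
increments to bounded random variables of the past. -/
structure HasPotential (P : Measure (ForwardPath d)) (φ g : Cable d → ℝ) : Prop where
  continuous : Continuous φ
  measurable : Measurable g
  bound : ∃ c, ∀ z, |φ z| ≤ c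
  bound_potential : ∃ c, ∀ z, |g z| ≤ c
  dynkin : ∀ s t : ℝ, 0 ≤ s → s ≤ t → ∀ Z : ForwardPath d → ℝ,
    Measurable[pathFiltration d s.toNNReal] Z → (∃ c, ∀ w, |Z w| ≤ c) →
    ∫ w, Z w * (g (pathAt w t) - g (pathAt w s) + (occ φ t w - occ φ s w)) ∂P = 0

lemma integrable_of_bound {Ω : Type*} {m : MeasurableSpace Ω} {P : Measure Ω} [IsFiniteMeasure P]
    {F : Ω → ℝ} (hF : Measurable F) {c : ℝ} (hc : ∀ ω, |F ω| ≤ c) : Integrable F P :=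
  Integrable.of_bound hF.aestronglyMeasurable c (ae_of_all _ hc)

/-- The martingale problem for a test pair, as orthogonality of the increments to the past. -/
lemma IsDiffusionLaw.integral_mul_eq_zero {f : Cable d → ℝ} {z : Cable d} {P : Measure (ForwardPath d)}
    (hP : IsDiffusionLaw z P) {φ : Cable d → ℝ} (hfh : IsTestPair f (fun z => -2 * φ z))
    {s t : ℝ} (hs : 0 ≤ s) (hst : s ≤ t) {Z : ForwardPath d → ℝ}
    (hZ : Measurable[pathFiltration d s.toNNReal] Z) {c : ℝ} (hc : ∀ w, |Z w| ≤ c) :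
    ∫ w, Z w * (f (pathAt w t) - f (pathAt w s) + (occ φ t w - occ φ s w)) ∂P = 0 := by
  have := hP.isProbability
  have hM := hP.martingale f _ hfh
  set M : ℝ≥0 → ForwardPath d → ℝ := fun (t : ℝ≥0) (w : ForwardPath d) =>
        f (w.1 t) - ∫ s in (0 : ℝ)..t, (1 / 2) * (-2 * φ (w.1 s.toNNReal)) with hMdef
  have hMeq : ∀ r : ℝ, 0 ≤ r → ∀ w, M r.toNNReal w = f (pathAt w r) + occ φ r w := by
    intro r hr w
    simp only [hMdef, occ, pathAt, Real.coe_toNNReal r hr]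
    rw [sub_eq_add_neg, ← intervalIntegral.integral_neg]
    congr 1
    refine intervalIntegral.integral_congr fun s _ => ?_
    ring
  have hle := (pathFiltration d).le s.toNNReal
  have hZs : StronglyMeasurable[pathFiltration d s.toNNReal] Z := hZ.stronglyMeasurable
  have hZm : AEStronglyMeasurable Z P := (hZs.mono hle).aestronglyMeasurable
  have hint : ∀ r, Integrable (fun w => Z w * M r w) P := fun r =>
    (hM.integrable r).bdd_mul hZm (ae_of_all _ hc)
  have h1 : ∫ w, Z w * M t.toNNReal w ∂P = ∫ w, Z w * M s.toNNReal w ∂P := by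
    have e1 := condExp_stronglyMeasurable_mul_of_bound hle hZs (hM.integrable t.toNNReal) c
      (ae_of_all P hc)
    have e2 := hM.condExp_ae_eq (Real.toNNReal_le_toNNReal hst)
    calc ∫ w, Z w * M t.toNNReal w ∂P
        = ∫ w, (P[Z * M t.toNNReal | pathFiltration d s.toNNReal]) w ∂P :=
          (integral_condExp hle).symm
      _ = ∫ w, Z w * M s.toNNReal w ∂P := by
          refine integral_congr_ae ?_
          filter_upwards [e1, e2] with w h1 h2
          rw [h1, Pi.mul_apply, h2]
  have h2 := sub_eq_zero.2 h1
  rw [← integral_sub (hint _) (hint _)] at h2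
  rw [← h2]
  refine integral_congr_ae (ae_of_all _ fun w => ?_)
  simp only [hMeq t (hs.trans hst), hMeq s hs]
  ring

/-! ### Potentials of bounded functions -/

lemma abs_negLaplace_le [NeZero d] {a : (Fin d → ℤ) → ℝ} {c : ℝ} (hc : ∀ x, |a x| ≤ c)
    (x : Fin d → ℤ) : |negLaplace a x| ≤ 2 * c := by
  have hd0 : (0 : ℝ) < 2 * d := by
    have : (0 : ℝ) < d := by exact_mod_cast NeZero.pos d
    linarith
  have h1 : |(2 * d : ℝ)⁻¹ * ∑ v : Dir d, a (x + unitVec v)| ≤ c := by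
    rw [abs_mul, abs_of_pos (inv_pos.2 hd0), inv_mul_le_iff₀ hd0]
    refine (Finset.abs_sum_le_sum_abs _ _).trans ?_
    refine (Finset.sum_le_sum fun v _ => hc _).trans (le_of_eq ?_)
    simp only [Finset.sum_const, Finset.card_univ, Fintype.card_prod, Fintype.card_fin,
      Fintype.card_bool, nsmul_eq_mul]
    push_cast; ring
  refine (abs_sub _ _).trans ?_
  linarith [hc x]

lemma IsBump.exists_le {k : ℝ → ℝ} {ρ : ℝ} (hk : IsBump k ρ) :
    ∃ κ, 0 ≤ κ ∧ ∀ s, 0 ≤ s → k s ≤ κ := by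
  obtain ⟨κ, hκ⟩ := (isCompact_Icc (a := (0 : ℝ)) (b := ρ)).bddAbove_image hk.continuous.continuousOn
  refine ⟨max κ 0, le_max_right _ _, fun s hs => ?_⟩
  rcases le_or_gt ρ s with h | h
  · rw [hk.eq_zero s h]; exact le_max_right _ _
  · exact (hκ ⟨s, ⟨hs, h.le⟩, rfl⟩).trans (le_max_left _ _)

lemma abs_potentialProfile_le [NeZero d] {k : ℝ → ℝ} {ρ : ℝ} (hk : IsBump k ρ)
    {a : (Fin d → ℤ) → ℝ} {c : ℝ} (hc : ∀ x, |a x| ≤ c) (x : Fin d → ℤ) {s : ℝ} (hs : 0 ≤ s) :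
    |potentialProfile k a x s| ≤ 3 * c := by
  have h1 : |max (1 - s) 0| ≤ 1 := by
    rw [abs_of_nonneg (le_max_right _ _)]; exact max_le (by linarith) (by norm_num)
  have h2 : |tail2 k s| ≤ 1 := by
    rw [abs_of_nonneg (hk.tail2_nonneg s)]; exact (hk.tail2_le_radius hs).trans hk.le_one
  have h3 := hc x
  have h4 := abs_negLaplace_le hc x
  have h0 := abs_nonneg (a x)
  refine (abs_sub _ _).trans ?_
  rw [abs_mul, abs_mul]
  have e1 : |a x| * |max (1 - s) 0| ≤ c * 1 := mul_le_mul h3 h1 (abs_nonneg _) (h0.trans h3)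
  have e2 : |negLaplace a x| * |tail2 k s| ≤ 2 * c * 1 :=
    mul_le_mul h4 h2 (abs_nonneg _) ((abs_nonneg _).trans h4)
  linarith

lemma abs_radialSum_le [NeZero d] {p : (Fin d → ℤ) → ℝ → ℝ} (hp : ∀ x s, 1 ≤ s → p x s = 0) {c : ℝ}
    (hc : ∀ x s, 0 ≤ s → |p x s| ≤ c) (z : Cable d) : |radialSum p z| ≤ 2 * c := by
  obtain ⟨x, v, t, ht, rfl⟩ := exists_edgePoint z
  rw [radialSum_edgePoint hp x v ht]
  have h1 := hc x (2 * t) (by linarith [ht.1])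
  have h2 := hc (x + unitVec v) (1 - 2 * t) (by linarith [ht.2])
  exact (abs_add_le _ _).trans (by linarith)

/-- The restriction of `a` to the box `[-M, M]^d`. -/
def truncate (M : ℕ) (a : (Fin d → ℤ) → ℝ) (x : Fin d → ℤ) : ℝ :=
  if x ∈ Fintype.piFinset fun _ : Fin d => Finset.Icc (-(M : ℤ)) M then a x else 0

lemma truncate_eventually (a : (Fin d → ℤ) → ℝ) (x : Fin d → ℤ) :
    ∀ᶠ M in atTop, truncate M a x = a x := by
  filter_upwards [eventually_ge_atTop (∑ i, (x i).natAbs)] with M hM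
  rw [truncate, if_pos]
  rw [Fintype.mem_piFinset]
  intro i
  have : (x i).natAbs ≤ M :=
    (Finset.single_le_sum (f := fun i => (x i).natAbs) (fun _ _ => Nat.zero_le _)
      (Finset.mem_univ i)).trans hM
  rw [Finset.mem_Icc]
  omega

lemma truncate_eq_zero (M : ℕ) (a : (Fin d → ℤ) → ℝ) (x : Fin d → ℤ)
    (hx : x ∉ Fintype.piFinset fun _ : Fin d => Finset.Icc (-(M : ℤ)) M) : truncate M a x = 0 :=
  if_neg hx

lemma abs_truncate_le {a : (Fin d → ℤ) → ℝ} {c : ℝ} (hc : ∀ x, |a x| ≤ c) (M : ℕ) (x : Fin d → ℤ) :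
    |truncate M a x| ≤ c := by
  unfold truncate
  split_ifs
  · exact hc x
  · rw [abs_zero]; exact (abs_nonneg _).trans (hc x)

lemma negLaplace_truncate_eventually (a : (Fin d → ℤ) → ℝ) (x : Fin d → ℤ) :
    ∀ᶠ M in atTop, negLaplace (truncate M a) x = negLaplace a x := by
  filter_upwards [truncate_eventually a x,
    eventually_all.2 fun v : Dir d => truncate_eventually a (x + unitVec v)] with M h1 h2
  simp only [negLaplace, h1, h2]

lemma radialSum_eventually [NeZero d] {p : ℕ → (Fin d → ℤ) → ℝ → ℝ} {q : (Fin d → ℤ) → ℝ → ℝ}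
    (hp : ∀ M x s, 1 ≤ s → p M x s = 0) (hq : ∀ x s, 1 ≤ s → q x s = 0)
    (h : ∀ x, ∀ᶠ M in atTop, p M x = q x) (z : Cable d) :
    ∀ᶠ M in atTop, radialSum (p M) z = radialSum q z := by
  obtain ⟨x, v, t, ht, rfl⟩ := exists_edgePoint z
  filter_upwards [h x, h (x + unitVec v)] with M h1 h2
  rw [radialSum_edgePoint (hp M) x v ht, radialSum_edgePoint hq x v ht, h1, h2]

lemma potential_truncate_tendsto [NeZero d] {k : ℝ → ℝ} {ρ : ℝ} (hk : IsBump k ρ)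
    (a : (Fin d → ℤ) → ℝ) (z : Cable d) :
    Tendsto (fun M => potential k (truncate M a) z) atTop (𝓝 (potential k a z)) := by
  refine tendsto_const_nhds.congr' (EventuallyEq.symm ?_)
  refine radialSum_eventually (fun M => potentialProfile_eq_zero hk _)
    (potentialProfile_eq_zero hk _) (fun x => ?_) z
  filter_upwards [truncate_eventually a x, negLaplace_truncate_eventually a x] with M h1 h2
  ext s
  rw [potentialProfile, potentialProfile, h1, h2]

lemma charge_truncate_tendsto [NeZero d] {k : ℝ → ℝ} {ρ : ℝ} (hk : IsBump k ρ)
    (a : (Fin d → ℤ) → ℝ) (z : Cable d) :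
    Tendsto (fun M => charge k (negLaplace (truncate M a)) z) atTop
      (𝓝 (charge k (negLaplace a) z)) := by
  refine tendsto_const_nhds.congr' (EventuallyEq.symm ?_)
  refine radialSum_eventually (fun M => charge_eq_zero hk _)
    (charge_eq_zero hk _) (fun x => ?_) z
  filter_upwards [negLaplace_truncate_eventually a x] with M h2
  ext s
  rw [h2]

/-- The martingale problem extends from finitely supported `a` to bounded `a`, by dominated
convergence along truncations of `a`. -/
lemma hasPotential [NeZero d] {k : ℝ → ℝ} {ρ : ℝ} (hk : IsBump k ρ) {z₀ : Cable d}
    {P : Measure (ForwardPath d)} (hP : IsDiffusionLaw z₀ P)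
    {a : (Fin d → ℤ) → ℝ} {c : ℝ} (hc : ∀ x, |a x| ≤ c) {S : Finset (Fin d → ℤ)}
    (hS : ∀ x ∉ S, negLaplace a x = 0) :
    HasPotential P (charge k (negLaplace a)) (potential k a) := by
  have := hP.isProbability
  obtain ⟨κ, hκ0, hκ⟩ := hk.exists_le
  have hc0 : 0 ≤ c := (abs_nonneg _).trans (hc 0)
  have hbp : ∀ (a : (Fin d → ℤ) → ℝ), (∀ x, |a x| ≤ c) → ∀ z, |potential k a z| ≤ 2 * (3 * c) :=
    fun a hc z => abs_radialSum_le (potentialProfile_eq_zero hk a)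
      (fun x s hs => abs_potentialProfile_le hk hc x hs) z
  have hbc : ∀ (a : (Fin d → ℤ) → ℝ), (∀ x, |a x| ≤ c) → ∀ z,
      |charge k (negLaplace a) z| ≤ 2 * (2 * (2 * c) * κ) := fun a hc z =>
    abs_radialSum_le (charge_eq_zero hk _) (fun x s hs => by
      rw [abs_mul, abs_mul, abs_of_nonneg (hk.nonneg s), abs_two]
      have := abs_negLaplace_le hc x
      have := hκ s hs
      have := hk.nonneg s
      gcongr) z
  have htest : ∀ M, IsTestPair (potential k (truncate M a))
      (fun z => -2 * charge k (negLaplace (truncate M a)) z) := fun M =>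
    isTestPair_potential hk (truncate_eq_zero M a)
  have hcontM : ∀ M, Continuous (charge k (negLaplace (truncate M a))) := fun M => by
    have := ((htest M).continuous_second).const_mul (-1 / 2 : ℝ)
    refine this.congr fun z => ?_
    ring
  have hmeasp : Measurable (potential k a) :=
    measurable_of_tendsto_metrizable (fun M => (htest M).continuous_fun.measurable)
      (tendsto_pi_nhds.2 (potential_truncate_tendsto hk a))
  have hcont : Continuous (charge k (negLaplace a)) :=
    continuous_radialSum (S := S) (fun x hx s => by rw [hS x hx]; simp) fun x => by
      have := hk.continuous
      fun_prop
  refine ⟨hcont, hmeasp, ⟨_, hbc a hc⟩, ⟨_, hbp a hc⟩, fun s t hs hst Z hZ ⟨C, hC⟩ => ?_⟩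
  have hCM : ∀ M, ∫ w, Z w * (potential k (truncate M a) (pathAt w t) -
      potential k (truncate M a) (pathAt w s) +
      (occ (charge k (negLaplace (truncate M a))) t w -
        occ (charge k (negLaplace (truncate M a))) s w)) ∂P = 0 := fun M =>
    hP.integral_mul_eq_zero (htest M) hs hst hZ hC
  have hZm : Measurable Z := hZ.mono ((pathFiltration d).le _) le_rfl
  have hocc : ∀ r w, Tendsto (fun M => occ (charge k (negLaplace (truncate M a))) r w) atTop
      (𝓝 (occ (charge k (negLaplace a)) r w)) := fun r w => by
    refine intervalIntegral.tendsto_integral_filter_of_dominated_convergence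
      (fun _ => 2 * (2 * (2 * c) * κ)) (Eventually.of_forall fun M => ?_)
      (Eventually.of_forall fun M => ae_of_all _ fun s _ => hbc _ (abs_truncate_le hc M) _)
      intervalIntegrable_const
      (ae_of_all _ fun s _ => charge_truncate_tendsto hk a _)
    exact ((hcontM M).comp (continuous_pathAt w)).aestronglyMeasurable
  have hlim := tendsto_integral_of_dominated_convergence
    (F := fun M w => Z w * (potential k (truncate M a) (pathAt w t) -
      potential k (truncate M a) (pathAt w s) +
      (occ (charge k (negLaplace (truncate M a))) t w -
        occ (charge k (negLaplace (truncate M a))) s w)))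
    (f := fun w => Z w * (potential k a (pathAt w t) -
      potential k a (pathAt w s) +
      (occ (charge k (negLaplace a)) t w - occ (charge k (negLaplace a)) s w))) (μ := P)
    (fun _ => C * (2 * (3 * c) + 2 * (3 * c) +
      (2 * (2 * (2 * c) * κ) * t + 2 * (2 * (2 * c) * κ) * s)))
    (fun M => by
      have m1 := (htest M).continuous_fun.measurable
      have m2 := (hcontM M).measurable
      exact (hZm.mul (((m1.comp (measurable_pathAt t)).sub (m1.comp (measurable_pathAt s))).add
        ((measurable_occ m2 t).sub (measurable_occ m2 s)))).aestronglyMeasurable)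
    (integrable_const _)
    (fun M => ae_of_all _ fun w => by
      rw [Real.norm_eq_abs, abs_mul]
      have hC0 : 0 ≤ C := (abs_nonneg _).trans (hC w)
      have b1 := hbp _ (abs_truncate_le hc M) (pathAt w t)
      have b2 := hbp _ (abs_truncate_le hc M) (pathAt w s)
      have b3 := abs_occ_le (hbc _ (abs_truncate_le hc M)) (hs.trans hst) w
      have b4 := abs_occ_le (hbc _ (abs_truncate_le hc M)) hs w
      refine mul_le_mul (hC w) ?_ (abs_nonneg _) hC0
      refine (abs_add_le _ _).trans (add_le_add ((abs_sub _ _).trans (add_le_add b1 b2))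
        ((abs_sub _ _).trans (add_le_add b3 b4))))
    (ae_of_all _ fun w => ((((potential_truncate_tendsto hk a _).sub
      (potential_truncate_tendsto hk a _)).add ((hocc t w).sub (hocc s w))).const_mul _))
  simp only [hCM] at hlim
  exact (tendsto_nhds_unique hlim tendsto_const_nhds)

/-! ### Moments of occupation integrals -/

lemma integrable_uncurry_of_bound {Ω : Type*} {m : MeasurableSpace Ω} {P : Measure Ω}
    [IsFiniteMeasure P] {F : ℝ → Ω → ℝ} (hF : Measurable (Function.uncurry F)) {T c : ℝ}
    (hc : ∀ s ∈ Ioc 0 T, ∀ ω, |F s ω| ≤ c) :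
    Integrable (Function.uncurry F) ((volume.restrict (Ioc 0 T)).prod P) := by
  refine Integrable.of_bound hF.aestronglyMeasurable c ?_
  have h : ∀ᵐ p ∂((volume.restrict (Ioc (0 : ℝ) T)).prod P), p.1 ∈ Ioc (0 : ℝ) T :=
    Measure.quasiMeasurePreserving_fst.ae (ae_restrict_mem measurableSet_Ioc)
  filter_upwards [h] with p hp
  exact hc p.1 hp p.2

lemma integrable_intervalIntegral_of_bound {Ω : Type*} {m : MeasurableSpace Ω} {P : Measure Ω}
    [IsFiniteMeasure P] {F : ℝ → Ω → ℝ} (hF : Measurable (Function.uncurry F)) {T c : ℝ}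
    (hT : 0 ≤ T) (hc : ∀ s ∈ Ioc 0 T, ∀ ω, |F s ω| ≤ c) :
    Integrable (fun ω => ∫ s in (0 : ℝ)..T, F s ω) P := by
  refine integrable_of_bound (measurable_intervalIntegral_of_uncurry hF 0 T) (c := c * T) fun ω => ?_
  have := intervalIntegral.norm_integral_le_of_norm_le_const (a := 0) (b := T)
    (f := fun s => F s ω) (C := c) fun s hs => hc s (by rwa [uIoc_of_le hT] at hs) ω
  rwa [sub_zero, abs_of_nonneg hT] at this

lemma measurable_uncurry_occ {φ : Cable d → ℝ} (hφ : Continuous φ) :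
    Measurable (Function.uncurry fun (s : ℝ) (w : ForwardPath d) => occ φ s w) :=
  measurable_uncurry_of_continuous_of_measurable (fun w => continuous_occ hφ w)
    fun s => measurable_occ hφ.measurable s

/-- Taylor's formula with remainder for `ψ(∫₀ᵀ φ)`, expanded along the path. -/
lemma integral_occ_taylor {φ : Cable d → ℝ} (hφ : Continuous φ) {ψ ψ' ψ'' : ℝ → ℝ}
    (h1 : ∀ x, HasDerivAt ψ (ψ' x) x) (h2 : ∀ x, HasDerivAt ψ' (ψ'' x) x) (h3 : Continuous ψ'')
    (w : ForwardPath d) (T : ℝ) :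
    ∫ s in (0 : ℝ)..T, ψ'' (occ φ s w) * φ (pathAt w s) * (occ φ T w - occ φ s w) =
      ψ (occ φ T w) - ψ 0 - ψ' 0 * occ φ T w := by
  have hd : ∀ s, HasDerivAt (fun s => ψ' (occ φ s w) * (occ φ T w - occ φ s w) + ψ (occ φ s w))
      (ψ'' (occ φ s w) * φ (pathAt w s) * (occ φ T w - occ φ s w)) s := by
    intro s
    have hA := hasDerivAt_occ hφ w s
    have e1 : HasDerivAt (fun s => ψ' (occ φ s w)) (ψ'' (occ φ s w) * φ (pathAt w s)) s :=
      HasDerivAt.comp (h₂ := ψ') (h := fun s => occ φ s w) s (h2 _) hA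
    have e2 : HasDerivAt (fun s => ψ (occ φ s w)) (ψ' (occ φ s w) * φ (pathAt w s)) s :=
      HasDerivAt.comp (h₂ := ψ) (h := fun s => occ φ s w) s (h1 _) hA
    refine ((e1.mul (hA.const_sub (occ φ T w))).add e2).congr_deriv ?_
    ring
  rw [intervalIntegral.integral_eq_sub_of_hasDerivAt (fun s _ => hd s)]
  · simp only [occ_zero]; ring
  · refine Continuous.intervalIntegrable ?_ _ _
    have hA := continuous_occ hφ w
    exact ((h3.comp hA).mul (hφ.comp (continuous_pathAt w))).mul (continuous_const.sub hA)

namespace HasPotential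
variable {P : Measure (ForwardPath d)} {φ g : Cable d → ℝ}

lemma sub {φ' g' : Cable d → ℝ} [IsFiniteMeasure P] (h : HasPotential P φ g)
    (h' : HasPotential P φ' g') :
    HasPotential P (fun z => φ z - φ' z) (fun z => g z - g' z) := by
  obtain ⟨c1, hc1⟩ := h.bound
  obtain ⟨c2, hc2⟩ := h'.bound
  obtain ⟨c3, hc3⟩ := h.bound_potential
  obtain ⟨c4, hc4⟩ := h'.bound_potential
  refine ⟨h.continuous.sub h'.continuous, h.measurable.sub h'.measurable,
    ⟨c1 + c2, fun z => (abs_sub _ _).trans (add_le_add (hc1 z) (hc2 z))⟩,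
    ⟨c3 + c4, fun z => (abs_sub _ _).trans (add_le_add (hc3 z) (hc4 z))⟩,
    fun s t hs hst Z hZ hC => ?_⟩
  have e1 := h.dynkin s t hs hst Z hZ hC
  have e2 := h'.dynkin s t hs hst Z hZ hC
  obtain ⟨C, hC⟩ := hC
  have hZm : Measurable Z := hZ.mono ((pathFiltration d).le _) le_rfl
  have hi : ∀ {φ g : Cable d → ℝ}, Continuous φ → Measurable g → ∀ {c c' : ℝ}, (∀ z, |φ z| ≤ c) →
      (∀ z, |g z| ≤ c') → Integrable (fun w => Z w * (g (pathAt w t) - g (pathAt w s) +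
        (occ φ t w - occ φ s w))) P := by
    intro φ g hφ hg c c' hc hc'
    refine integrable_of_bound (c := C * (c' + c' + (c * t + c * s))) (hZm.mul
      (((hg.comp (measurable_pathAt t)).sub (hg.comp (measurable_pathAt s))).add
        ((measurable_occ hφ.measurable t).sub (measurable_occ hφ.measurable s)))) fun w => ?_
    rw [abs_mul]
    refine mul_le_mul (hC w) ?_ (abs_nonneg _) ((abs_nonneg _).trans (hC w))
    exact (abs_add_le _ _).trans (add_le_add ((abs_sub _ _).trans (add_le_add (hc' _) (hc' _)))
        ((abs_sub _ _).trans (add_le_add (abs_occ_le hc (hs.trans hst) w) (abs_occ_le hc hs w))))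
  have hocc : ∀ r w, occ (fun z => φ z - φ' z) r w = occ φ r w - occ φ' r w := fun r w =>
    intervalIntegral.integral_sub
      ((h.continuous.comp (continuous_pathAt w)).intervalIntegrable _ _)
      ((h'.continuous.comp (continuous_pathAt w)).intervalIntegrable _ _)
  have e3 := sub_eq_zero.2 (e1.trans e2.symm)
  rw [← integral_sub (hi h.continuous h.measurable hc1 hc3) (hi h'.continuous h'.measurable hc2 hc4)]
    at e3
  rw [← e3]
  refine integral_congr_ae (ae_of_all _ fun w => ?_)
  simp only [hocc]
  ring

variable [IsProbabilityMeasure P]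

/-- In the second-order remainder, the future occupation `∫ₛᵀ φ` may be replaced by
`g(w_s) - g(w_T)`, because the other factors depend on the path up to time `s` only. -/
lemma integral_taylor (h : HasPotential P φ g) {ψ ψ' ψ'' : ℝ → ℝ}
    (h1 : ∀ x, HasDerivAt ψ (ψ' x) x) (h2 : ∀ x, HasDerivAt ψ' (ψ'' x) x) (h3 : Continuous ψ'')
    {T : ℝ} (hT : 0 ≤ T) :
    ∫ w, (ψ (occ φ T w) - ψ 0 - ψ' 0 * occ φ T w) ∂P =
      ∫ w, (∫ s in (0 : ℝ)..T, ψ'' (occ φ s w) * φ (pathAt w s) *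
        (g (pathAt w s) - g (pathAt w T))) ∂P := by
  obtain ⟨c, hc⟩ := h.bound
  obtain ⟨G, hG⟩ := h.bound_potential
  have hφ := h.continuous
  have hgm := h.measurable
  obtain ⟨κ, hκ⟩ := (isCompact_Icc (a := -(c * T)) (b := c * T)).bddAbove_image
    (f := fun x => |ψ'' x|) h3.abs.continuousOn
  have hAb : ∀ s ∈ Icc 0 T, ∀ w, |occ φ s w| ≤ c * T := fun s hs w =>
    (abs_occ_le hc hs.1 w).trans
      (mul_le_mul_of_nonneg_left hs.2 ((abs_nonneg _).trans (hc (pathAt w 0))))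
  have hψb : ∀ s ∈ Icc 0 T, ∀ w, |ψ'' (occ φ s w)| ≤ κ := fun s hs w =>
    hκ ⟨_, abs_le.1 (hAb s hs w), rfl⟩
  have hZb : ∀ s ∈ Icc 0 T, ∀ w, |ψ'' (occ φ s w) * φ (pathAt w s)| ≤ κ * c := fun s hs w => by
    rw [abs_mul]
    exact mul_le_mul (hψb s hs w) (hc _) (abs_nonneg _) ((abs_nonneg _).trans (hψb s hs w))
  have hκc : ∀ (_ : ForwardPath d), 0 ≤ κ * c := fun w =>
    (abs_nonneg _).trans (hZb 0 ⟨le_rfl, hT⟩ w)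
  have hoccm := measurable_uncurry_occ hφ
  have hpm := measurable_uncurry_pathAt (d := d)
  have hZm : Measurable (Function.uncurry fun (s : ℝ) (w : ForwardPath d) =>
      ψ'' (occ φ s w) * φ (pathAt w s)) :=
    (h3.measurable.comp hoccm).mul (hφ.measurable.comp hpm)
  have m1 : Measurable (Function.uncurry fun (s : ℝ) (w : ForwardPath d) =>
      ψ'' (occ φ s w) * φ (pathAt w s) * (occ φ T w - occ φ s w)) :=
    hZm.mul (((measurable_occ hφ.measurable T).comp measurable_snd).sub hoccm)
  have m2 : Measurable (Function.uncurry fun (s : ℝ) (w : ForwardPath d) =>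
      ψ'' (occ φ s w) * φ (pathAt w s) * (g (pathAt w s) - g (pathAt w T))) :=
    hZm.mul ((hgm.comp hpm).sub ((hgm.comp (measurable_pathAt T)).comp measurable_snd))
  have b1 : ∀ s ∈ Ioc 0 T, ∀ w, |ψ'' (occ φ s w) * φ (pathAt w s) * (occ φ T w - occ φ s w)| ≤
      κ * c * (c * T + c * T) := fun s hs w => by
    rw [abs_mul]
    exact mul_le_mul (hZb s (Ioc_subset_Icc_self hs) w) ((abs_sub _ _).trans (add_le_add
      (hAb T ⟨hT, le_rfl⟩ w) (hAb s (Ioc_subset_Icc_self hs) w))) (abs_nonneg _) (hκc w)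
  have b2 : ∀ s ∈ Ioc 0 T, ∀ w, |ψ'' (occ φ s w) * φ (pathAt w s) *
      (g (pathAt w s) - g (pathAt w T))| ≤ κ * c * (G + G) := fun s hs w => by
    rw [abs_mul]
    exact mul_le_mul (hZb s (Ioc_subset_Icc_self hs) w) ((abs_sub _ _).trans (add_le_add
      (hG _) (hG _))) (abs_nonneg _) (hκc w)
  simp only [← integral_occ_taylor hφ h1 h2 h3 _ T]
  have i1 := integrable_uncurry_of_bound (P := P) m1 b1
  have i2 := integrable_uncurry_of_bound (P := P) m2 b2
  rw [← uIoc_of_le hT] at i1 i2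
  rw [← intervalIntegral_integral_swap i1, ← intervalIntegral_integral_swap i2]
  refine intervalIntegral.integral_congr fun s hs => ?_
  rw [uIcc_of_le hT] at hs
  have hdyn := h.dynkin s T hs.1 hs.2 (fun w => ψ'' (occ φ s w) * φ (pathAt w s))
    ((h3.measurable.comp (measurable_occ_filtration hφ.measurable hs.1)).mul
      (hφ.measurable.comp (measurable_pathAt_filtration le_rfl))) ⟨κ * c, hZb s hs⟩
  have j1 : Integrable (fun w => ψ'' (occ φ s w) * φ (pathAt w s) * (occ φ T w - occ φ s w)) P :=
    integrable_of_bound (c := κ * c * (c * T + c * T)) (m1.comp measurable_prodMk_left) fun w => by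
      rw [abs_mul]
      exact mul_le_mul (hZb s hs w) ((abs_sub _ _).trans (add_le_add
        (hAb T ⟨hT, le_rfl⟩ w) (hAb s hs w))) (abs_nonneg _) (hκc w)
  have j2 : Integrable (fun w => ψ'' (occ φ s w) * φ (pathAt w s) *
      (g (pathAt w s) - g (pathAt w T))) P :=
    integrable_of_bound (c := κ * c * (G + G)) (m2.comp measurable_prodMk_left) fun w => by
      rw [abs_mul]
      exact mul_le_mul (hZb s hs w) ((abs_sub _ _).trans (add_le_add
        (hG _) (hG _))) (abs_nonneg _) (hκc w)
  refine sub_eq_zero.1 ?_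
  rw [← integral_sub j1 j2, ← hdyn]
  refine integral_congr_ae (ae_of_all _ fun w => ?_)
  ring

lemma integrable_occ (h : HasPotential P φ g) {T : ℝ} (hT : 0 ≤ T) : Integrable (occ φ T) P := by
  obtain ⟨c, hc⟩ := h.bound
  exact integrable_of_bound (measurable_occ h.continuous.measurable T) fun w => abs_occ_le hc hT w

lemma integrable_comp_occ (h : HasPotential P φ g) {T : ℝ} (hT : 0 ≤ T) {ψ : ℝ → ℝ}
    (hψ : Continuous ψ) : Integrable (fun w => ψ (occ φ T w)) P := by
  obtain ⟨c, hc⟩ := h.bound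
  obtain ⟨κ, hκ⟩ := (isCompact_Icc (a := -(c * T)) (b := c * T)).bddAbove_image
    (f := fun x => |ψ x|) hψ.abs.continuousOn
  exact integrable_of_bound (hψ.measurable.comp (measurable_occ h.continuous.measurable T))
    fun w => hκ ⟨_, abs_le.1 (abs_occ_le hc hT w), rfl⟩

lemma integral_occ (h : HasPotential P φ g) {z : Cable d} (hz : ∀ᵐ w ∂P, w.1 0 = z) {T : ℝ}
    (hT : 0 ≤ T) : ∫ w, occ φ T w ∂P = g z - ∫ w, g (pathAt w T) ∂P := by
  obtain ⟨G, hG⟩ := h.bound_potential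
  have h0 := h.dynkin 0 T le_rfl hT (fun _ => 1) measurable_const ⟨1, fun _ => by simp⟩
  have i1 := h.integrable_occ hT
  have i2 : Integrable (fun w => g (pathAt w T)) P :=
    integrable_of_bound (h.measurable.comp (measurable_pathAt T)) fun w => hG _
  have h1 : ∫ w, (1 : ℝ) * (g (pathAt w T) - g (pathAt w 0) + (occ φ T w - occ φ 0 w)) ∂P =
      ∫ w, ((g (pathAt w T) - g z) + occ φ T w) ∂P := by
    refine integral_congr_ae ?_
    filter_upwards [hz] with w hw
    rw [occ_zero, pathAt, pathAt, Real.toNNReal_zero, hw]; ring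
  rw [h1, integral_add (f := fun w => g (pathAt w T) - g z) (i2.sub (integrable_const _)) i1,
    integral_sub i2 (integrable_const _)] at h0
  simp only [integral_const, probReal_univ, one_smul] at h0
  linarith

lemma integral_taylor_le (h : HasPotential P φ g) {ψ ψ' ψ'' : ℝ → ℝ}
    (h1 : ∀ x, HasDerivAt ψ (ψ' x) x) (h2 : ∀ x, HasDerivAt ψ' (ψ'' x) x) (h3 : Continuous ψ'')
    (h4 : ∀ x, 0 ≤ ψ'' x) {D : ℝ} (hD : ∀ z z', g z - g z' ≤ D) {T : ℝ} (hT : 0 ≤ T) :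
    ∫ w, (ψ (occ φ T w) - ψ 0 - ψ' 0 * occ φ T w) ∂P ≤
      D * ∫ w, (∫ s in (0 : ℝ)..T, ψ'' (occ φ s w) * |φ (pathAt w s)|) ∂P := by
  rw [h.integral_taylor h1 h2 h3 hT, ← integral_const_mul]
  obtain ⟨c, hc⟩ := h.bound
  obtain ⟨G, hG⟩ := h.bound_potential
  have hφ := h.continuous
  have hgm := h.measurable
  obtain ⟨κ, hκ⟩ := (isCompact_Icc (a := -(c * T)) (b := c * T)).bddAbove_image
    (f := fun x => |ψ'' x|) h3.abs.continuousOn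
  have hψb : ∀ s ∈ Icc 0 T, ∀ w, |ψ'' (occ φ s w)| ≤ κ := fun s hs w =>
    hκ ⟨_, abs_le.1 ((abs_occ_le hc hs.1 w).trans
      (mul_le_mul_of_nonneg_left hs.2 ((abs_nonneg _).trans (hc (pathAt w 0))))), rfl⟩
  have hZb : ∀ s ∈ Icc 0 T, ∀ w, abs (ψ'' (occ φ s w) * |φ (pathAt w s)|) ≤ κ * c := fun s hs w => by
    rw [abs_mul, abs_abs]
    exact mul_le_mul (hψb s hs w) (hc _) (abs_nonneg _) ((abs_nonneg _).trans (hψb s hs w))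
  have hoccm := measurable_uncurry_occ hφ
  have hpm := measurable_uncurry_pathAt (d := d)
  have m1 : Measurable (Function.uncurry fun (s : ℝ) (w : ForwardPath d) =>
      ψ'' (occ φ s w) * |φ (pathAt w s)|) :=
    (h3.measurable.comp hoccm).mul (hφ.abs.measurable.comp hpm)
  have m2 : Measurable (Function.uncurry fun (s : ℝ) (w : ForwardPath d) =>
      ψ'' (occ φ s w) * φ (pathAt w s) * (g (pathAt w s) - g (pathAt w T))) :=
    ((h3.measurable.comp hoccm).mul (hφ.measurable.comp hpm)).mul
      ((hgm.comp hpm).sub ((hgm.comp (measurable_pathAt T)).comp measurable_snd))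
  have b2 : ∀ s ∈ Ioc 0 T, ∀ w, |ψ'' (occ φ s w) * φ (pathAt w s) *
      (g (pathAt w s) - g (pathAt w T))| ≤ κ * c * (G + G) := fun s hs w => by
    have hb := hZb s (Ioc_subset_Icc_self hs) w
    rw [abs_mul, abs_abs, ← abs_mul] at hb
    rw [abs_mul]
    exact mul_le_mul hb ((abs_sub _ _).trans (add_le_add (hG _) (hG _))) (abs_nonneg _)
      ((abs_nonneg _).trans hb)
  refine integral_mono (integrable_intervalIntegral_of_bound m2 hT b2)
    ((integrable_intervalIntegral_of_bound m1 hT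
      fun s hs w => hZb s (Ioc_subset_Icc_self hs) w).const_mul D) fun w => ?_
  have hA := continuous_occ hφ w
  have c1 : IntervalIntegrable (fun s => ψ'' (occ φ s w) * |φ (pathAt w s)|) volume 0 T :=
    ((h3.comp hA).mul (hφ.abs.comp (continuous_pathAt w))).intervalIntegrable _ _
  have c2 : IntervalIntegrable (fun s => ψ'' (occ φ s w) * φ (pathAt w s) *
      (g (pathAt w s) - g (pathAt w T))) volume 0 T := by
    rw [intervalIntegrable_iff_integrableOn_Ioc_of_le hT]
    refine Measure.integrableOn_of_bounded (M := κ * c * (G + G)) (by simp) ?_ ?_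
    · exact (m2.comp (measurable_id.prodMk measurable_const)).aestronglyMeasurable
    · filter_upwards [ae_restrict_mem measurableSet_Ioc] with s hs
      exact b2 s hs w
  simp only
  rw [← intervalIntegral.integral_const_mul]
  refine intervalIntegral.integral_mono_on hT c2 (c1.const_mul D) fun s _ => ?_
  have hab : φ (pathAt w s) * (g (pathAt w s) - g (pathAt w T)) ≤ |φ (pathAt w s)| * D := by
    refine (le_abs_self _).trans ?_
    rw [abs_mul]
    exact mul_le_mul_of_nonneg_left
      (abs_le.2 ⟨by linarith [hD (pathAt w T) (pathAt w s)], hD _ _⟩) (abs_nonneg _)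
  have := mul_le_mul_of_nonneg_left hab (h4 (occ φ s w))
  linarith

/-- For `φ ≥ 0` the time integral in the remainder is a total derivative. -/
lemma integral_taylor_le_of_nonneg (h : HasPotential P φ g) (hφ : ∀ z, 0 ≤ φ z)
    {ψ ψ' ψ'' : ℝ → ℝ}
    (h1 : ∀ x, HasDerivAt ψ (ψ' x) x) (h2 : ∀ x, HasDerivAt ψ' (ψ'' x) x) (h3 : Continuous ψ'')
    (h4 : ∀ x, 0 ≤ ψ'' x) {D : ℝ} (hD : ∀ z z', g z - g z' ≤ D) {T : ℝ} (hT : 0 ≤ T) :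
    ∫ w, (ψ (occ φ T w) - ψ 0 - ψ' 0 * occ φ T w) ∂P ≤
      D * ∫ w, (ψ' (occ φ T w) - ψ' 0) ∂P := by
  refine (h.integral_taylor_le h1 h2 h3 h4 hD hT).trans (le_of_eq ?_)
  congr 1
  refine integral_congr_ae (ae_of_all _ fun w => ?_)
  have hd : ∀ s, HasDerivAt (fun s => ψ' (occ φ s w)) (ψ'' (occ φ s w) * |φ (pathAt w s)|) s := by
    intro s
    rw [abs_of_nonneg (hφ _)]
    exact HasDerivAt.comp (h₂ := ψ') (h := fun s => occ φ s w) s (h2 _)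
      (hasDerivAt_occ h.continuous w s)
  simp only
  rw [intervalIntegral.integral_eq_sub_of_hasDerivAt (fun s _ => hd s), occ_zero]
  exact ((h3.comp (continuous_occ h.continuous w)).mul
    (h.continuous.abs.comp (continuous_pathAt w))).intervalIntegrable _ _

lemma hasDerivAt_exp_mul (θ x : ℝ) :
    HasDerivAt (fun x => Real.exp (θ * x)) (θ * Real.exp (θ * x)) x := by
  simpa [mul_comm] using ((hasDerivAt_id x).const_mul θ).exp

/-- Exponential moments: with `E = E exp (θ ∫ φ)`, the Taylor bound reads
`E - 1 - θ E ∫ φ ≤ θ G (E - 1)`, which is solved for `E`. -/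
lemma integral_exp_occ_le (h : HasPotential P φ g) (hφ : ∀ z, 0 ≤ φ z) (hg : ∀ z, 0 ≤ g z) {G : ℝ}
    (hG : ∀ z, g z ≤ G) {θ : ℝ} (hθ : 0 ≤ θ) (hθG : θ * G < 1) {z : Cable d}
    (hz : ∀ᵐ w ∂P, w.1 0 = z) {T : ℝ} (hT : 0 ≤ T) :
    ∫ w, Real.exp (θ * occ φ T w) ∂P ≤ 1 + θ / (1 - θ * G) * g z := by
  have ht := h.integral_taylor_le_of_nonneg hφ (hasDerivAt_exp_mul θ)
    (fun x => (hasDerivAt_exp_mul θ x).const_mul θ) (by fun_prop)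
    (fun x => mul_nonneg hθ (mul_nonneg hθ (Real.exp_pos _).le))
    (D := G) (fun z z' => by linarith [hG z, hg z']) hT
  have iE := h.integrable_comp_occ hT (ψ := fun x => Real.exp (θ * x)) (by fun_prop)
  have iA := h.integrable_occ hT
  have hAz : ∫ w, occ φ T w ∂P ≤ g z := by
    rw [h.integral_occ hz hT]
    have : 0 ≤ ∫ w, g (pathAt w T) ∂P := integral_nonneg fun w => hg _
    linarith
  rw [integral_sub (f := fun w => Real.exp (θ * occ φ T w) - Real.exp (θ * 0))
    (iE.sub (integrable_const _)) (iA.const_mul _), integral_sub iE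
    (integrable_const _), integral_const_mul, integral_sub (iE.const_mul _) (integrable_const _),
    integral_const_mul] at ht
  simp only [mul_zero, Real.exp_zero, mul_one, integral_const, probReal_univ, one_smul] at ht
  have h1 : 0 < 1 - θ * G := by linarith
  have h2 : θ * ∫ w, occ φ T w ∂P ≤ θ * g z := mul_le_mul_of_nonneg_left hAz hθ
  rw [← sub_le_iff_le_add', div_mul_eq_mul_div, le_div_iff₀ h1]
  linarith

/-- An upper bound on the Laplace transform, from the Taylor bound and
`1 - exp (-θ ∫ φ) ≤ θ ∫ φ`. -/
lemma integral_exp_neg_occ_le (h : HasPotential P φ g) (hφ : ∀ z, 0 ≤ φ z) (hg : ∀ z, 0 ≤ g z)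
    {G : ℝ} (hG : ∀ z, g z ≤ G) {θ : ℝ} (hθ : 0 ≤ θ) {T : ℝ} (hT : 0 ≤ T) :
    ∫ w, Real.exp (-θ * occ φ T w) ∂P ≤ 1 - θ * (1 - θ * G) * ∫ w, occ φ T w ∂P := by
  have ht := h.integral_taylor_le_of_nonneg hφ (hasDerivAt_exp_mul (-θ))
    (fun x => (hasDerivAt_exp_mul (-θ) x).const_mul (-θ)) (by fun_prop)
    (fun x => by nlinarith [mul_nonneg (mul_nonneg hθ hθ) (Real.exp_pos (-θ * x)).le])
    (D := G) (fun z z' => by linarith [hG z, hg z']) hT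
  have iE := h.integrable_comp_occ hT (ψ := fun x => Real.exp (-θ * x)) (by fun_prop)
  have iA := h.integrable_occ hT
  have hG0 : ∀ z : Cable d, 0 ≤ G := fun z => (hg z).trans (hG z)
  have hb : ∫ w, (-θ * Real.exp (-θ * occ φ T w) - -θ * Real.exp (-θ * 0)) ∂P ≤
      ∫ w, θ * θ * occ φ T w ∂P := by
    refine integral_mono ((iE.const_mul _).sub (integrable_const _)) (iA.const_mul _) fun w => ?_
    have := Real.add_one_le_exp (-θ * occ φ T w)
    have := mul_le_mul_of_nonneg_left this hθ
    simp only [mul_zero, Real.exp_zero]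
    linarith
  rw [integral_const_mul] at hb
  obtain ⟨w₀⟩ : Nonempty (ForwardPath d) := P.nonempty_of_neZero
  have hb' := mul_le_mul_of_nonneg_left hb (hG0 (pathAt w₀ 0))
  have ht := ht.trans hb'
  rw [integral_sub (f := fun w => Real.exp (-θ * occ φ T w) - Real.exp (-θ * 0))
    (iE.sub (integrable_const _)) (iA.const_mul _), integral_sub iE
    (integrable_const _), integral_const_mul] at ht
  simp only [mul_zero, Real.exp_zero, mul_one, integral_const, probReal_univ, one_smul] at ht
  linarith

/-- The second moment is small when the oscillation `D` of the potential is, even if `φ` is not; it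
is applied to the difference of two approximations of the same point masses. -/
lemma integral_sq_occ_le (h : HasPotential P φ g) {D : ℝ} (hD : ∀ z z', g z - g z' ≤ D) {T : ℝ}
    (hT : 0 ≤ T) :
    ∫ w, occ φ T w ^ 2 ∂P ≤ 2 * D * ∫ w, occ (fun z => |φ z|) T w ∂P := by
  have ht := h.integral_taylor_le (ψ := fun x => x ^ 2) (ψ' := fun x => 2 * x) (ψ'' := fun _ => 2)
    (fun x => by simpa using hasDerivAt_pow 2 x)
    (fun x => by simpa using (hasDerivAt_id x).const_mul 2) continuous_const (fun _ => by norm_num)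
    hD hT
  simp only [intervalIntegral.integral_const_mul, integral_const_mul] at ht
  simp only [ne_eq, OfNat.ofNat_ne_zero, not_false_eq_true, zero_pow, sub_zero, mul_zero,
    zero_mul] at ht
  unfold occ at ht ⊢
  linarith

end HasPotential

/-! ### Local time at a vertex as a limit of smoothed local times -/

/-- Radii that decrease slowly enough for consecutive ratios to tend to `1`, so that local times can
be computed along them, and fast enough for the smoothed local times to converge almost surely. -/
def radius (n : ℕ) : ℝ := 1 / ((n : ℝ) + 1) ^ 4

lemma radius_pos (n : ℕ) : 0 < radius n := by unfold radius; positivity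

lemma radius_succ_lt (n : ℕ) : radius (n + 1) < radius n := by
  unfold radius
  push_cast
  gcongr
  linarith

lemma radius_antitone : Antitone radius := antitone_nat_of_succ_le fun n => (radius_succ_lt n).le

lemma radius_le_one (n : ℕ) : radius n ≤ 1 := by
  have := radius_antitone (Nat.zero_le n)
  simpa [radius] using this

lemma tendsto_radius : Tendsto radius atTop (𝓝 0) := by
  have h := (tendsto_one_div_add_atTop_nhds_zero_nat (𝕜 := ℝ)).pow 4
  rw [zero_pow (by norm_num)] at h
  exact h.congr fun n => by rw [radius, div_pow, one_pow]

lemma tendsto_radius_div_succ : Tendsto (fun n => radius n / radius (n + 1)) atTop (𝓝 1) := by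
  have h := ((tendsto_one_div_add_atTop_nhds_zero_nat (𝕜 := ℝ)).const_add 1).pow 4
  rw [add_zero, one_pow] at h
  refine h.congr fun n => ?_
  unfold radius
  push_cast
  have : (n : ℝ) + 1 ≠ 0 := by positivity
  have : (n : ℝ) + 1 + 1 ≠ 0 := by positivity
  field_simp

/-- The cutoff that is `1` up to `radius (n + 1)`, `0` beyond `radius n` and linear in between. It is
sandwiched between the indicators of two consecutive balls. -/
def trapezoid (n : ℕ) (s : ℝ) : ℝ :=
  max 0 (min 1 ((radius n - s) / (radius n - radius (n + 1))))

lemma trapezoid_nonneg (n : ℕ) (s : ℝ) : 0 ≤ trapezoid n s := le_max_left _ _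

lemma trapezoid_le_one (n : ℕ) (s : ℝ) : trapezoid n s ≤ 1 :=
  max_le zero_le_one (min_le_left _ _)

lemma trapezoid_of_le {n : ℕ} {s : ℝ} (h : s ≤ radius (n + 1)) : trapezoid n s = 1 := by
  have h0 := radius_succ_lt n
  rw [trapezoid, min_eq_left ((one_le_div (by linarith)).2 (by linarith)),
    max_eq_right zero_le_one]

lemma trapezoid_of_ge {n : ℕ} {s : ℝ} (h : radius n ≤ s) : trapezoid n s = 0 := by
  have h0 := radius_succ_lt n
  exact max_eq_left ((min_le_right _ _).trans (div_nonpos_of_nonpos_of_nonneg (by linarith)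
    (by linarith)))

lemma continuous_trapezoid (n : ℕ) : Continuous (trapezoid n) := by
  unfold trapezoid; fun_prop

/-- The integral of `trapezoid n`. -/
def trapezoidMass (n : ℕ) : ℝ := ∫ s in (0 : ℝ)..1, trapezoid n s

lemma radius_succ_le_mass (n : ℕ) : radius (n + 1) ≤ trapezoidMass n := by
  have hi := fun a b => (continuous_trapezoid n).intervalIntegrable (μ := volume) a b
  have h1 := intervalIntegral.integral_add_adjacent_intervals (hi 0 (radius (n + 1)))
    (hi (radius (n + 1)) 1)
  have h2 : ∫ s in (0 : ℝ)..radius (n + 1), trapezoid n s = ∫ s in (0 : ℝ)..radius (n + 1), (1 : ℝ) := by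
    refine intervalIntegral.integral_congr fun s hs => ?_
    rw [uIcc_of_le (radius_pos _).le] at hs
    exact trapezoid_of_le hs.2
  have h3 : 0 ≤ ∫ s in radius (n + 1)..1, trapezoid n s :=
    intervalIntegral.integral_nonneg (radius_le_one _) fun s _ => trapezoid_nonneg n s
  rw [h2, intervalIntegral.integral_const, sub_zero, smul_eq_mul, mul_one] at h1
  unfold trapezoidMass
  linarith

lemma mass_le_radius (n : ℕ) : trapezoidMass n ≤ radius n := by
  have hi := fun a b => (continuous_trapezoid n).intervalIntegrable (μ := volume) a b
  have h1 := intervalIntegral.integral_add_adjacent_intervals (hi 0 (radius n)) (hi (radius n) 1)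
  have h2 : ∫ s in (0 : ℝ)..radius n, trapezoid n s ≤ ∫ s in (0 : ℝ)..radius n, (1 : ℝ) :=
    intervalIntegral.integral_mono_on (radius_pos n).le (hi _ _) intervalIntegrable_const
      fun s _ => trapezoid_le_one n s
  have h3 : ∫ s in radius n..1, trapezoid n s = 0 := by
    rw [intervalIntegral.integral_congr (g := fun _ => (0 : ℝ)) fun s hs => ?_,
      intervalIntegral.integral_zero]
    rw [uIcc_of_le (radius_le_one n)] at hs
    exact trapezoid_of_ge hs.1
  rw [intervalIntegral.integral_const, sub_zero, smul_eq_mul, mul_one] at h2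
  unfold trapezoidMass
  linarith

lemma mass_pos (n : ℕ) : 0 < trapezoidMass n := (radius_pos _).trans_le (radius_succ_le_mass n)

/-- The normalised trapezoid. -/
def bump (n : ℕ) (s : ℝ) : ℝ := trapezoid n s / trapezoidMass n

lemma isBump_bump (n : ℕ) : IsBump (bump n) (radius n) where
  continuous := (continuous_trapezoid n).div_const _
  nonneg s := div_nonneg (trapezoid_nonneg n s) (mass_pos n).le
  eq_zero s hs := by rw [bump, trapezoid_of_ge hs, zero_div]
  integral_eq := by
    unfold bump
    rw [intervalIntegral.integral_div]
    exact div_self (mass_pos n).ne'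
  pos := radius_pos n
  le_one := radius_le_one n

/-- The smoothed local time at the vertex `y` during the time set `S`. The factor `d⁻¹` makes the
weight a probability density: the `2d` edges at `y` have length `1/2`, half their length in `ℝ^d`. -/
def bumpTime (n : ℕ) (y : Fin d → ℤ) (S : Set ℝ) (X : ℝ → Cable d) : ℝ≥0∞ :=
  ∫⁻ t in S, ENNReal.ofReal ((d : ℝ)⁻¹ * bump n (dist (X t) (vertex y)))

lemma volume_le_bumpTime [NeZero d] (n : ℕ) (y : Fin d → ℤ) {X : ℝ → Cable d} (hX : Continuous X) :
    volume {t | X t ∈ Metric.ball (vertex y) (radius (n + 1))} ≤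
      ENNReal.ofReal (d * trapezoidMass n) * bumpTime n y univ X := by
  have hd : (0 : ℝ) < d := by exact_mod_cast NeZero.pos d
  have hm := mass_pos n
  have hc : Continuous fun t => (d : ℝ)⁻¹ * bump n (dist (X t) (vertex y)) :=
    continuous_const.mul ((isBump_bump n).continuous.comp (hX.dist continuous_const))
  rw [bumpTime, Measure.restrict_univ, ← lintegral_const_mul _ hc.measurable.ennreal_ofReal]
  have hms : MeasurableSet {t | X t ∈ Metric.ball (vertex y) (radius (n + 1))} :=
    hX.measurable measurableSet_ball
  rw [← lintegral_indicator_one hms]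
  refine lintegral_mono fun t => ?_
  by_cases ht : t ∈ {t | X t ∈ Metric.ball (vertex y) (radius (n + 1))}
  · rw [indicator_of_mem ht, ← ENNReal.ofReal_mul (by positivity), bump,
      trapezoid_of_le (Metric.mem_ball.1 ht).le, Pi.one_apply]
    rw [ENNReal.one_le_ofReal]
    apply le_of_eq
    field_simp
  · rw [indicator_of_notMem ht]; exact bot_le

lemma bumpTime_le_volume [NeZero d] (n : ℕ) (y : Fin d → ℤ) {X : ℝ → Cable d} (hX : Continuous X) :
    ENNReal.ofReal (d * trapezoidMass n) * bumpTime n y univ X ≤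
      volume {t | X t ∈ Metric.ball (vertex y) (radius n)} := by
  have hd : (0 : ℝ) < d := by exact_mod_cast NeZero.pos d
  have hm := mass_pos n
  have hc : Continuous fun t => (d : ℝ)⁻¹ * bump n (dist (X t) (vertex y)) :=
    continuous_const.mul ((isBump_bump n).continuous.comp (hX.dist continuous_const))
  rw [bumpTime, Measure.restrict_univ, ← lintegral_const_mul _ hc.measurable.ennreal_ofReal]
  have hms : MeasurableSet {t | X t ∈ Metric.ball (vertex y) (radius n)} :=
    hX.measurable measurableSet_ball
  rw [← lintegral_indicator_one hms]
  refine lintegral_mono fun t => ?_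
  rw [← ENNReal.ofReal_mul (by positivity)]
  by_cases ht : t ∈ {t | X t ∈ Metric.ball (vertex y) (radius n)}
  · rw [indicator_of_mem ht, Pi.one_apply, ENNReal.ofReal_le_one, bump]
    refine le_trans (le_of_eq ?_) (trapezoid_le_one n (dist (X t) (vertex y)))
    field_simp
  · have : radius n ≤ dist (X t) (vertex y) := not_lt.1 ht
    rw [indicator_of_notMem ht, bump, trapezoid_of_ge this]; simp

/-- The `limsup` over all small balls that defines the local time may be computed with the smoothed
local times, because consecutive radii are asymptotically equal. -/
lemma pathLocalTime_vertex [NeZero d] (y : Fin d → ℤ) {X : ℝ → Cable d} (hX : Continuous X) :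
    pathLocalTime X (vertex y) = limsup (fun n => bumpTime n y univ X) atTop := by
  have hd : (0 : ℝ) < d := by exact_mod_cast NeZero.pos d
  set v : ℝ → ℝ≥0∞ := fun r => volume {t : ℝ | X t ∈ Metric.ball (vertex y) r} with hv
  have hvmono : Monotone v := fun r r' h => measure_mono fun t ht => Metric.ball_subset_ball h ht
  set B : ℕ → ℝ≥0∞ := fun n => bumpTime n y univ X with hB
  set ratio : ℝ → ℝ≥0∞ := fun r => v r / cableLebesgue d (Metric.ball (vertex y) r) with hratio
  have hratio_eq : ∀ r, 0 < r → r ≤ 1 → ratio r = v r / ENNReal.ofReal (d * r) := fun r h0 h1 => by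
    rw [hratio]; simp only [cableLebesgue_ball y h0 h1]
  change limsup ratio (𝓝[>] 0) = limsup B atTop
  have hmul : ∀ (c : ℕ → ℝ) (u : ℕ → ℝ≥0∞), Tendsto c atTop (𝓝 1) →
      limsup (fun n => ENNReal.ofReal (c n) * u n) atTop ≤ limsup u atTop := by
    intro c u hc
    have h1 : Tendsto (fun n => ENNReal.ofReal (c n)) atTop (𝓝 1) := by
      simpa using ENNReal.tendsto_ofReal hc
    have h2 := h1.limsup_eq
    refine (ENNReal.limsup_mul_le' (u := fun n => ENNReal.ofReal (c n)) (Or.inl ?_)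
      (Or.inl ?_)).trans ?_
    · rw [h2]; simp
    · rw [h2]; simp
    · rw [h2, one_mul]
  apply le_antisymm
  · have hc : Tendsto (fun n => radius n / radius (n + 2)) atTop (𝓝 1) := by
      have h := tendsto_radius_div_succ.mul (tendsto_radius_div_succ.comp (tendsto_add_atTop_nat 1))
      rw [one_mul] at h
      refine h.congr fun n => ?_
      have := (radius_pos (n + 1)).ne'
      have := (radius_pos (n + 2)).ne'
      simp only [Function.comp]
      field_simp
    refine le_trans ?_ (hmul _ B hc)
    refine le_of_forall_gt_imp_ge_of_dense fun b hb => ?_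
    obtain ⟨N, hN⟩ := eventually_atTop.1 (eventually_lt_of_limsup_lt hb)
    refine limsup_le_of_le (by isBoundedDefault) ?_
    have hmem : Ioc 0 (radius (N + 1)) ∈ 𝓝[>] (0 : ℝ) :=
      Ioc_mem_nhdsGT (radius_pos _)
    filter_upwards [hmem] with r hr
    -- the last index with `r ≤ radius (n + 1)`
    have hex : ∃ n, radius (n + 1) < r :=
      ((tendsto_radius.comp (tendsto_add_atTop_nat 1)).eventually_lt_const hr.1).exists
    classical
    set k := Nat.find hex with hk
    have hk1 : radius (k + 1) < r := Nat.find_spec hex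
    have hkN : N < k := by
      by_contra h
      exact absurd (hr.2.trans (radius_antitone (by omega : k + 1 ≤ N + 1))) (not_le.2 hk1)
    obtain ⟨n, hn⟩ : ∃ n, k = n + 1 := ⟨k - 1, by omega⟩
    have hk2 : r ≤ radius (n + 1) := not_lt.1 (Nat.find_min hex (by omega : n < k))
    rw [hn] at hk1
    have hr1 : r ≤ 1 := hk2.trans (radius_le_one _)
    rw [hratio_eq r hr.1 hr1]
    have hr2 := radius_pos (n + 2)
    refine le_trans ?_ (hN n (by omega)).le
    calc v r / ENNReal.ofReal (d * r) ≤ v (radius (n + 1)) / ENNReal.ofReal (d * radius (n + 2)) := by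
          gcongr
          exact hvmono hk2
      _ ≤ ENNReal.ofReal (d * radius n) * B n / ENNReal.ofReal (d * radius (n + 2)) := by
          gcongr
          refine (volume_le_bumpTime n y hX).trans ?_
          gcongr
          exact mass_le_radius n
      _ = ENNReal.ofReal (radius n / radius (n + 2)) * B n := by
          rw [ENNReal.mul_div_right_comm, ← ENNReal.ofReal_div_of_pos (by positivity),
            mul_div_mul_left _ _ hd.ne']
  · have h1 : ∀ n, B n ≤ ENNReal.ofReal (radius n / radius (n + 1)) * ratio (radius n) := by
      intro n
      have hr0 := radius_pos n
      have hr1 := radius_pos (n + 1)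
      rw [hratio_eq _ hr0 (radius_le_one n)]
      have h2 := bumpTime_le_volume n y hX
      have h3 : ENNReal.ofReal (d * radius (n + 1)) * B n ≤ v (radius n) := by
        refine le_trans ?_ h2
        gcongr
        exact radius_succ_le_mass n
      have h4 : ENNReal.ofReal (radius n / radius (n + 1)) * (v (radius n) / ENNReal.ofReal (d * radius n)) =
          v (radius n) / ENNReal.ofReal (d * radius (n + 1)) := by
        rw [div_eq_mul_inv (v _), div_eq_mul_inv (v _), mul_left_comm,
          ← ENNReal.ofReal_inv_of_pos (by positivity), ← ENNReal.ofReal_inv_of_pos (by positivity),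
          ← ENNReal.ofReal_mul (by positivity)]
        congr 2
        field_simp
      rw [h4, ENNReal.le_div_iff_mul_le (Or.inl (ENNReal.ofReal_pos.2 (by positivity)).ne') (Or.inl ENNReal.ofReal_ne_top),
        mul_comm]
      exact h3
    refine (limsup_le_limsup (Eventually.of_forall h1)).trans ((hmul _ _ tendsto_radius_div_succ).trans ?_)
    have h5 : Tendsto radius atTop (𝓝[>] 0) :=
      tendsto_nhdsWithin_iff.2 ⟨tendsto_radius, Eventually.of_forall fun n => radius_pos n⟩
    exact limsup_le_limsup_of_le (f := map radius atTop) (u := ratio) h5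

/-! ### The Green potential of a finite set of vertices -/

/-- The Green potential of `B`, in the normalisation of unit edge weights: `(2d)⁻¹` times the expected
number of visits to `B` of the walk from `x`. It is also the expected sum of the local times of the
diffusion at the points of `B`. -/
def greenPotential (B : Finset (Fin d → ℤ)) (x : Fin d → ℤ) : ℝ :=
  (2 * d : ℝ)⁻¹ * (green (indicator (B : Set (Fin d → ℤ)) 1) x).toReal

lemma greenPotential_nonneg (B : Finset (Fin d → ℤ)) (x : Fin d → ℤ) : 0 ≤ greenPotential B x :=
  mul_nonneg (by positivity) ENNReal.toReal_nonneg

lemma negLaplace_greenPotential (hd : 3 ≤ d) (B : Finset (Fin d → ℤ)) (x : Fin d → ℤ) :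
    negLaplace (greenPotential B) x = (2 * d : ℝ)⁻¹ * indicator (B : Set (Fin d → ℤ)) 1 x := by
  have hG := green_indicator_ne_top hd B
  have h := congrArg ENNReal.toReal
    (congrFun (green_eq (indicator (B : Set (Fin d → ℤ)) (1 : (Fin d → ℤ) → ℝ≥0∞))) x)
  have hi : indicator (B : Set (Fin d → ℤ)) (1 : (Fin d → ℤ) → ℝ≥0∞) x ≠ ∞ := by
    by_cases hx : x ∈ B <;> simp [hx]
  have hs : stepMean (green (indicator (B : Set (Fin d → ℤ)) 1)) x ≠ ∞ := by
    unfold stepMean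
    have : (2 * d : ℝ≥0∞) ≠ 0 := by
      have : d ≠ 0 := by omega
      simp [this]
    exact ENNReal.mul_ne_top (ENNReal.inv_ne_top.2 this) (ENNReal.sum_ne_top.2 fun v _ => hG _)
  rw [Pi.add_apply, ENNReal.toReal_add hi hs] at h
  have h1 : (indicator (B : Set (Fin d → ℤ)) (1 : (Fin d → ℤ) → ℝ≥0∞) x).toReal =
      indicator (B : Set (Fin d → ℤ)) 1 x := by
    by_cases hx : x ∈ B <;> simp [hx]
  have h2 : (stepMean (green (indicator (B : Set (Fin d → ℤ)) 1)) x).toReal =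
      ∑ v : Dir d, greenPotential B (x + unitVec v) := by
    unfold stepMean greenPotential
    rw [ENNReal.toReal_mul, ENNReal.toReal_sum (fun v _ => hG _), ← Finset.mul_sum]
    simp
  rw [negLaplace, greenPotential, h, h1, h2]
  ring

lemma negLaplace_greenPotential_nonneg (hd : 3 ≤ d) (B : Finset (Fin d → ℤ)) (x : Fin d → ℤ) :
    0 ≤ negLaplace (greenPotential B) x := by
  rw [negLaplace_greenPotential hd]
  exact mul_nonneg (by positivity) (indicator_nonneg (fun _ _ => zero_le_one) _)

lemma negLaplace_greenPotential_le_one (hd : 3 ≤ d) (B : Finset (Fin d → ℤ)) (x : Fin d → ℤ) :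
    negLaplace (greenPotential B) x ≤ 1 := by
  rw [negLaplace_greenPotential hd]
  have hd0 : (1 : ℝ) ≤ 2 * d := by
    have : (3 : ℝ) ≤ d := by exact_mod_cast hd
    linarith
  refine mul_le_one₀ (inv_le_one_of_one_le₀ hd0) (indicator_nonneg (fun _ _ => zero_le_one) _) ?_
  exact indicator_le_self' (fun _ _ => zero_le_one) _

lemma negLaplace_greenPotential_le (B : Finset (Fin d → ℤ)) (x : Fin d → ℤ) :
    negLaplace (greenPotential B) x ≤ greenPotential B x := by
  unfold negLaplace
  have : 0 ≤ (2 * d : ℝ)⁻¹ * ∑ v : Dir d, greenPotential B (x + unitVec v) :=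
    mul_nonneg (by positivity) (Finset.sum_nonneg fun v _ => greenPotential_nonneg _ _)
  linarith

lemma exists_greenPotential_le (hd : 3 ≤ d) (B : Finset (Fin d → ℤ)) :
    ∃ A, ∀ x, greenPotential B x ≤ A := by
  obtain ⟨r, hr, hB⟩ := finset_sqNorm_bdd B
  refine ⟨(2 * d : ℝ)⁻¹ * (50 * (14400 + r) ^ (5 / 4 : ℝ) * 1), fun x => ?_⟩
  refine mul_le_mul_of_nonneg_left ?_ (by positivity)
  have h1 : lyapunov 14400 x ≤ 1 := by
    have := sqNorm_nonneg x
    exact Real.rpow_le_one_of_one_le_of_nonpos (by linarith) (by norm_num)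
  refine ENNReal.toReal_le_of_le_ofReal (by positivity) ?_
  refine (green_le_lyapunov hd le_rfl hr B hB x).trans (ENNReal.ofReal_le_ofReal ?_)
  gcongr

lemma tendsto_greenPotential (hd : 3 ≤ d) (B : Finset (Fin d → ℤ)) :
    Tendsto (greenPotential B) cofinite (𝓝 0) := by
  have h := (tendsto_green_indicator hd B).const_mul (2 * d : ℝ)⁻¹
  rw [mul_zero] at h
  exact h

/-! ### The smoothed Green potential on the cable system -/

lemma potentialProfile_green_nonneg (hd : 3 ≤ d) {k : ℝ → ℝ} {ρ : ℝ} (hk : IsBump k ρ)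
    (B : Finset (Fin d → ℤ)) (x : Fin d → ℤ) {s : ℝ} (hs : 0 ≤ s) :
    0 ≤ potentialProfile k (greenPotential B) x s := by
  have h1 := negLaplace_greenPotential_le B x
  have h2 := negLaplace_greenPotential_nonneg hd B x
  have h3 := hk.tail2_le_tent hs
  have h4 := hk.tail2_nonneg s
  unfold potentialProfile
  nlinarith [mul_le_mul h1 h3 h4 (greenPotential_nonneg B x)]

lemma potentialProfile_green_le (hd : 3 ≤ d) {k : ℝ → ℝ} {ρ : ℝ} (hk : IsBump k ρ)
    (B : Finset (Fin d → ℤ)) (x : Fin d → ℤ) (s : ℝ) :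
    potentialProfile k (greenPotential B) x s ≤ greenPotential B x * max (1 - s) 0 := by
  have h2 := negLaplace_greenPotential_nonneg hd B x
  have h4 := hk.tail2_nonneg s
  unfold potentialProfile
  nlinarith [mul_nonneg h2 h4]

lemma potential_green_nonneg (hd : 3 ≤ d) {k : ℝ → ℝ} {ρ : ℝ} (hk : IsBump k ρ)
    (B : Finset (Fin d → ℤ)) (z : Cable d) : 0 ≤ potential k (greenPotential B) z :=
  tsum_nonneg fun x => potentialProfile_green_nonneg hd hk B x dist_nonneg

lemma potential_green_edgePoint_le (hd : 3 ≤ d) {k : ℝ → ℝ} {ρ : ℝ} (hk : IsBump k ρ)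
    (B : Finset (Fin d → ℤ)) (x : Fin d → ℤ) (v : Dir d) {t : ℝ} (ht : t ∈ Icc (0 : ℝ) (1 / 2)) {A : ℝ}
    (h1 : greenPotential B x ≤ A) (h2 : greenPotential B (x + unitVec v) ≤ A) :
    potential k (greenPotential B) (edgePoint x v t) ≤ A := by
  rw [potential, radialSum_edgePoint (potentialProfile_eq_zero hk _) x v ht]
  have e1 := potentialProfile_green_le hd hk B x (2 * t)
  have e2 := potentialProfile_green_le hd hk B (x + unitVec v) (1 - 2 * t)
  obtain ⟨ht0, ht1⟩ := ht
  rw [max_eq_left (by linarith)] at e1 e2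
  have e3 := mul_le_mul_of_nonneg_right h1 (by linarith : 0 ≤ 1 - 2 * t)
  have e4 := mul_le_mul_of_nonneg_right h2 (by linarith : 0 ≤ 1 - (1 - 2 * t))
  linarith

lemma potential_green_le [NeZero d] (hd : 3 ≤ d) {k : ℝ → ℝ} {ρ : ℝ} (hk : IsBump k ρ)
    (B : Finset (Fin d → ℤ)) {A : ℝ} (hA : ∀ x, greenPotential B x ≤ A) (z : Cable d) :
    potential k (greenPotential B) z ≤ A := by
  obtain ⟨x, v, t, ht, rfl⟩ := exists_edgePoint z
  exact potential_green_edgePoint_le hd hk B x v ht (hA _) (hA _)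

lemma potential_green_vertex_le [NeZero d] (hd : 3 ≤ d) {k : ℝ → ℝ} {ρ : ℝ} (hk : IsBump k ρ)
    (B : Finset (Fin d → ℤ)) (x : Fin d → ℤ) :
    potential k (greenPotential B) (vertex x) ≤ greenPotential B x := by
  rw [potential, radialSum_vertex (potentialProfile_eq_zero hk _)]
  simpa using potentialProfile_green_le hd hk B x 0

lemma le_potential_green_vertex [NeZero d] (hd : 3 ≤ d) {k : ℝ → ℝ} {ρ : ℝ} (hk : IsBump k ρ)
    (B : Finset (Fin d → ℤ)) (x : Fin d → ℤ) :
    greenPotential B x - ρ ≤ potential k (greenPotential B) (vertex x) := by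
  rw [potential, radialSum_vertex (potentialProfile_eq_zero hk _), potentialProfile]
  have h1 := negLaplace_greenPotential_le_one hd B x
  have h2 := negLaplace_greenPotential_nonneg hd B x
  have h3 := hk.tail2_le_radius le_rfl
  have h4 := hk.tail2_nonneg 0
  simp only [sub_zero, max_eq_left zero_le_one, mul_one]
  nlinarith [mul_le_mul h1 h3 h4 zero_le_one]

lemma tendsto_potential_green [NeZero d] (hd : 3 ≤ d) {k : ℝ → ℝ} {ρ : ℝ} (hk : IsBump k ρ)
    (B : Finset (Fin d → ℤ)) :
    Tendsto (potential k (greenPotential B)) (cocompact (Cable d)) (𝓝 0) := by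
  rw [Metric.tendsto_nhds]
  intro ε hε
  have hfin : {x | ¬ greenPotential B x < ε / 2}.Finite := by
    have := (tendsto_greenPotential hd B).eventually_lt_const (half_pos hε)
    exact this
  have hcomp : IsCompact (⋃ x ∈ hfin.toFinset, Metric.closedBall (vertex x : Cable d) 1) :=
    hfin.toFinset.isCompact_biUnion fun x _ => isCompact_closedBall _ _
  filter_upwards [hcomp.compl_mem_cocompact] with z hz
  simp only [mem_compl_iff, mem_iUnion, Set.Finite.mem_toFinset, mem_ofPred_eq,
    Metric.mem_closedBall, not_exists] at hz
  obtain ⟨x, v, t, ht, rfl⟩ := exists_edgePoint z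
  have h1 : greenPotential B x < ε / 2 := by
    by_contra h
    refine hz x h ?_
    rw [dist_edgePoint_left x v ht.1]; linarith [ht.2]
  have h2 : greenPotential B (x + unitVec v) < ε / 2 := by
    by_contra h
    refine hz _ h ?_
    rw [dist_edgePoint_right x v ht.2]; linarith [ht.1]
  rw [Real.dist_eq, sub_zero, abs_of_nonneg (potential_green_nonneg hd hk B _)]
  have := potential_green_edgePoint_le hd hk B x v ht h1.le h2.le
  linarith

/-! ### Local time of the diffusion at a finite set of vertices -/

/-- The density with occupation integral the sum of the smoothed local times at the points of `B`;
see `boxDensity_eq`. It is defined as the charge of the Green potential. -/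
def boxDensity (n : ℕ) (B : Finset (Fin d → ℤ)) : Cable d → ℝ :=
  charge (bump n) (negLaplace (greenPotential B))

lemma boxDensity_eq (hd : 3 ≤ d) (n : ℕ) (B : Finset (Fin d → ℤ)) (z : Cable d) :
    boxDensity n B z = ∑ y ∈ B, (d : ℝ)⁻¹ * bump n (dist z (vertex y)) := by
  have hd0 : (d : ℝ) ≠ 0 := by
    have : d ≠ 0 := by omega
    exact_mod_cast this
  unfold boxDensity charge
  rw [radialSum_eq_sum (S := B) fun x hx s => by rw [negLaplace_greenPotential hd]; simp [hx]]
  refine Finset.sum_congr rfl fun y hy => ?_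
  rw [negLaplace_greenPotential hd, indicator_of_mem (by simpa using hy)]
  simp only [Pi.one_apply]
  field_simp

lemma boxDensity_nonneg (hd : 3 ≤ d) (n : ℕ) (B : Finset (Fin d → ℤ)) (z : Cable d) :
    0 ≤ boxDensity n B z := by
  rw [boxDensity_eq hd]
  exact Finset.sum_nonneg fun y _ => mul_nonneg (by positivity) ((isBump_bump n).nonneg _)

lemma hasPotential_boxDensity [NeZero d] (hd : 3 ≤ d) (n : ℕ) (B : Finset (Fin d → ℤ)) {z : Cable d}
    {P : Measure (ForwardPath d)} (hP : IsDiffusionLaw z P) :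
    HasPotential P (boxDensity n B) (potential (bump n) (greenPotential B)) := by
  obtain ⟨A, hA⟩ := exists_greenPotential_le hd B
  refine hasPotential (isBump_bump n) hP (c := A) (fun x => ?_) (S := B) fun x hx => ?_
  · rw [abs_of_nonneg (greenPotential_nonneg B x)]; exact hA x
  · rw [negLaplace_greenPotential hd]; simp [hx]

/-- The occupation integral of `φ ≥ 0` over all positive times. -/
def totalTime (φ : Cable d → ℝ) (w : ForwardPath d) : ℝ≥0∞ :=
  ∫⁻ t in Ioi (0 : ℝ), ENNReal.ofReal (φ (pathAt w t))

lemma measurable_totalTime {φ : Cable d → ℝ} (hφ : Measurable φ) : Measurable (totalTime φ) := by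
  have h : Measurable fun p : ForwardPath d × ℝ => ENNReal.ofReal (φ (pathAt p.1 p.2)) :=
    ((hφ.comp measurable_uncurry_pathAt).comp measurable_swap).ennreal_ofReal
  exact h.lintegral_prod_right'

lemma tendsto_occ {φ : Cable d → ℝ} (hφ : Continuous φ) (h0 : ∀ z, 0 ≤ φ z) (w : ForwardPath d) :
    Tendsto (fun T : ℕ => ENNReal.ofReal (occ φ T w)) atTop (𝓝 (totalTime φ w)) := by
  have hc := hφ.comp (continuous_pathAt w)
  have hcov : AECover (volume.restrict (Ioi (0 : ℝ))) atTop fun T : ℕ => Iic (T : ℝ) :=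
    aecover_Iic tendsto_natCast_atTop_atTop
  have h := hcov.lintegral_tendsto_of_nat (f := fun t => ENNReal.ofReal (φ (pathAt w t)))
    hc.measurable.ennreal_ofReal.aemeasurable
  refine h.congr fun T => ?_
  rw [Measure.restrict_restrict measurableSet_Iic, inter_comm, Ioi_inter_Iic, occ,
    intervalIntegral.integral_of_le (Nat.cast_nonneg T),
    ofReal_integral_eq_lintegral_ofReal _ (ae_of_all _ fun t => h0 _)]
  have hi : IntegrableOn (fun t => φ (pathAt w t)) (Icc 0 (T : ℝ)) := hc.continuousOn.integrableOn_Icc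
  exact hi.mono_set Ioc_subset_Icc_self

lemma totalTime_boxDensity (hd : 3 ≤ d) (n : ℕ) (B : Finset (Fin d → ℤ)) (w : ForwardPath d) :
    totalTime (boxDensity n B) w = ∑ y ∈ B, bumpTime n y (Ioi 0) (pathAt w) := by
  have hc : ∀ y : Fin d → ℤ, Continuous fun t => (d : ℝ)⁻¹ * bump n (dist (pathAt w t) (vertex y)) :=
    fun y => continuous_const.mul
      ((isBump_bump n).continuous.comp ((continuous_pathAt w).dist continuous_const))
  unfold totalTime bumpTime
  rw [← lintegral_finsetSum _ fun y _ => (hc y).measurable.ennreal_ofReal]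
  refine lintegral_congr fun t => ?_
  rw [boxDensity_eq hd, ENNReal.ofReal_sum_of_nonneg fun y _ =>
    mul_nonneg (by positivity) ((isBump_bump n).nonneg _)]

/-- Fatou's lemma for an almost surely convergent sequence. -/
lemma lintegral_le_of_ae_tendsto {Ω : Type*} {m : MeasurableSpace Ω} {P : Measure Ω}
    {F : ℕ → Ω → ℝ≥0∞} {G : Ω → ℝ≥0∞} (hF : ∀ n, Measurable (F n))
    (h : ∀ᵐ ω ∂P, Tendsto (fun n => F n ω) atTop (𝓝 (G ω))) {c : ℕ → ℝ≥0∞} {C : ℝ≥0∞}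
    (hc : ∀ n, ∫⁻ ω, F n ω ∂P ≤ c n) (hC : Tendsto c atTop (𝓝 C)) : ∫⁻ ω, G ω ∂P ≤ C := by
  calc ∫⁻ ω, G ω ∂P = ∫⁻ ω, liminf (fun n => F n ω) atTop ∂P := by
        refine lintegral_congr_ae ?_
        filter_upwards [h] with ω hω
        exact hω.liminf_eq.symm
    _ ≤ liminf (fun n => ∫⁻ ω, F n ω ∂P) atTop := lintegral_liminf_le hF
    _ ≤ liminf c atTop := liminf_le_liminf (Eventually.of_forall hc)
    _ = C := hC.liminf_eq

section law
variable {x : Fin d → ℤ} {P : Measure (ForwardPath d)}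

lemma integral_occ_boxDensity_le [NeZero d] (hd : 3 ≤ d) (hP : IsDiffusionLaw (vertex x) P) (n : ℕ)
    (B : Finset (Fin d → ℤ)) {T : ℝ} (hT : 0 ≤ T) :
    ∫ w, occ (boxDensity n B) T w ∂P ≤ greenPotential B x := by
  have := hP.isProbability
  rw [(hasPotential_boxDensity hd n B hP).integral_occ hP.start hT]
  have h1 := potential_green_vertex_le hd (isBump_bump n) B x
  have h2 : 0 ≤ ∫ w, potential (bump n) (greenPotential B) (pathAt w T) ∂P :=
    integral_nonneg fun w => potential_green_nonneg hd (isBump_bump n) B _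
  linarith

lemma occ_nonneg {φ : Cable d → ℝ} (h0 : ∀ z, 0 ≤ φ z) {T : ℝ} (hT : 0 ≤ T) (w : ForwardPath d) :
    0 ≤ occ φ T w := intervalIntegral.integral_nonneg hT fun _ _ => h0 _

lemma lintegral_totalTime_le [NeZero d] (hd : 3 ≤ d) (hP : IsDiffusionLaw (vertex x) P) (n : ℕ)
    (B : Finset (Fin d → ℤ)) :
    ∫⁻ w, totalTime (boxDensity n B) w ∂P ≤ ENNReal.ofReal (greenPotential B x) := by
  have := hP.isProbability
  have hpot := hasPotential_boxDensity hd n B hP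
  refine lintegral_le_of_ae_tendsto (F := fun T : ℕ => fun w => ENNReal.ofReal (occ (boxDensity n B) T w))
    (fun T => (measurable_occ hpot.continuous.measurable _).ennreal_ofReal)
    (ae_of_all _ fun w => tendsto_occ hpot.continuous (boxDensity_nonneg hd n B) w)
    (c := fun _ => ENNReal.ofReal (greenPotential B x)) (fun T => ?_) tendsto_const_nhds
  rw [← ofReal_integral_eq_lintegral_ofReal (hpot.integrable_occ (Nat.cast_nonneg T))
    (ae_of_all _ fun w => occ_nonneg (boxDensity_nonneg hd n B) (Nat.cast_nonneg T) w)]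
  exact ENNReal.ofReal_le_ofReal (integral_occ_boxDensity_le hd hP n B (Nat.cast_nonneg T))

lemma ae_totalTime_lt_top [NeZero d] (hd : 3 ≤ d) (hP : IsDiffusionLaw (vertex x) P) (B : Finset (Fin d → ℤ)) :
    ∀ᵐ w ∂P, ∀ n, totalTime (boxDensity n B) w < ∞ := by
  refine ae_all_iff.2 fun n => ?_
  exact ae_lt_top (measurable_totalTime (hasPotential_boxDensity hd n B hP).continuous.measurable)
    (ne_top_of_le_ne_top ENNReal.ofReal_ne_top (lintegral_totalTime_le hd hP n B))

/-- Consecutive smoothings change the potential by a multiple of their radius. -/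
lemma abs_potential_sub_le [NeZero d] (hd : 3 ≤ d) (n : ℕ) (B : Finset (Fin d → ℤ)) (z : Cable d) :
    |potential (bump n) (greenPotential B) z - potential (bump (n + 1)) (greenPotential B) z| ≤
      2 * radius n := by
  have hk := isBump_bump n
  have hk' := isBump_bump (n + 1)
  have hp : ∀ x s, 0 ≤ s → |potentialProfile (bump n) (greenPotential B) x s -
      potentialProfile (bump (n + 1)) (greenPotential B) x s| ≤ radius n := by
    intro x s hs
    have e : potentialProfile (bump n) (greenPotential B) x s -
      potentialProfile (bump (n + 1)) (greenPotential B) x s =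
      negLaplace (greenPotential B) x * (tail2 (bump (n + 1)) s - tail2 (bump n) s) := by
      unfold potentialProfile; ring
    have h1 := negLaplace_greenPotential_le_one hd B x
    have h2 := negLaplace_greenPotential_nonneg hd B x
    rw [e, abs_mul, abs_of_nonneg h2]
    have h3 : |tail2 (bump (n + 1)) s - tail2 (bump n) s| ≤ radius n := by
      have a1 := hk.tail2_le_radius hs
      have a2 := (hk'.tail2_le_radius hs).trans (radius_succ_lt n).le
      have a3 := hk.tail2_nonneg s
      have a4 := hk'.tail2_nonneg s
      rw [abs_le]; constructor <;> linarith
    calc _ ≤ 1 * radius n := mul_le_mul h1 h3 (abs_nonneg _) zero_le_one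
      _ = _ := one_mul _
  obtain ⟨x, v, t, ht, rfl⟩ := exists_edgePoint z
  rw [potential, potential, radialSum_edgePoint (potentialProfile_eq_zero hk _) x v ht,
    radialSum_edgePoint (potentialProfile_eq_zero hk' _) x v ht]
  have h1 := hp x (2 * t) (by linarith [ht.1])
  have h2 := hp (x + unitVec v) (1 - 2 * t) (by linarith [ht.2])
  rw [abs_le] at *
  constructor <;> linarith [h1.1, h1.2, h2.1, h2.2]

/-- By the Cauchy-Schwarz inequality, in the form `|x| ≤ x² / (2 η) + η / 2` with `η² = radius n`,
consecutive smoothed local times differ by a summable amount in mean. -/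
lemma integral_abs_occ_sub_le [NeZero d] (hd : 3 ≤ d) (hP : IsDiffusionLaw (vertex x) P) (n : ℕ)
    (B : Finset (Fin d → ℤ)) {T : ℝ} (hT : 0 ≤ T) :
    ∫ w, |occ (boxDensity n B) T w - occ (boxDensity (n + 1) B) T w| ∂P ≤
      (8 * greenPotential B x + 1) * (1 / ((n : ℝ) + 1) ^ 2) := by
  have := hP.isProbability
  have hp1 := hasPotential_boxDensity hd n B hP
  have hp2 := hasPotential_boxDensity hd (n + 1) B hP
  have hp := hp1.sub hp2
  set φ := fun z => boxDensity n B z - boxDensity (n + 1) B z with hφ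
  have hocc : ∀ w, occ φ T w = occ (boxDensity n B) T w - occ (boxDensity (n + 1) B) T w := fun w =>
    intervalIntegral.integral_sub
      ((hp1.continuous.comp (continuous_pathAt w)).intervalIntegrable _ _)
      ((hp2.continuous.comp (continuous_pathAt w)).intervalIntegrable _ _)
  have hsq := hp.integral_sq_occ_le (D := 4 * radius n) (fun z z' => by
    have h1 := abs_le.1 (abs_potential_sub_le hd n B z)
    have h2 := abs_le.1 (abs_potential_sub_le hd n B z')
    linarith [h1.1, h1.2, h2.1, h2.2]) hT
  have habs : ∫ w, occ (fun z => |φ z|) T w ∂P ≤ 2 * greenPotential B x := by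
    have h1 := integral_occ_boxDensity_le hd hP n B hT
    have h2 := integral_occ_boxDensity_le hd hP (n + 1) B hT
    have h3 : ∫ w, occ (fun z => |φ z|) T w ∂P ≤
        ∫ w, (occ (boxDensity n B) T w + occ (boxDensity (n + 1) B) T w) ∂P := by
      refine integral_mono_of_nonneg (ae_of_all _ fun w => occ_nonneg (fun z => abs_nonneg _) hT w)
        ((hp1.integrable_occ hT).add (hp2.integrable_occ hT)) (ae_of_all _ fun w => ?_)
      have c1 : Continuous fun s => boxDensity n B (pathAt w s) :=
        hp1.continuous.comp (continuous_pathAt w)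
      have c2 : Continuous fun s => boxDensity (n + 1) B (pathAt w s) :=
        hp2.continuous.comp (continuous_pathAt w)
      have c3 : Continuous fun s => |φ (pathAt w s)| :=
        hp.continuous.abs.comp (continuous_pathAt w)
      unfold occ
      simp only
      rw [← intervalIntegral.integral_add (c1.intervalIntegrable _ _) (c2.intervalIntegrable _ _)]
      refine intervalIntegral.integral_mono_on hT (c3.intervalIntegrable _ _)
        ((c1.add c2).intervalIntegrable _ _) fun s _ => ?_
      refine (abs_sub _ _).trans (le_of_eq ?_)
      rw [abs_of_nonneg (boxDensity_nonneg hd _ _ _), abs_of_nonneg (boxDensity_nonneg hd _ _ _)]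
    rw [integral_add (hp1.integrable_occ hT) (hp2.integrable_occ hT)] at h3
    linarith
  have hr := radius_pos n
  have hsq' : ∫ w, occ φ T w ^ 2 ∂P ≤ 16 * greenPotential B x * radius n := by
    refine hsq.trans ?_
    nlinarith
  set η : ℝ := 1 / ((n : ℝ) + 1) ^ 2 with hη
  have hη0 : 0 < η := by positivity
  have hηr : radius n = η * η := by
    rw [hη, radius]; field_simp
  simp only [← hocc]
  calc ∫ w, |occ φ T w| ∂P ≤ ∫ w, ((2 * η)⁻¹ * occ φ T w ^ 2 + η / 2) ∂P := by
        refine integral_mono (hp.integrable_comp_occ hT continuous_abs)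
          (((hp.integrable_comp_occ hT (continuous_pow 2)).const_mul _).add (integrable_const _))
          fun w => ?_
        have h : (2 * η)⁻¹ * occ φ T w ^ 2 + η / 2 - |occ φ T w| =
            (2 * η)⁻¹ * (|occ φ T w| - η) ^ 2 := by
          rw [sub_sq, sq_abs]; field_simp; ring
        have : 0 ≤ (2 * η)⁻¹ * (|occ φ T w| - η) ^ 2 := by positivity
        simp only
        linarith
    _ = (2 * η)⁻¹ * ∫ w, occ φ T w ^ 2 ∂P + η / 2 := by
        rw [integral_add ((hp.integrable_comp_occ hT (continuous_pow 2)).const_mul _)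
          (integrable_const _), integral_const_mul]
        simp
    _ ≤ (2 * η)⁻¹ * (16 * greenPotential B x * (η * η)) + η / 2 := by
        rw [← hηr]; gcongr
    _ = (8 * greenPotential B x + 1 / 2) * η := by field_simp; ring
    _ ≤ _ := by gcongr; norm_num

lemma ae_cauchySeq_totalTime [NeZero d] (hd : 3 ≤ d) (hP : IsDiffusionLaw (vertex x) P)
    (B : Finset (Fin d → ℤ)) :
    ∀ᵐ w ∂P, CauchySeq fun n => (totalTime (boxDensity n B) w).toReal := by
  have := hP.isProbability
  have hpot := fun n => hasPotential_boxDensity hd n B hP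
  have hfin := ae_totalTime_lt_top hd hP B
  have hlim : ∀ᵐ w ∂P, ∀ n, Tendsto (fun T : ℕ => occ (boxDensity n B) T w) atTop
      (𝓝 (totalTime (boxDensity n B) w).toReal) := by
    filter_upwards [hfin] with w hw n
    have h := (ENNReal.tendsto_toReal (hw n).ne).comp
      (tendsto_occ (hpot n).continuous (boxDensity_nonneg hd n B) w)
    refine h.congr fun T => ?_
    exact ENNReal.toReal_ofReal (occ_nonneg (boxDensity_nonneg hd n B) (Nat.cast_nonneg T) w)
  set c : ℕ → ℝ := fun n => (8 * greenPotential B x + 1) * (1 / ((n : ℝ) + 1) ^ 2) with hc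
  have hc0 : ∀ n, 0 ≤ c n := fun n => by
    have := greenPotential_nonneg B x
    positivity
  have hdiff : ∀ n, ∫⁻ w, ENNReal.ofReal |(totalTime (boxDensity n B) w).toReal -
      (totalTime (boxDensity (n + 1) B) w).toReal| ∂P ≤ ENNReal.ofReal (c n) := by
    intro n
    refine lintegral_le_of_ae_tendsto (F := fun T : ℕ => fun w =>
      ENNReal.ofReal |occ (boxDensity n B) T w - occ (boxDensity (n + 1) B) T w|)
      (fun T => ?_) ?_ (c := fun _ => ENNReal.ofReal (c n)) (fun T => ?_) tendsto_const_nhds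
    · exact ((measurable_occ (hpot n).continuous.measurable _).sub
        (measurable_occ (hpot (n + 1)).continuous.measurable _)).abs.ennreal_ofReal
    · filter_upwards [hlim] with w hw
      exact ENNReal.tendsto_ofReal ((hw n).sub (hw (n + 1))).abs
    · rw [← ofReal_integral_eq_lintegral_ofReal
        (f := fun w => |occ (boxDensity n B) T w - occ (boxDensity (n + 1) B) T w|)
        (((hpot n).integrable_occ (Nat.cast_nonneg T)).sub
        ((hpot (n + 1)).integrable_occ (Nat.cast_nonneg T))).abs (ae_of_all _ fun w => abs_nonneg _)]
      exact ENNReal.ofReal_le_ofReal (integral_abs_occ_sub_le hd hP n B (Nat.cast_nonneg T))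
  have hmeas : ∀ n, Measurable fun w => ENNReal.ofReal |(totalTime (boxDensity n B) w).toReal -
      (totalTime (boxDensity (n + 1) B) w).toReal| := fun n =>
    ((measurable_totalTime (hpot n).continuous.measurable).ennreal_toReal.sub
      (measurable_totalTime (hpot (n + 1)).continuous.measurable).ennreal_toReal).abs.ennreal_ofReal
  have hsum : ∫⁻ w, ∑' n, ENNReal.ofReal |(totalTime (boxDensity n B) w).toReal -
      (totalTime (boxDensity (n + 1) B) w).toReal| ∂P ≠ ∞ := by
    rw [lintegral_tsum fun n => (hmeas n).aemeasurable]
    refine ne_top_of_le_ne_top ?_ (ENNReal.tsum_le_tsum hdiff)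
    have hs : Summable c := by
      have h := (summable_nat_add_iff 1).2 (Real.summable_one_div_nat_pow.2 (one_lt_two))
      refine (h.mul_left (8 * greenPotential B x + 1)).congr fun n => ?_
      simp [hc]
    rw [← ENNReal.ofReal_tsum_of_nonneg hc0 hs]
    exact ENNReal.ofReal_ne_top
  filter_upwards [ae_lt_top (Measurable.tsum hmeas) hsum] with w hw
  refine cauchySeq_of_edist_le_of_tsum_ne_top _ (fun n => ?_) hw.ne
  rw [edist_dist, Real.dist_eq]

/-- The sum over `y ∈ B` of the local times of a forward path at `y`, as the `limsup` of smoothed local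
times. By `ae_tendsto_totalTime` it is almost surely a limit. -/
def forwardLocalTime (B : Finset (Fin d → ℤ)) (w : ForwardPath d) : ℝ≥0∞ :=
  ∑ y ∈ B, limsup (fun n => bumpTime n y (Ioi 0) (pathAt w)) atTop

lemma totalTime_singleton (hd : 3 ≤ d) (n : ℕ) (y : Fin d → ℤ) (w : ForwardPath d) :
    totalTime (boxDensity n {y}) w = bumpTime n y (Ioi 0) (pathAt w) := by
  rw [totalTime_boxDensity hd, Finset.sum_singleton]

lemma ae_tendsto_totalTime [NeZero d] (hd : 3 ≤ d) (hP : IsDiffusionLaw (vertex x) P)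
    (B : Finset (Fin d → ℤ)) :
    ∀ᵐ w ∂P, (∀ n, totalTime (boxDensity n B) w < ∞) ∧ forwardLocalTime B w < ∞ ∧
      Tendsto (fun n => totalTime (boxDensity n B) w) atTop (𝓝 (forwardLocalTime B w)) := by
  have h1 : ∀ᵐ w ∂P, ∀ y ∈ B, CauchySeq fun n => (totalTime (boxDensity n {y}) w).toReal :=
    (Finset.eventually_all B).2 fun y _ => ae_cauchySeq_totalTime hd hP {y}
  have h2 : ∀ᵐ w ∂P, ∀ y ∈ B, ∀ n, totalTime (boxDensity n {y}) w < ∞ :=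
    (Finset.eventually_all B).2 fun y _ => ae_totalTime_lt_top hd hP {y}
  filter_upwards [h1, h2, ae_totalTime_lt_top hd hP B] with w hc hf hB
  have hlim : ∀ y ∈ B, limsup (fun n => bumpTime n y (Ioi 0) (pathAt w)) atTop < ∞ ∧
      Tendsto (fun n => bumpTime n y (Ioi 0) (pathAt w)) atTop
        (𝓝 (limsup (fun n => bumpTime n y (Ioi 0) (pathAt w)) atTop)) := by
    intro y hy
    obtain ⟨l, hl⟩ := cauchySeq_tendsto_of_complete (hc y hy)
    have h3 : Tendsto (fun n => bumpTime n y (Ioi 0) (pathAt w)) atTop (𝓝 (ENNReal.ofReal l)) := by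
      refine (ENNReal.tendsto_ofReal hl).congr fun n => ?_
      rw [ENNReal.ofReal_toReal (hf y hy n).ne, totalTime_singleton hd]
    rw [h3.limsup_eq]
    exact ⟨ENNReal.ofReal_lt_top, h3⟩
  refine ⟨hB, ENNReal.sum_lt_top.2 fun y hy => (hlim y hy).1, ?_⟩
  simp only [totalTime_boxDensity hd]
  exact tendsto_finsetSum _ fun y hy => (hlim y hy).2

/-- A bound on `E exp (θ ∫₀ᵀ φ_n)` passes to the local time, first as `T → ∞` and then as the
smoothing is removed. -/
lemma lintegral_exp_le_of_occ [NeZero d] (hd : 3 ≤ d) (hP : IsDiffusionLaw (vertex x) P)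
    (B : Finset (Fin d → ℤ)) (θ : ℝ) {c : ℕ → ℕ → ℝ} {c' : ℕ → ℝ} {C : ℝ}
    (h : ∀ n T : ℕ, ∫ w, Real.exp (θ * occ (boxDensity n B) T w) ∂P ≤ c n T)
    (hc : ∀ n, Tendsto (c n) atTop (𝓝 (c' n))) (hc' : Tendsto c' atTop (𝓝 C)) :
    ∫⁻ w, ENNReal.ofReal (Real.exp (θ * (forwardLocalTime B w).toReal)) ∂P ≤ ENNReal.ofReal C := by
  have := hP.isProbability
  have hpot := fun n => hasPotential_boxDensity hd n B hP
  have hlim := ae_tendsto_totalTime hd hP B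
  have hm := fun n => (measurable_totalTime (hpot n).continuous.measurable).ennreal_toReal
  refine lintegral_le_of_ae_tendsto (F := fun n w => ENNReal.ofReal (Real.exp
    (θ * (totalTime (boxDensity n B) w).toReal))) (fun n => ?_) ?_
    (c := fun n => ENNReal.ofReal (c' n)) (fun n => ?_) (ENNReal.tendsto_ofReal hc')
  · exact (((hm n).const_mul θ).exp).ennreal_ofReal
  · filter_upwards [hlim] with w hw
    exact ENNReal.tendsto_ofReal ((Real.continuous_exp.tendsto _).comp
      (((ENNReal.tendsto_toReal hw.2.1.ne).comp hw.2.2).const_mul θ))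
  · refine lintegral_le_of_ae_tendsto (F := fun (T : ℕ) w => ENNReal.ofReal (Real.exp
      (θ * occ (boxDensity n B) T w))) (fun T => ?_) ?_
      (c := fun T => ENNReal.ofReal (c n T)) (fun T => ?_) (ENNReal.tendsto_ofReal (hc n))
    · exact (((measurable_occ (hpot n).continuous.measurable _).const_mul θ).exp).ennreal_ofReal
    · filter_upwards [hlim] with w hw
      have h := (ENNReal.tendsto_toReal (hw.1 n).ne).comp
        (tendsto_occ (hpot n).continuous (boxDensity_nonneg hd n B) w)
      have h' := h.congr fun T => ENNReal.toReal_ofReal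
        (occ_nonneg (boxDensity_nonneg hd n B) (Nat.cast_nonneg T) w)
      exact ENNReal.tendsto_ofReal ((Real.continuous_exp.tendsto _).comp (h'.const_mul θ))
    · rw [← ofReal_integral_eq_lintegral_ofReal ((hpot n).integrable_comp_occ (Nat.cast_nonneg T)
        (ψ := fun x => Real.exp (θ * x)) (by fun_prop)) (ae_of_all _ fun w => (Real.exp_pos _).le)]
      exact ENNReal.ofReal_le_ofReal (h n T)

lemma lintegral_exp_forwardLocalTime_le [NeZero d] (hd : 3 ≤ d) (hP : IsDiffusionLaw (vertex x) P)
    {B : Finset (Fin d → ℤ)} {A : ℝ} (hA : ∀ x, greenPotential B x ≤ A) {θ : ℝ} (hθ : 0 ≤ θ)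
    (hθA : θ * A < 1) :
    ∫⁻ w, ENNReal.ofReal (Real.exp (θ * (forwardLocalTime B w).toReal)) ∂P ≤
      ENNReal.ofReal (1 + θ / (1 - θ * A) * greenPotential B x) := by
  have := hP.isProbability
  refine lintegral_exp_le_of_occ hd hP B θ
    (c := fun _ _ => 1 + θ / (1 - θ * A) * greenPotential B x) (fun n T => ?_)
    (fun _ => tendsto_const_nhds) tendsto_const_nhds
  refine ((hasPotential_boxDensity hd n B hP).integral_exp_occ_le (boxDensity_nonneg hd n B)
    (potential_green_nonneg hd (isBump_bump n) B) (potential_green_le hd (isBump_bump n) B hA)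
    hθ hθA hP.start (Nat.cast_nonneg T)).trans ?_
  have h1 := potential_green_vertex_le hd (isBump_bump n) B x
  have h2 : 0 ≤ θ / (1 - θ * A) := div_nonneg hθ (by linarith)
  gcongr

lemma lintegral_exp_neg_forwardLocalTime_le [NeZero d] (hd : 3 ≤ d) (hP : IsDiffusionLaw (vertex x) P)
    (htrans : ∀ᵐ w ∂P, Tendsto (pathAt w) atTop (cocompact (Cable d)))
    {B : Finset (Fin d → ℤ)} {A : ℝ} (hA : ∀ x, greenPotential B x ≤ A) {θ : ℝ} (hθ : 0 ≤ θ)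
    (hθA : θ * A ≤ 1) :
    ∫⁻ w, ENNReal.ofReal (Real.exp (-θ * (forwardLocalTime B w).toReal)) ∂P ≤
      ENNReal.ofReal (1 - θ * (1 - θ * A) * greenPotential B x) := by
  have := hP.isProbability
  have hA0 : 0 ≤ A := (greenPotential_nonneg B x).trans (hA x)
  have hpot := fun n => hasPotential_boxDensity hd n B hP
  have hocc : ∀ n, Tendsto (fun T : ℕ => ∫ w, occ (boxDensity n B) T w ∂P) atTop
      (𝓝 (potential (bump n) (greenPotential B) (vertex x))) := by
    intro n
    simp only [(hpot n).integral_occ hP.start (Nat.cast_nonneg _)]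
    have h0 : Tendsto (fun T : ℕ => ∫ w, potential (bump n) (greenPotential B) (pathAt w T) ∂P)
        atTop (𝓝 (∫ _w, (0 : ℝ) ∂P)) := by
      refine tendsto_integral_of_dominated_convergence (fun _ => A)
        (fun T => ((hpot n).measurable.comp (measurable_pathAt _)).aestronglyMeasurable)
        (integrable_const _) (fun T => ae_of_all _ fun w => ?_) ?_
      · rw [Real.norm_eq_abs, abs_of_nonneg (potential_green_nonneg hd (isBump_bump n) B _)]
        exact potential_green_le hd (isBump_bump n) B hA _
      · filter_upwards [htrans] with w hw
        exact (tendsto_potential_green hd (isBump_bump n) B).comp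
          (hw.comp tendsto_natCast_atTop_atTop)
    rw [integral_zero] at h0
    simpa using h0.const_sub (potential (bump n) (greenPotential B) (vertex x))
  have hcoef : 0 ≤ θ * (1 - θ * A) := mul_nonneg hθ (by linarith)
  refine lintegral_exp_le_of_occ hd hP B (-θ)
    (c := fun n T => 1 - θ * (1 - θ * A) * ∫ w, occ (boxDensity n B) T w ∂P)
    (c' := fun n => 1 - θ * (1 - θ * A) * potential (bump n) (greenPotential B) (vertex x))
    (fun n T => ?_) (fun n => ((hocc n).const_mul _).const_sub _) ?_
  · exact (hpot n).integral_exp_neg_occ_le (boxDensity_nonneg hd n B)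
      (potential_green_nonneg hd (isBump_bump n) B) (potential_green_le hd (isBump_bump n) B hA)
      hθ (Nat.cast_nonneg T)
  · refine ((Tendsto.const_mul _ ?_).const_sub _)
    refine tendsto_of_tendsto_of_tendsto_of_le_of_le
      (g := fun n => greenPotential B x - radius n) ?_ tendsto_const_nhds
      (fun n => le_potential_green_vertex hd (isBump_bump n) B x)
      (fun n => potential_green_vertex_le hd (isBump_bump n) B x)
    simpa using tendsto_radius.const_sub (greenPotential B x)

end law

/-! ### Tail bounds for Poisson point processes -/

section

lemma integrable_exp_poissonMeasure (r : ℝ≥0) (t : ℝ) :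
    Integrable (fun n : ℕ => Real.exp (t * n)) (poissonMeasure r) := by
  rw [integrable_poissonMeasure_iff]
  have h := (Real.summable_pow_div_factorial ((r : ℝ) * Real.exp t)).mul_left (Real.exp (-r))
  refine h.congr fun n => ?_
  rw [Real.norm_of_nonneg (Real.exp_pos _).le, mul_comm t, Real.exp_nat_mul, mul_pow]
  ring

lemma integral_exp_poissonMeasure (r : ℝ≥0) (t : ℝ) :
    ∫ n : ℕ, Real.exp (t * n) ∂(poissonMeasure r) = Real.exp (r * (Real.exp t - 1)) := by
  rw [integral_poissonMeasure]
  have h : ∀ n : ℕ, (Real.exp (-r) * (r : ℝ) ^ n / n.factorial) • Real.exp (t * n) =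
      Real.exp (-r) * (((r : ℝ) * Real.exp t) ^ n / n.factorial) := fun n => by
    rw [smul_eq_mul, mul_comm t, Real.exp_nat_mul, mul_pow]; ring
  simp only [h]
  have e : Real.exp (r * Real.exp t) = ∑' n : ℕ, ((r : ℝ) * Real.exp t) ^ n / n.factorial := by
    rw [Real.exp_eq_exp_ℝ, NormedSpace.exp_eq_tsum_div]
  rw [tsum_mul_left, ← e, ← Real.exp_add]
  congr 1; ring

variable {Ω S : Type*} [MeasurableSpace Ω] [MeasurableSpace S] {μ : Measure Ω} {N : Ω → Measure S}
  {Λ : Measure S}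

namespace IsPoissonPointProcess

lemma measurable_apply (h : IsPoissonPointProcess μ N Λ) {A : Set S} (hA : MeasurableSet A) :
    Measurable fun ω => N ω A := (Measure.measurable_coe hA).comp h.measurable

/-- The exponential moments of the number of points in `A`. -/
lemma integral_exp_apply (h : IsPoissonPointProcess μ N Λ) {A : Set S} (hA : MeasurableSet A) (hΛ : Λ A ≠ ∞)
    (t : ℝ) : Integrable (fun ω => Real.exp (t * (N ω A).toReal)) μ ∧
      ∫ ω, Real.exp (t * (N ω A).toReal) ∂μ = Real.exp ((Λ A).toReal * (Real.exp t - 1)) := by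
  have hm : Measurable fun x : ℝ≥0∞ => Real.exp (t * x.toReal) :=
    (ENNReal.measurable_toReal.const_mul t).exp
  have hN := h.measurable_apply hA
  have hp := h.poisson A hA hΛ
  have hcast : Measurable fun n : ℕ => (n : ℝ≥0∞) := measurable_of_countable _
  constructor
  · have h1 : Integrable (fun x : ℝ≥0∞ => Real.exp (t * x.toReal)) (μ.map fun ω => N ω A) := by
      rw [hp, integrable_map_measure hm.aestronglyMeasurable hcast.aemeasurable]
      simpa [Function.comp_def] using integrable_exp_poissonMeasure (Λ A).toNNReal t
    exact (integrable_map_measure hm.aestronglyMeasurable hN.aemeasurable).1 h1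
  · have h1 : ∫ x, Real.exp (t * x.toReal) ∂(μ.map fun ω => N ω A) =
        ∫ ω, Real.exp (t * (N ω A).toReal) ∂μ :=
      integral_map hN.aemeasurable hm.aestronglyMeasurable
    rw [← h1, hp, integral_map hcast.aemeasurable hm.aestronglyMeasurable]
    simp only [ENNReal.toReal_natCast]
    exact integral_exp_poissonMeasure (Λ A).toNNReal t

lemma ae_apply_lt_top (h : IsPoissonPointProcess μ N Λ) {A : Set S} (hA : MeasurableSet A)
    (hΛ : Λ A ≠ ∞) : ∀ᵐ ω ∂μ, N ω A < ∞ := by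
  have hN := h.measurable_apply hA
  have hcast : Measurable fun n : ℕ => (n : ℝ≥0∞) := measurable_of_countable _
  have h1 : ∀ᵐ x ∂(μ.map fun ω => N ω A), x < ∞ := by
    rw [h.poisson A hA hΛ, ae_map_iff hcast.aemeasurable measurableSet_Iio]
    exact ae_of_all _ fun n => ENNReal.natCast_lt_top n
  exact ae_of_ae_map hN.aemeasurable h1

variable [IsProbabilityMeasure μ]

/-- The integral of a finite simple function against a Poisson point process is a finite
combination `X` of independent Poisson variables, with an explicit moment generating function. -/
lemma exists_simpleFunc_mgf (h : IsPoissonPointProcess μ N Λ) (f : SimpleFunc S ℝ≥0∞)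
    (hf : ∀ p, f p ≠ ∞) (hΛ : Λ {p | f p ≠ 0} ≠ ∞) :
    ∃ X : Ω → ℝ, (∀ᵐ ω ∂μ, ∫⁻ p, f p ∂(N ω) = ENNReal.ofReal (X ω) ∧ 0 ≤ X ω) ∧
      ∀ θ : ℝ, Integrable (fun ω => Real.exp (θ * X ω)) μ ∧
        mgf X μ θ = Real.exp (∑ a ∈ f.range.erase 0,
          (Λ (f ⁻¹' {a})).toReal * (Real.exp (θ * a.toReal) - 1)) := by
  classical
  set s := f.range.erase 0 with hs
  set e := s.equivFin with he
  set a : Fin s.card → ℝ≥0∞ := fun i => (e.symm i).1 with ha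
  have ha_mem : ∀ i, a i ∈ s := fun i => (e.symm i).2
  have ha_ne : ∀ i, a i ≠ 0 := fun i => Finset.ne_of_mem_erase (ha_mem i)
  have ha_top : ∀ i, a i ≠ ∞ := fun i => by
    obtain ⟨p, hp⟩ := SimpleFunc.mem_range.1 (Finset.mem_of_mem_erase (ha_mem i))
    rw [← hp]; exact hf p
  have ha_inj : Function.Injective a := fun i j hij =>
    e.symm.injective (Subtype.ext hij)
  set A : Fin s.card → Set S := fun i => f ⁻¹' {a i} with hA
  have hAm : ∀ i, MeasurableSet (A i) := fun i => f.measurableSet_preimage _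
  have hAΛ : ∀ i, Λ (A i) ≠ ∞ := fun i => ne_top_of_le_ne_top hΛ (measure_mono fun p hp => by
    have : f p = a i := hp
    change f p ≠ 0
    rw [this]; exact ha_ne i)
  have hdisj : Pairwise fun i j => Disjoint (A i) (A j) := fun i j hij =>
    Disjoint.preimage _ (by simpa using fun h => hij (ha_inj h))
  have hind := (h.independent s.card A hAm hdisj).comp (fun i x => (a i).toReal * x.toReal)
    fun i => ENNReal.measurable_toReal.const_mul _
  set Y : Fin s.card → Ω → ℝ := fun i ω => (a i).toReal * (N ω (A i)).toReal with hY
  have hYm : ∀ i, Measurable (Y i) := fun i =>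
    ((h.measurable_apply (hAm i)).ennreal_toReal).const_mul _
  have hsum : ∀ (g : ℝ≥0∞ → ℝ), ∑ i, g (a i) = ∑ b ∈ s, g b := fun g => by
    rw [← Finset.sum_coe_sort s g]
    exact Equiv.sum_comp e.symm fun b : s => g b.1
  have hsum' : ∀ (g : ℝ≥0∞ → ℝ≥0∞), ∑ i, g (a i) = ∑ b ∈ s, g b := fun g => by
    rw [← Finset.sum_coe_sort s g]
    exact Equiv.sum_comp e.symm fun b : s => g b.1
  have hexp : ∀ θ i, Integrable (fun ω => Real.exp (θ * Y i ω)) μ ∧ mgf (Y i) μ θ =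
      Real.exp ((Λ (A i)).toReal * (Real.exp (θ * (a i).toReal) - 1)) := by
    intro θ i
    have := h.integral_exp_apply (hAm i) (hAΛ i) (θ * (a i).toReal)
    simpa only [hY, mgf, mul_assoc] using this
  refine ⟨fun ω => ∑ i, Y i ω, ?_, fun θ => ⟨?_, ?_⟩⟩
  · have hfin : ∀ᵐ ω ∂μ, ∀ i, N ω (A i) < ∞ :=
      ae_all_iff.2 fun i => h.ae_apply_lt_top (hAm i) (hAΛ i)
    filter_upwards [hfin] with ω hω
    have hY0 : ∀ i, 0 ≤ Y i ω := fun i => mul_nonneg ENNReal.toReal_nonneg ENNReal.toReal_nonneg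
    refine ⟨?_, Finset.sum_nonneg fun i _ => hY0 i⟩
    rw [SimpleFunc.lintegral_eq_lintegral, SimpleFunc.lintegral_eq_of_subset' f (s := s)
      (by rw [hs, Finset.erase_eq]), ← hsum' fun b => b * N ω (f ⁻¹' {b}),
      ENNReal.ofReal_sum_of_nonneg fun i _ => hY0 i]
    refine Finset.sum_congr rfl fun i _ => ?_
    rw [hY]
    simp only
    rw [ENNReal.ofReal_mul ENNReal.toReal_nonneg, ENNReal.ofReal_toReal (ha_top i),
      ENNReal.ofReal_toReal (hω i).ne]
  · have := hind.integrable_exp_mul_sum hYm (t := θ) (s := Finset.univ) fun i _ => (hexp θ i).1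
    simpa using this
  · have := iIndepFun.mgf_sum hind hYm (t := θ) Finset.univ
    have e1 : (∑ i, Y i) = fun ω => ∑ i, Y i ω := by ext ω; simp
    have e2 : mgf (fun ω => ∑ i, Y i ω) μ θ = ∏ i, mgf (Y i) μ θ := by
      rw [← e1]; exact this
    rw [e2]
    simp only [(hexp θ _).2]
    rw [← Real.exp_sum, ← hsum fun b => (Λ (f ⁻¹' {b})).toReal * (Real.exp (θ * b.toReal) - 1)]

end IsPoissonPointProcess

lemma sum_range_erase_eq_lintegral {S : Type*} [MeasurableSpace S] {Λ : Measure S}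
    (f : SimpleFunc S ℝ≥0∞) (hΛ : Λ {p | f p ≠ 0} ≠ ∞) {g : ℝ≥0∞ → ℝ}
    (hg0 : g 0 = 0) (hg : ∀ a, 0 ≤ g a) :
    ENNReal.ofReal (∑ a ∈ f.range.erase 0, (Λ (f ⁻¹' {a})).toReal * g a) =
      ∫⁻ p, ENNReal.ofReal (g (f p)) ∂Λ := by
  classical
  have h1 : ∫⁻ p, ENNReal.ofReal (g (f p)) ∂Λ =
      (f.map fun a => ENNReal.ofReal (g a)).lintegral Λ :=
    SimpleFunc.lintegral_eq_lintegral (f.map fun a => ENNReal.ofReal (g a)) Λ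
  rw [h1, SimpleFunc.map_lintegral, ENNReal.ofReal_sum_of_nonneg fun a _ =>
    mul_nonneg ENNReal.toReal_nonneg (hg a)]
  have h2 : ∑ a ∈ f.range, ENNReal.ofReal (g a) * Λ (f ⁻¹' {a}) =
      ∑ a ∈ f.range.erase 0, ENNReal.ofReal (g a) * Λ (f ⁻¹' {a}) := by
    symm
    refine Finset.sum_subset (Finset.erase_subset _ _) fun a ha ha' => ?_
    have : a = 0 := by by_contra h; exact ha' (Finset.mem_erase.2 ⟨h, ha⟩)
    rw [this, hg0]; simp
  rw [h2]
  refine Finset.sum_congr rfl fun a ha => ?_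
  have ha0 := Finset.ne_of_mem_erase ha
  have : Λ (f ⁻¹' {a}) ≠ ∞ := ne_top_of_le_ne_top hΛ (measure_mono fun p hp => by
    have : f p = a := hp
    change f p ≠ 0
    rw [this]; exact ha0)
  rw [ENNReal.ofReal_mul ENNReal.toReal_nonneg, ENNReal.ofReal_toReal this, mul_comm]

lemma eapprox_ne_zero_subset {H : S → ℝ≥0∞} (hH : Measurable H) (n : ℕ) :
    {p | SimpleFunc.eapprox H n p ≠ 0} ⊆ {p | H p ≠ 0} := fun p hp h => hp (by
  have := (le_iSup (fun n => SimpleFunc.eapprox H n p) n).trans_eq (SimpleFunc.iSup_eapprox_apply hH p)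
  rw [h] at this
  exact le_antisymm this bot_le)

lemma eapprox_le {H : S → ℝ≥0∞} (hH : Measurable H) (n : ℕ) (p : S) :
    SimpleFunc.eapprox H n p ≤ H p :=
  (le_iSup (fun n => SimpleFunc.eapprox H n p) n).trans_eq (SimpleFunc.iSup_eapprox_apply hH p)

namespace IsPoissonPointProcess
variable [IsProbabilityMeasure μ]

/-- Chernoff bound for the upper tail of an integral against a Poisson point process, by monotone
approximation of the integrand with simple functions. -/
lemma measure_lt_lintegral_le (h : IsPoissonPointProcess μ N Λ) {H : S → ℝ≥0∞} (hH : Measurable H)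
    (hΛ : Λ {p | H p ≠ 0} ≠ ∞) (hfin : ∀ᵐ p ∂Λ, H p < ∞) {θ I t : ℝ} (hθ : 0 ≤ θ) (hI0 : 0 ≤ I)
    (hI : ∫⁻ p, ENNReal.ofReal (Real.exp (θ * (H p).toReal) - 1) ∂Λ ≤ ENNReal.ofReal I) :
    μ {ω | ENNReal.ofReal t < ∫⁻ p, H p ∂(N ω)} ≤ ENNReal.ofReal (Real.exp (-θ * t + I)) := by
  have hset : {ω | ENNReal.ofReal t < ∫⁻ p, H p ∂(N ω)} =
      ⋃ n, {ω | ENNReal.ofReal t < ∫⁻ p, SimpleFunc.eapprox H n p ∂(N ω)} := by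
    ext ω
    simp only [mem_ofPred_eq, mem_iUnion]
    rw [lintegral_eq_iSup_eapprox_lintegral hH, lt_iSup_iff]
    simp only [SimpleFunc.lintegral_eq_lintegral]
  have hmono : Monotone fun n => {ω | ENNReal.ofReal t < ∫⁻ p, SimpleFunc.eapprox H n p ∂(N ω)} :=
    fun m n hmn ω hω => lt_of_lt_of_le hω
      (lintegral_mono fun p => SimpleFunc.monotone_eapprox H hmn p)
  rw [hset, hmono.measure_iUnion]
  refine iSup_le fun n => ?_
  set f := SimpleFunc.eapprox H n with hf
  have hfΛ : Λ {p | f p ≠ 0} ≠ ∞ :=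
    ne_top_of_le_ne_top hΛ (measure_mono (eapprox_ne_zero_subset hH n))
  obtain ⟨X, hX, hmgf⟩ := h.exists_simpleFunc_mgf f (fun p => (SimpleFunc.eapprox_lt_top H n p).ne) hfΛ
  have hsum : ∑ a ∈ f.range.erase 0, (Λ (f ⁻¹' {a})).toReal * (Real.exp (θ * a.toReal) - 1) ≤ I := by
    rw [← ENNReal.ofReal_le_ofReal_iff hI0, sum_range_erase_eq_lintegral f hfΛ
      (g := fun a => Real.exp (θ * a.toReal) - 1) (by simp) (fun a => by
        have := Real.one_le_exp (mul_nonneg hθ (ENNReal.toReal_nonneg (a := a)))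
        linarith)]
    refine le_trans (lintegral_mono_ae ?_) hI
    filter_upwards [hfin] with p hp
    have := ENNReal.toReal_mono hp.ne (eapprox_le hH n p)
    gcongr
  calc μ {ω | ENNReal.ofReal t < ∫⁻ p, f p ∂(N ω)} ≤ μ {ω | t ≤ X ω} := by
        refine measure_mono_ae ?_
        filter_upwards [hX] with ω hω hlt
        have hlt' : ENNReal.ofReal t < ∫⁻ p, f p ∂(N ω) := hlt
        rw [hω.1] at hlt'
        exact (ENNReal.ofReal_le_ofReal_iff hω.2).1 hlt'.le
    _ = ENNReal.ofReal (μ.real {ω | t ≤ X ω}) := (ofReal_measureReal).symm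
    _ ≤ ENNReal.ofReal (Real.exp (-θ * t) * mgf X μ θ) :=
        ENNReal.ofReal_le_ofReal (measure_ge_le_exp_mul_mgf t hθ (hmgf θ).1)
    _ ≤ _ := by
        rw [(hmgf θ).2, ← Real.exp_add]
        gcongr

/-- Chernoff bound for the lower tail. The integrand is replaced by a smaller simple function, so the
bound `J` has to be strict. -/
lemma measure_lintegral_lt_le (h : IsPoissonPointProcess μ N Λ) {H : S → ℝ≥0∞} (hH : Measurable H)
    (hΛ : Λ {p | H p ≠ 0} ≠ ∞) (hfin : ∀ᵐ p ∂Λ, H p < ∞) {θ J t : ℝ} (hθ : 0 ≤ θ)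
    (hJ : ENNReal.ofReal J < ∫⁻ p, ENNReal.ofReal (1 - Real.exp (-θ * (H p).toReal)) ∂Λ) :
    μ {ω | ∫⁻ p, H p ∂(N ω) < ENNReal.ofReal t} ≤ ENNReal.ofReal (Real.exp (θ * t - J)) := by
  have hmono : ∀ {a b : ℝ}, a ≤ b → 1 - Real.exp (-θ * a) ≤ 1 - Real.exp (-θ * b) := by
    intro a b hab
    have : Real.exp (-θ * b) ≤ Real.exp (-θ * a) := Real.exp_le_exp.2 (by nlinarith)
    linarith
  have hlim : Tendsto (fun n => ∫⁻ p, ENNReal.ofReal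
      (1 - Real.exp (-θ * (SimpleFunc.eapprox H n p).toReal)) ∂Λ) atTop
      (𝓝 (∫⁻ p, ENNReal.ofReal (1 - Real.exp (-θ * (H p).toReal)) ∂Λ)) := by
    refine lintegral_tendsto_of_tendsto_of_monotone (fun n => ?_) ?_ ?_
    · exact (((((SimpleFunc.eapprox H n).measurable.ennreal_toReal).const_mul
        (-θ)).exp.const_sub 1).ennreal_ofReal).aemeasurable
    · refine ae_of_all _ fun p m n hmn => ENNReal.ofReal_le_ofReal (hmono ?_)
      exact ENNReal.toReal_mono (SimpleFunc.eapprox_lt_top H n p).ne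
        (SimpleFunc.monotone_eapprox H hmn p)
    · filter_upwards [hfin] with p hp
      refine ENNReal.tendsto_ofReal (((Real.continuous_exp.tendsto _).comp
        (Tendsto.const_mul (-θ) ?_)).const_sub 1)
      exact (ENNReal.tendsto_toReal hp.ne).comp (SimpleFunc.tendsto_eapprox hH p)
  obtain ⟨n, hn⟩ := (hlim.eventually_const_lt hJ).exists
  set f := SimpleFunc.eapprox H n with hf
  have hfΛ : Λ {p | f p ≠ 0} ≠ ∞ :=
    ne_top_of_le_ne_top hΛ (measure_mono (eapprox_ne_zero_subset hH n))
  obtain ⟨X, hX, hmgf⟩ := h.exists_simpleFunc_mgf f (fun p => (SimpleFunc.eapprox_lt_top H n p).ne) hfΛ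
  have hsum : J ≤ ∑ a ∈ f.range.erase 0, (Λ (f ⁻¹' {a})).toReal * (1 - Real.exp (-θ * a.toReal)) := by
    rw [← sum_range_erase_eq_lintegral f hfΛ (g := fun a => 1 - Real.exp (-θ * a.toReal)) (by simp)
      (fun a => by simpa using hmono (ENNReal.toReal_nonneg (a := a)))] at hn
    exact (ENNReal.ofReal_lt_ofReal_iff'.1 hn).1.le
  have hneg : ∑ a ∈ f.range.erase 0, (Λ (f ⁻¹' {a})).toReal * (Real.exp (-θ * a.toReal) - 1) =
      -∑ a ∈ f.range.erase 0, (Λ (f ⁻¹' {a})).toReal * (1 - Real.exp (-θ * a.toReal)) := by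
    rw [← Finset.sum_neg_distrib]
    exact Finset.sum_congr rfl fun a _ => by ring
  calc μ {ω | ∫⁻ p, H p ∂(N ω) < ENNReal.ofReal t} ≤ μ {ω | X ω ≤ t} := by
        refine measure_mono_ae ?_
        filter_upwards [hX] with ω hω hlt
        have hlt' : ∫⁻ p, H p ∂(N ω) < ENNReal.ofReal t := hlt
        have hle : ∫⁻ p, f p ∂(N ω) < ENNReal.ofReal t :=
          (lintegral_mono fun p => eapprox_le hH n p).trans_lt hlt'
        rw [hω.1] at hle
        exact (ENNReal.ofReal_lt_ofReal_iff'.1 hle).1.le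
    _ = ENNReal.ofReal (μ.real {ω | X ω ≤ t}) := (ofReal_measureReal).symm
    _ ≤ ENNReal.ofReal (Real.exp (-(-θ) * t) * mgf X μ (-θ)) :=
        ENNReal.ofReal_le_ofReal (measure_le_le_exp_mul_mgf t (by linarith) (hmgf (-θ)).1)
    _ ≤ _ := by
        rw [(hmgf (-θ)).2, ← Real.exp_add, hneg, neg_neg]
        gcongr
        linarith

end IsPoissonPointProcess

end

/-! ### Local times of trajectories and of their forward parts -/

lemma measurable_uncurry_trajectory :
    Measurable (Function.uncurry fun (t : ℝ) (w : Trajectory d) => w.1 t) :=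
  measurable_uncurry_of_continuous_of_measurable (u := fun t (w : Trajectory d) => w.1 t)
    (fun w => w.2.1) fun t => (measurable_pi_apply t).comp measurable_subtype_coe

lemma measurable_trajectoryLocalTime [NeZero d] (y : Fin d → ℤ) :
    Measurable (trajectoryLocalTime (vertex y)) := by
  refine measurable_from_quotient.2 ?_
  have h : (trajectoryLocalTime (vertex y) ∘ Quotient.mk (timeShift d)) =
      fun w => limsup (fun n => bumpTime n y univ w.1) atTop := by
    ext w
    exact pathLocalTime_vertex y w.2.1
  refine h ▸ Measurable.limsup fun n => ?_
  have hm : Measurable fun p : ℝ × Trajectory d =>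
      ENNReal.ofReal ((d : ℝ)⁻¹ * bump n (dist (p.2.1 p.1) (vertex y))) :=
    (((isBump_bump n).continuous.measurable.comp
      (measurable_uncurry_trajectory.dist measurable_const)).const_mul _).ennreal_ofReal
  exact hm.lintegral_prod_left'

lemma measurable_forwardLocalTime (B : Finset (Fin d → ℤ)) : Measurable (forwardLocalTime B) := by
  refine Finset.measurable_fun_sum _ fun y _ => Measurable.limsup fun n => ?_
  have hm : Measurable fun p : ℝ × ForwardPath d =>
      ENNReal.ofReal ((d : ℝ)⁻¹ * bump n (dist (pathAt p.2 p.1) (vertex y))) :=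
    (((isBump_bump n).continuous.measurable.comp
      (measurable_uncurry_pathAt.dist measurable_const)).const_mul _).ennreal_ofReal
  exact hm.lintegral_prod_left'

/-! ### Trajectories hitting a box -/

lemma isCompact_cableBox (N₁ N₂ : ℤ) : IsCompact (cableBox d N₁ N₂) := by
  have h : cableBox d N₁ N₂ = Subtype.val ⁻¹' (Icc (fun _ => (N₁ : ℝ)) fun _ => (N₂ : ℝ)) := by
    ext z
    exact ⟨fun h => ⟨fun j => (h j).1, fun j => (h j).2⟩, fun h j => ⟨h.1 j, h.2 j⟩⟩
  rw [h]
  exact isClosed_cable.isClosedEmbedding_subtypeVal.isCompact_preimage isCompact_Icc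

/-- A vertex `y` at distance at least `1` from the complement of the box is not seen from outside. -/
lemma bump_dist_eq_zero {N₁ N₂ : ℤ} {y : Fin d → ℤ} (hy : ∀ j, N₁ + 1 ≤ y j ∧ y j + 1 ≤ N₂)
    {z : Cable d} (hz : z ∉ cableBox d N₁ N₂) (n : ℕ) : bump n (dist z (vertex y)) = 0 := by
  refine (isBump_bump n).eq_zero _ ((radius_le_one n).trans ?_)
  simp only [cableBox, mem_ofPred_eq, not_forall, not_and_or, not_le] at hz
  obtain ⟨j, hj⟩ := hz
  have h1 : |z.1 j - (y j : ℝ)| ≤ dist z (vertex y) := by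
    rw [← Real.dist_eq]; exact dist_le_pi_dist z.1 (vertex y).1 j
  refine le_trans ?_ h1
  have h2 : (N₁ : ℝ) + 1 ≤ y j := by exact_mod_cast (hy j).1
  have h3 : (y j : ℝ) + 1 ≤ N₂ := by exact_mod_cast (hy j).2
  rcases hj with hj | hj
  · exact le_abs.2 (Or.inr (by linarith))
  · exact le_abs.2 (Or.inl (by linarith))

lemma bumpTime_eq_zero {N₁ N₂ : ℤ} {y : Fin d → ℤ} (hy : ∀ j, N₁ + 1 ≤ y j ∧ y j + 1 ≤ N₂)
    {X : ℝ → Cable d} (hX : ∀ t, X t ∉ cableBox d N₁ N₂) (n : ℕ) (S : Set ℝ) :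
    bumpTime n y S X = 0 := by
  simp [bumpTime, bump_dist_eq_zero hy (hX _) n]

lemma bumpTime_univ_eq {N₁ N₂ : ℤ} {y : Fin d → ℤ} (hy : ∀ j, N₁ + 1 ≤ y j ∧ y j + 1 ≤ N₂)
    {w : Trajectory d} (hw : ∀ r < 0, w.1 r ∉ cableBox d N₁ N₂) (n : ℕ) :
    bumpTime n y univ w.1 = bumpTime n y (Ioi 0) (pathAt (forwardPart w)) := by
  rw [bumpTime, bumpTime, Measure.restrict_univ, ← lintegral_add_compl _ (measurableSet_Ici (a := (0 : ℝ))),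
    compl_Ici]
  have h0 : ∫⁻ t in Iio (0 : ℝ), ENNReal.ofReal ((d : ℝ)⁻¹ * bump n (dist (w.1 t) (vertex y))) = 0 := by
    rw [setLIntegral_congr_fun (g := fun _ => 0) measurableSet_Iio fun t ht => ?_]
    · simp
    · simp [bump_dist_eq_zero hy (hw t ht) n]
  rw [h0, add_zero, setLIntegral_congr Ioi_ae_eq_Ici.symm]
  refine setLIntegral_congr_fun measurableSet_Ioi fun t ht => ?_
  have ht' : (0 : ℝ) < t := ht
  simp only [pathAt, forwardPart, Real.coe_toNNReal _ ht'.le]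

/-- A trajectory that hits a box has a representative that hits it first at time `0`: the set of
hitting times is closed, and bounded below because the trajectory leaves the compact box as
`t → -∞`. -/
lemma exists_first_hit {N₁ N₂ : ℤ} (w : Trajectory d) (hw : ∃ t, w.1 t ∈ cableBox d N₁ N₂) :
    ∃ w' : Trajectory d, Quotient.mk (timeShift d) w' = Quotient.mk (timeShift d) w ∧
      w'.1 0 ∈ cableBox d N₁ N₂ ∧ ∀ r < 0, w'.1 r ∉ cableBox d N₁ N₂ := by
  have hK := isCompact_cableBox (d := d) N₁ N₂
  set T : Set ℝ := {t | w.1 t ∈ cableBox d N₁ N₂} with hT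
  have hclosed : IsClosed T := hK.isClosed.preimage w.2.1
  obtain ⟨a, ha⟩ := eventually_atBot.1 (w.2.2.2.eventually hK.compl_mem_cocompact)
  have hbdd : BddBelow T := ⟨a, fun t ht => by
    by_contra h
    exact ha t (not_le.1 h).le ht⟩
  have hmem : sInf T ∈ T := hclosed.csInf_mem hw hbdd
  set s := sInf T with hs
  refine ⟨⟨fun t => w.1 (t + s), w.2.1.comp (continuous_id.add continuous_const),
    w.2.2.1.comp (tendsto_atTop_add_const_right _ _ tendsto_id),
    w.2.2.2.comp (tendsto_atBot_add_const_right _ _ tendsto_id)⟩, ?_, ?_, ?_⟩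
  · exact Quotient.sound ⟨-s, fun t => by simp⟩
  · simp only [zero_add]
    exact hmem
  · intro r hr hmem'
    have : s ≤ r + s := csInf_le hbdd hmem'
    linarith

/-- The sum over `y ∈ B` of the local times at `y` of a trajectory. -/
def boxLocalTime (B : Finset (Fin d → ℤ)) (q : TrajectoryMod d) : ℝ≥0∞ :=
  ∑ y ∈ B, trajectoryLocalTime (vertex y) q

lemma measurable_boxLocalTime [NeZero d] (B : Finset (Fin d → ℤ)) :
    Measurable (boxLocalTime B) :=
  Finset.measurable_fun_sum _ fun y _ => measurable_trajectoryLocalTime y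

lemma boxLocalTime_mk [NeZero d] (B : Finset (Fin d → ℤ)) (w : Trajectory d) :
    boxLocalTime B (Quotient.mk (timeShift d) w) =
      ∑ y ∈ B, limsup (fun n => bumpTime n y univ w.1) atTop :=
  Finset.sum_congr rfl fun y _ => pathLocalTime_vertex y w.2.1

/-- The nonzero values of the local time of a trajectory in the interior of a box are those of its part
after the first hitting time of the box. -/
lemma preimage_boxLocalTime [NeZero d] {N₁ N₂ : ℤ} {B : Finset (Fin d → ℤ)}
    (hB : ∀ y ∈ B, ∀ j, N₁ + 1 ≤ y j ∧ y j + 1 ≤ N₂) {S : Set ℝ≥0∞} (hS : 0 ∉ S) :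
    boxLocalTime B ⁻¹' S = hitsThenIn (cableBox d N₁ N₂) (forwardLocalTime B ⁻¹' S) := by
  have key : ∀ w : Trajectory d, (∀ r < 0, w.1 r ∉ cableBox d N₁ N₂) →
      boxLocalTime B (Quotient.mk (timeShift d) w) = forwardLocalTime B (forwardPart w) := by
    intro w hw
    rw [boxLocalTime_mk, forwardLocalTime]
    refine Finset.sum_congr rfl fun y hy => ?_
    simp only [bumpTime_univ_eq (hB y hy) hw]
  ext q
  constructor
  · intro hq
    induction q using Quotient.inductionOn with | _ w =>
    by_cases hw : ∃ t, w.1 t ∈ cableBox d N₁ N₂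
    · obtain ⟨w', h1, h2, h3⟩ := exists_first_hit w hw
      refine ⟨w', h1, h2, h3, ?_⟩
      rw [mem_preimage, ← key w' h3, h1]
      exact hq
    · push Not at hw
      refine absurd ?_ hS
      have h0 : boxLocalTime B (Quotient.mk (timeShift d) w) = 0 := by
        rw [boxLocalTime_mk]
        refine Finset.sum_eq_zero fun y hy => ?_
        simp [bumpTime_eq_zero (hB y hy) hw]
      rw [← h0]
      exact hq
  · rintro ⟨w, rfl, -, h2, h3⟩
    rw [mem_preimage, key w h2]
    exact h3

/-! ### Transience of the diffusion -/

/-- Leaving every compact set, expressed with countably many times. -/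
lemma tendsto_cocompact_iff (w : ForwardPath d) :
    Tendsto (pathAt w) atTop (cocompact (Cable d)) ↔
      ∀ n : ℕ, ∃ m : ℕ, ∀ q : ℚ, (m : ℝ) < q → (n : ℝ) ≤ dist (pathAt w q) (vertex 0) := by
  rw [← Metric.cobounded_eq_cocompact, ← Metric.comap_dist_right_atTop (vertex 0), tendsto_comap_iff]
  constructor
  · intro h n
    obtain ⟨a, ha⟩ := eventually_atTop.1 (h.eventually_ge_atTop (n : ℝ))
    obtain ⟨m, hm⟩ := exists_nat_ge a
    exact ⟨m, fun q hq => ha q (hm.trans hq.le)⟩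
  · intro h
    refine tendsto_atTop.2 fun b => ?_
    obtain ⟨n, hn⟩ := exists_nat_ge b
    obtain ⟨m, hm⟩ := h n
    filter_upwards [eventually_gt_atTop (m : ℝ)] with t ht
    by_contra hlt
    have hopen : IsOpen (Ioi (m : ℝ) ∩ {t | dist (pathAt w t) (vertex 0) < n}) :=
      isOpen_Ioi.inter (isOpen_lt ((continuous_pathAt w).dist continuous_const) continuous_const)
    obtain ⟨q, hq⟩ := Rat.denseRange_cast.exists_mem_open hopen
      ⟨t, ht, lt_of_lt_of_le (not_le.1 hlt) hn⟩
    exact absurd (hm q hq.1) (not_le.2 hq.2)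

lemma measurableSet_tendsto_cocompact :
    MeasurableSet {w : ForwardPath d | Tendsto (pathAt w) atTop (cocompact (Cable d))} := by
  simp only [tendsto_cocompact_iff]
  have hm : ∀ q : ℚ, Measurable fun w : ForwardPath d => dist (pathAt w q) (vertex 0) := fun q =>
    (measurable_pathAt (q : ℝ)).dist measurable_const
  refine measurableSet_setOfPred.2 (Measurable.forall fun n => Measurable.exists fun m =>
    Measurable.forall fun q => Measurable.imp measurable_const ?_)
  exact measurableSet_setOfPred.1 (measurableSet_le measurable_const (hm q))

/-! ### Local time under the intensity measure -/

section intensity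
variable {P : (Fin d → ℤ) → Measure (ForwardPath d)} {ν : Measure (TrajectoryMod d)} {N₁ N₂ : ℤ}

/-- The diffusion is transient from every point charged by the equilibrium measure, since all
trajectories leave every compact set. -/
lemma ae_tendsto_cocompact
    (hν : ∀ A : Set (ForwardPath d), MeasurableSet A → ν (hitsThenIn (cableBox d N₁ N₂) A) =
        ∑ x ∈ latticeBox d N₁ N₂, equilibrium (latticeBox d N₁ N₂) x * P x A)
    {x : Fin d → ℤ} (hx : x ∈ latticeBox d N₁ N₂) (he : equilibrium (latticeBox d N₁ N₂) x ≠ 0) :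
    ∀ᵐ w ∂(P x), Tendsto (pathAt w) atTop (cocompact (Cable d)) := by
  have h := hν _ measurableSet_tendsto_cocompact.compl
  have hempty : hitsThenIn (cableBox d N₁ N₂)
      {w : ForwardPath d | Tendsto (pathAt w) atTop (cocompact (Cable d))}ᶜ = ∅ := by
    refine eq_empty_iff_forall_notMem.2 ?_
    rintro q ⟨w, -, -, -, hw⟩
    refine hw (w.2.2.1.congr' ?_)
    filter_upwards [eventually_ge_atTop 0] with t ht
    simp [pathAt, forwardPart, ht]
  rw [hempty, measure_empty] at h
  have := (Finset.sum_eq_zero_iff.1 h.symm) x hx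
  exact (mul_eq_zero.1 this).resolve_left he

/-- The intensity measure of the local time of a trajectory, off the value `0`: it is the law of the
local time of the forward diffusion started from the equilibrium measure. -/
lemma lintegral_comp_boxLocalTime [NeZero d]
    (hν : ∀ A : Set (ForwardPath d), MeasurableSet A → ν (hitsThenIn (cableBox d N₁ N₂) A) =
        ∑ x ∈ latticeBox d N₁ N₂, equilibrium (latticeBox d N₁ N₂) x * P x A)
    {B : Finset (Fin d → ℤ)} (hB : ∀ y ∈ B, ∀ j, N₁ + 1 ≤ y j ∧ y j + 1 ≤ N₂)
    {ψ : ℝ≥0∞ → ℝ≥0∞} (hψ : Measurable ψ) (h0 : ψ 0 = 0) :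
    ∫⁻ q, ψ (boxLocalTime B q) ∂ν = ∑ x ∈ latticeBox d N₁ N₂,
      equilibrium (latticeBox d N₁ N₂) x * ∫⁻ w, ψ (forwardLocalTime B w) ∂(P x) := by
  have hF := measurable_boxLocalTime B
  have hG := measurable_forwardLocalTime B
  set κ : Measure ℝ≥0∞ := Measure.sum fun x : latticeBox d N₁ N₂ =>
    equilibrium (latticeBox d N₁ N₂) x.1 • (P x).map (forwardLocalTime B) with hκ
  have hmeas : (ν.map (boxLocalTime B)).restrict {0}ᶜ = κ.restrict {0}ᶜ := by
    ext S hS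
    have hS' : MeasurableSet (S ∩ {0}ᶜ) := hS.inter (measurableSet_singleton _).compl
    rw [Measure.restrict_apply hS, Measure.restrict_apply hS, Measure.map_apply hF hS',
      preimage_boxLocalTime hB (by simp), hν _ (hG hS'), hκ, Measure.sum_apply _ hS',
      tsum_fintype, ← Finset.sum_coe_sort]
    refine Finset.sum_congr rfl fun x _ => ?_
    rw [Measure.smul_apply, Measure.map_apply hG hS', smul_eq_mul]
  have hres : ∀ κ' : Measure ℝ≥0∞, ∫⁻ a, ψ a ∂κ' = ∫⁻ a in {0}ᶜ, ψ a ∂κ' := by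
    intro κ'
    rw [← lintegral_add_compl _ (measurableSet_singleton (0 : ℝ≥0∞))]
    simp [h0]
  rw [← lintegral_map hψ hF, hres, hmeas, ← hres, hκ, lintegral_sum_measure, tsum_fintype,
    ← Finset.sum_coe_sort (latticeBox d N₁ N₂)]
  refine Finset.sum_congr rfl fun x _ => ?_
  rw [lintegral_smul_measure, lintegral_map hψ hG, smul_eq_mul]

lemma equilibrium_ne_top [NeZero d] (K : Finset (Fin d → ℤ)) (x : Fin d → ℤ) :
    equilibrium K x ≠ ∞ := by
  exact ENNReal.mul_ne_top (by finiteness) (measure_ne_top _ _)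

lemma measure_boxLocalTime_ne_zero [NeZero d] (hP : ∀ x, IsDiffusionLaw (vertex x) (P x))
    (hν : ∀ A : Set (ForwardPath d), MeasurableSet A → ν (hitsThenIn (cableBox d N₁ N₂) A) =
        ∑ x ∈ latticeBox d N₁ N₂, equilibrium (latticeBox d N₁ N₂) x * P x A)
    {B : Finset (Fin d → ℤ)} (hB : ∀ y ∈ B, ∀ j, N₁ + 1 ≤ y j ∧ y j + 1 ≤ N₂) :
    ν {q | boxLocalTime B q ≠ 0} ≠ ∞ := by
  have := fun x => (hP x).isProbability
  have h : {q | boxLocalTime B q ≠ 0} = boxLocalTime B ⁻¹' {0}ᶜ := rfl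
  rw [h, preimage_boxLocalTime hB (by simp),
    hν _ (measurable_forwardLocalTime B (measurableSet_singleton _).compl)]
  exact (ENNReal.sum_lt_top.2 fun x _ => (ENNReal.mul_ne_top (equilibrium_ne_top _ _)
    (measure_ne_top _ _)).lt_top).ne

lemma ae_boxLocalTime_lt_top [NeZero d] (hd : 3 ≤ d) (hP : ∀ x, IsDiffusionLaw (vertex x) (P x))
    (hν : ∀ A : Set (ForwardPath d), MeasurableSet A → ν (hitsThenIn (cableBox d N₁ N₂) A) =
        ∑ x ∈ latticeBox d N₁ N₂, equilibrium (latticeBox d N₁ N₂) x * P x A)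
    {B : Finset (Fin d → ℤ)} (hB : ∀ y ∈ B, ∀ j, N₁ + 1 ≤ y j ∧ y j + 1 ≤ N₂) :
    ∀ᵐ q ∂ν, boxLocalTime B q < ∞ := by
  have h : {q | ¬ boxLocalTime B q < ∞} = boxLocalTime B ⁻¹' {∞} := by
    ext q; simp
  rw [ae_iff, h, preimage_boxLocalTime hB (by simp),
    hν _ (measurable_forwardLocalTime B (measurableSet_singleton _))]
  refine Finset.sum_eq_zero fun x _ => ?_
  have h2 : ∀ᵐ w ∂(P x), w ∉ forwardLocalTime B ⁻¹' {∞} := by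
    filter_upwards [ae_tendsto_totalTime hd (hP x) B] with w hw
    exact hw.2.1.ne
  have h3 : P x (forwardLocalTime B ⁻¹' {∞}) = 0 := measure_eq_zero_iff_ae_notMem.2 h2
  rw [h3, mul_zero]

lemma sum_equilibrium_mul_greenPotential [NeZero d] (hd : 3 ≤ d) (K B : Finset (Fin d → ℤ))
    (hB : B ⊆ K) {c : ℝ} (hc : 0 ≤ c) :
    ∑ x ∈ K, equilibrium K x * ENNReal.ofReal (c * greenPotential B x) =
      ENNReal.ofReal (c * B.card) := by
  rw [ENNReal.ofReal_mul hc, ENNReal.ofReal_natCast,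
    ← sum_equilibrium_mul_green K B hB (fun x => green_indicator_ne_top hd K x), Finset.mul_sum]
  refine Finset.sum_congr rfl fun x _ => ?_
  have hd0 : (0 : ℝ) < 2 * d := by have := NeZero.pos d; positivity
  rw [ENNReal.ofReal_mul hc, greenPotential, ENNReal.ofReal_mul (by positivity),
    ENNReal.ofReal_toReal (green_indicator_ne_top hd B x), ENNReal.ofReal_inv_of_pos hd0,
    ENNReal.ofReal_mul (by norm_num), ENNReal.ofReal_natCast, ENNReal.ofReal_ofNat]
  ring

lemma lintegral_exp_boxLocalTime_le [NeZero d] (hd : 3 ≤ d)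
    (hP : ∀ x, IsDiffusionLaw (vertex x) (P x))
    (hν : ∀ A : Set (ForwardPath d), MeasurableSet A → ν (hitsThenIn (cableBox d N₁ N₂) A) =
        ∑ x ∈ latticeBox d N₁ N₂, equilibrium (latticeBox d N₁ N₂) x * P x A)
    {B : Finset (Fin d → ℤ)} (hB : ∀ y ∈ B, ∀ j, N₁ + 1 ≤ y j ∧ y j + 1 ≤ N₂)
    {A : ℝ} (hA : ∀ x, greenPotential B x ≤ A) {θ : ℝ} (hθ : 0 ≤ θ) (hθA : θ * A < 1) :
    ∫⁻ q, ENNReal.ofReal (Real.exp (θ * (boxLocalTime B q).toReal) - 1) ∂ν ≤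
      ENNReal.ofReal (θ / (1 - θ * A) * B.card) := by
  have hc : 0 ≤ θ / (1 - θ * A) := div_nonneg hθ (by linarith)
  rw [lintegral_comp_boxLocalTime hν hB
    (ψ := fun a => ENNReal.ofReal (Real.exp (θ * a.toReal) - 1)) (by fun_prop) (by simp),
    ← sum_equilibrium_mul_greenPotential hd (latticeBox d N₁ N₂) B (fun y hy => ?_) hc]
  · refine Finset.sum_le_sum fun x _ => ?_
    gcongr
    have := (hP x).isProbability
    have h := lintegral_exp_forwardLocalTime_le hd (hP x) hA hθ hθA
    have h1 : ∀ w, ENNReal.ofReal (Real.exp (θ * (forwardLocalTime B w).toReal)) =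
        ENNReal.ofReal (Real.exp (θ * (forwardLocalTime B w).toReal) - 1) + 1 := fun w => by
      have := Real.one_le_exp (mul_nonneg hθ (ENNReal.toReal_nonneg (a := forwardLocalTime B w)))
      rw [← ENNReal.ofReal_one, ← ENNReal.ofReal_add (by linarith) zero_le_one, sub_add_cancel]
    simp only [h1] at h
    rw [lintegral_add_right _ measurable_const, lintegral_const, measure_univ, mul_one, add_comm (1 : ℝ),
      ENNReal.ofReal_add (mul_nonneg hc (greenPotential_nonneg B x)) zero_le_one,
      ENNReal.ofReal_one] at h
    exact (ENNReal.add_le_add_iff_right ENNReal.one_ne_top).1 h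
  · rw [latticeBox, Fintype.mem_piFinset]
    intro j
    have := hB y hy j
    rw [Finset.mem_Icc]; omega

lemma le_lintegral_exp_neg_boxLocalTime [NeZero d] (hd : 3 ≤ d)
    (hP : ∀ x, IsDiffusionLaw (vertex x) (P x))
    (hν : ∀ A : Set (ForwardPath d), MeasurableSet A → ν (hitsThenIn (cableBox d N₁ N₂) A) =
        ∑ x ∈ latticeBox d N₁ N₂, equilibrium (latticeBox d N₁ N₂) x * P x A)
    {B : Finset (Fin d → ℤ)} (hB : ∀ y ∈ B, ∀ j, N₁ + 1 ≤ y j ∧ y j + 1 ≤ N₂)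
    {A : ℝ} (hA : ∀ x, greenPotential B x ≤ A) {θ : ℝ} (hθ : 0 ≤ θ) (hθA : θ * A ≤ 1) :
    ENNReal.ofReal (θ * (1 - θ * A) * B.card) ≤
      ∫⁻ q, ENNReal.ofReal (1 - Real.exp (-θ * (boxLocalTime B q).toReal)) ∂ν := by
  have hc : 0 ≤ θ * (1 - θ * A) := mul_nonneg hθ (by linarith)
  rw [lintegral_comp_boxLocalTime hν hB
    (ψ := fun a => ENNReal.ofReal (1 - Real.exp (-θ * a.toReal))) (by fun_prop) (by simp),
    ← sum_equilibrium_mul_greenPotential hd (latticeBox d N₁ N₂) B (fun y hy => ?_) hc]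
  · refine Finset.sum_le_sum fun x hx => ?_
    by_cases he : equilibrium (latticeBox d N₁ N₂) x = 0
    · simp [he]
    gcongr
    have := (hP x).isProbability
    have h := lintegral_exp_neg_forwardLocalTime_le hd (hP x) (ae_tendsto_cocompact hν hx he)
      hA hθ hθA
    set p := θ * (1 - θ * A) * greenPotential B x with hp
    have hp1 : p ≤ 1 := by
      have h0 := greenPotential_nonneg B x
      have h1 := hA x
      have h2 : θ * greenPotential B x ≤ θ * A := mul_le_mul_of_nonneg_left h1 hθ
      have h3 : 0 ≤ θ * greenPotential B x := mul_nonneg hθ h0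
      nlinarith
    have hm : Measurable fun w => ENNReal.ofReal (Real.exp (-θ * (forwardLocalTime B w).toReal)) :=
      (((measurable_forwardLocalTime B).ennreal_toReal.const_mul _).exp).ennreal_ofReal
    have h1 : ∫⁻ w, ENNReal.ofReal (1 - Real.exp (-θ * (forwardLocalTime B w).toReal)) ∂(P x) +
        ∫⁻ w, ENNReal.ofReal (Real.exp (-θ * (forwardLocalTime B w).toReal)) ∂(P x) = 1 := by
      rw [← lintegral_add_right _ hm]
      have h2 : ∀ w, ENNReal.ofReal (1 - Real.exp (-θ * (forwardLocalTime B w).toReal)) +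
          ENNReal.ofReal (Real.exp (-θ * (forwardLocalTime B w).toReal)) = 1 := fun w => by
        have h3 : Real.exp (-θ * (forwardLocalTime B w).toReal) ≤ 1 := Real.exp_le_one_iff.2 (by
          have := mul_nonneg hθ (ENNReal.toReal_nonneg (a := forwardLocalTime B w))
          linarith)
        rw [← ENNReal.ofReal_add (by linarith) (Real.exp_pos _).le, sub_add_cancel,
          ENNReal.ofReal_one]
      simp only [h2, lintegral_const, measure_univ, mul_one]
    have h4 : ENNReal.ofReal p + ENNReal.ofReal (1 - p) = 1 := by
      rw [← ENNReal.ofReal_add (mul_nonneg hc (greenPotential_nonneg B x)) (by linarith),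
        add_sub_cancel, ENNReal.ofReal_one]
    have h5 : ENNReal.ofReal p + ENNReal.ofReal (1 - p) ≤
        ∫⁻ w, ENNReal.ofReal (1 - Real.exp (-θ * (forwardLocalTime B w).toReal)) ∂(P x) +
          ENNReal.ofReal (1 - p) := by
      rw [h4, ← h1]
      gcongr
    exact (ENNReal.add_le_add_iff_right ENNReal.ofReal_ne_top).1 h5
  · rw [latticeBox, Fintype.mem_piFinset]
    intro j
    have := hB y hy j
    rw [Finset.mem_Icc]; omega

end intensity

/-! ### Concentration of the averaged local time -/

/-- The local time in `B` that a trajectory contributes at level `u`; zero if its label exceeds `u`. -/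
def labelledLocalTime (B : Finset (Fin d → ℤ)) (u : ℝ) : TrajectoryMod d × ℝ → ℝ≥0∞ :=
  indicator {p | p.2 ≤ u} fun p => boxLocalTime B p.1

lemma measurableSet_label_le (u : ℝ) : MeasurableSet {p : TrajectoryMod d × ℝ | p.2 ≤ u} :=
  measurableSet_le measurable_snd measurable_const

lemma measurable_labelledLocalTime [NeZero d] (B : Finset (Fin d → ℤ)) (u : ℝ) :
    Measurable (labelledLocalTime B u) :=
  ((measurable_boxLocalTime B).comp measurable_fst).indicator (measurableSet_label_le u)

lemma lintegral_labelledLocalTime [NeZero d] (B : Finset (Fin d → ℤ)) (u : ℝ)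
    (N : Measure (TrajectoryMod d × ℝ)) :
    ∫⁻ p, labelledLocalTime B u p ∂N = ∑ x ∈ B, localTime N u (vertex x) := by
  rw [labelledLocalTime, lintegral_indicator (measurableSet_label_le u)]
  exact lintegral_finsetSum _ fun y _ => (measurable_trajectoryLocalTime y).comp measurable_fst

lemma lintegral_comp_labelledLocalTime [NeZero d] (ν : Measure (TrajectoryMod d))
    (B : Finset (Fin d → ℤ)) (u : ℝ) {ψ : ℝ≥0∞ → ℝ≥0∞} (hψ : Measurable ψ) (h0 : ψ 0 = 0) :
    ∫⁻ p, ψ (labelledLocalTime B u p) ∂(ν.prod (volume.restrict (Ici (0 : ℝ)))) =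
      ENNReal.ofReal u * ∫⁻ q, ψ (boxLocalTime B q) ∂ν := by
  rw [lintegral_prod (fun p => ψ (labelledLocalTime B u p))
    (hψ.comp (measurable_labelledLocalTime B u)).aemeasurable]
  have h : ∀ q : TrajectoryMod d, ∫⁻ s in Ici (0 : ℝ), ψ (labelledLocalTime B u (q, s)) =
      ENNReal.ofReal u * ψ (boxLocalTime B q) := by
    intro q
    have h1 : ∀ s : ℝ, ψ (labelledLocalTime B u (q, s)) =
        (Iic u).indicator (fun _ => ψ (boxLocalTime B q)) s := by
      intro s
      by_cases hs : s ≤ u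
      · rw [labelledLocalTime, indicator_of_mem (by exact hs), indicator_of_mem (by exact hs)]
      · rw [labelledLocalTime, indicator_of_notMem (by exact hs), indicator_of_notMem (by exact hs),
          h0]
    simp only [h1]
    rw [lintegral_indicator measurableSet_Iic, Measure.restrict_restrict measurableSet_Iic,
      setLIntegral_const, inter_comm, Ici_inter_Iic, Real.volume_Icc, sub_zero, mul_comm]
  simp only [h]
  exact lintegral_const_mul _ (hψ.comp (measurable_boxLocalTime B))

section main
variable {Ω : Type*} [MeasurableSpace Ω] {μ : Measure Ω}
  {N : Ω → Measure (TrajectoryMod d × ℝ)} {B : Finset (Fin d → ℤ)} {A θ u : ℝ}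

/-- Every finite set of vertices is well inside some box. -/
lemma exists_cableBox (B : Finset (Fin d → ℤ)) : ∃ N₁ N₂ : ℤ, N₁ ≤ N₂ ∧
    ∀ y ∈ B, ∀ j, N₁ + 1 ≤ y j ∧ y j + 1 ≤ N₂ := by
  set m : ℤ := ∑ y ∈ B, ∑ j, |y j| with hm
  have hm0 : 0 ≤ m := Finset.sum_nonneg fun y _ => Finset.sum_nonneg fun j _ => abs_nonneg _
  refine ⟨-m - 1, m + 1, by omega, fun y hy j => ?_⟩
  have h1 : |y j| ≤ ∑ j, |y j| :=
    Finset.single_le_sum (f := fun j => |y j|) (fun j _ => abs_nonneg _) (Finset.mem_univ j)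
  have h2 : ∑ j, |y j| ≤ m :=
    Finset.single_le_sum (f := fun y : Fin d → ℤ => ∑ j, |y j|)
      (fun y _ => Finset.sum_nonneg fun j _ => abs_nonneg _) hy
  have h3 := abs_le.1 (h1.trans h2)
  constructor <;> omega

/-- The integrability and the exponential moments of `labelledLocalTime` under the intensity measure of
the interlacement process. -/
lemma IsRandomInterlacement.exists_intensity [NeZero d] (hd : 3 ≤ d)
    (h : IsRandomInterlacement μ N) (hA : ∀ x, greenPotential B x ≤ A) (hθ : 0 ≤ θ)
    (hθA : θ * A < 1) (u : ℝ) (hu : 0 ≤ u) :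
    ∃ Λ : Measure (TrajectoryMod d × ℝ), IsPoissonPointProcess μ N Λ ∧
      Λ {p | labelledLocalTime B u p ≠ 0} ≠ ∞ ∧ (∀ᵐ p ∂Λ, labelledLocalTime B u p < ∞) ∧
      ∫⁻ p, ENNReal.ofReal (Real.exp (θ * (labelledLocalTime B u p).toReal) - 1) ∂Λ ≤
        ENNReal.ofReal (u * (θ / (1 - θ * A) * B.card)) ∧
      ENNReal.ofReal (u * (θ * (1 - θ * A) * B.card)) ≤
        ∫⁻ p, ENNReal.ofReal (1 - Real.exp (-θ * (labelledLocalTime B u p).toReal)) ∂Λ := by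
  obtain ⟨ν, ⟨P, hP, hν⟩, hN⟩ := h
  obtain ⟨N₁, N₂, hN12, hB⟩ := exists_cableBox B
  have hν' := hν N₁ N₂ hN12
  have hmeas := measurable_labelledLocalTime B u
  have hb := measurable_boxLocalTime B
  -- the mass of a set of nonzero values is the integral of its indicator function
  have hset : ∀ S : Set ℝ≥0∞, MeasurableSet S → 0 ∉ S →
      (ν.prod (volume.restrict (Ici (0 : ℝ)))) (labelledLocalTime B u ⁻¹' S) =
        ENNReal.ofReal u * ν (boxLocalTime B ⁻¹' S) := by
    intro S hS h0
    rw [← lintegral_indicator_one (hmeas hS), ← lintegral_indicator_one (hb hS)]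
    exact lintegral_comp_labelledLocalTime ν B u (ψ := S.indicator 1)
      (measurable_one.indicator hS) (indicator_of_notMem h0 _)
  refine ⟨_, hN, ?_, ?_, ?_, ?_⟩
  · refine (hset {0}ᶜ (measurableSet_singleton _).compl (by simp)).trans_ne ?_
    exact ENNReal.mul_ne_top ENNReal.ofReal_ne_top (measure_boxLocalTime_ne_zero hP hν' hB)
  · have h1 : ν (boxLocalTime B ⁻¹' {∞}) = 0 := by
      refine measure_eq_zero_iff_ae_notMem.2 ?_
      filter_upwards [ae_boxLocalTime_lt_top hd hP hν' hB] with q hq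
      exact hq.ne
    have h2 := hset {∞} (measurableSet_singleton _) (by simp)
    rw [h1, mul_zero] at h2
    filter_upwards [measure_eq_zero_iff_ae_notMem.1 h2] with p hp
    exact lt_top_iff_ne_top.2 hp
  · rw [lintegral_comp_labelledLocalTime ν B u
      (ψ := fun a => ENNReal.ofReal (Real.exp (θ * a.toReal) - 1)) (by fun_prop) (by simp),
      ENNReal.ofReal_mul hu]
    gcongr
    exact lintegral_exp_boxLocalTime_le hd hP hν' hB hA hθ hθA
  · rw [lintegral_comp_labelledLocalTime ν B u
      (ψ := fun a => ENNReal.ofReal (1 - Real.exp (-θ * a.toReal))) (by fun_prop) (by simp),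
      ENNReal.ofReal_mul hu]
    gcongr
    exact le_lintegral_exp_neg_boxLocalTime hd hP hν' hB hA hθ hθA.le

/-- Concentration of the mean local time over a nonempty finite set `B` of vertices, for `θ` small
compared with the inverse of the maximum of the Green potential. -/
lemma IsRandomInterlacement.measure_deviation_le [NeZero d] [IsProbabilityMeasure μ] (hd : 3 ≤ d)
    (h : IsRandomInterlacement μ N) (hA : ∀ x, greenPotential B x ≤ A) (hB : B.Nonempty)
    (hθ : 0 < θ) (hu : 0 < u) {ε : ℝ} (hε : 0 < ε) (hε1 : ε < 1) (hθA : θ * A ≤ ε / 4) :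
    μ {ω | ε * u < |1 / (B.card : ℝ) *
        (∑ x ∈ B, localTime (N ω) u (vertex x)).toReal - u|} ≤
      ENNReal.ofReal (2 * Real.exp (-(θ * ε / 2 * u * B.card))) := by
  have hb : (0 : ℝ) < B.card := by exact_mod_cast hB.card_pos
  set b : ℝ := (B.card : ℝ) with hbdef
  obtain ⟨Λ, hN, hΛ, hfin, hup, hlow⟩ :=
    h.exists_intensity hd hA hθ.le (by linarith) u hu.le
  have hH := measurable_labelledLocalTime B u
  have h1 : 0 < 1 - θ * A := by linarith
  have hubθ : 0 < u * θ * b := by positivity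
  have hI : u * (θ / (1 - θ * A) * b) ≤ u * θ * b * (1 + ε / 2) := by
    have : 1 / (1 - θ * A) ≤ 1 + ε / 2 := by
      rw [div_le_iff₀ h1]; nlinarith
    calc u * (θ / (1 - θ * A) * b) = u * θ * b * (1 / (1 - θ * A)) := by ring
      _ ≤ _ := by gcongr
  have hJ : u * θ * b * (1 - ε / 2) < u * (θ * (1 - θ * A) * b) := by
    have : 1 - ε / 2 < 1 - θ * A := by linarith
    calc u * θ * b * (1 - ε / 2) < u * θ * b * (1 - θ * A) := by gcongr
      _ = _ := by ring
  have hupper := hN.measure_lt_lintegral_le hH hΛ hfin (t := (1 + ε) * u * b) hθ.le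
    (I := u * θ * b * (1 + ε / 2)) (by positivity)
    (hup.trans (ENNReal.ofReal_le_ofReal hI))
  have hlower := hN.measure_lintegral_lt_le hH hΛ hfin (t := (1 - ε) * u * b) hθ.le
    (J := u * θ * b * (1 - ε / 2)) (lt_of_lt_of_le
      ((ENNReal.ofReal_lt_ofReal_iff (by nlinarith)).2 hJ) hlow)
  simp only [lintegral_labelledLocalTime] at hupper hlower
  have hsub : {ω | ε * u < |1 / b * (∑ x ∈ B, localTime (N ω) u (vertex x)).toReal - u|} ⊆
      {ω | ENNReal.ofReal ((1 + ε) * u * b) < ∑ x ∈ B, localTime (N ω) u (vertex x)} ∪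
      {ω | ∑ x ∈ B, localTime (N ω) u (vertex x) < ENNReal.ofReal ((1 - ε) * u * b)} := by
    intro ω hω
    set Z := ∑ x ∈ B, localTime (N ω) u (vertex x) with hZ
    by_cases hZtop : Z = ∞
    -- an infinite sum has real value `0`, but it lies in the upper event as an extended real
    · left
      change _ < Z
      rw [hZtop]; exact ENNReal.ofReal_lt_top
    · rcases lt_abs.1 (show ε * u < |1 / b * Z.toReal - u| from hω) with hlt | hlt
      · left
        change _ < Z
        rw [ENNReal.ofReal_lt_iff_lt_toReal (by positivity) hZtop]
        have : (1 + ε) * u < Z.toReal / b := by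
          have e : 1 / b * Z.toReal = Z.toReal / b := by ring
          linarith
        exact (lt_div_iff₀ hb).1 this
      · right
        change Z < _
        rw [ENNReal.lt_ofReal_iff_toReal_lt hZtop]
        have : Z.toReal / b < (1 - ε) * u := by
          have e : 1 / b * Z.toReal = Z.toReal / b := by ring
          linarith
        exact (div_lt_iff₀ hb).1 this
  refine (measure_mono hsub).trans ((measure_union_le _ _).trans ((add_le_add hupper hlower).trans ?_))
  rw [← ENNReal.ofReal_add (Real.exp_pos _).le (Real.exp_pos _).le]
  refine ENNReal.ofReal_le_ofReal (le_of_eq ?_)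
  rw [two_mul]
  congr 2 <;> ring

end main

end

end Interlacement

theorem lemma3p3 (d : ℕ) (hd : 3 ≤ d) (ε : ℝ) (hε₀ : 0 < ε) (hε₁ : ε < 1) :
    ∃ c C : ℝ, 0 < c ∧ 0 < C ∧
      ∀ {Ω : Type*} [MeasurableSpace Ω] (μ : Measure Ω) [IsProbabilityMeasure μ]
        (N : Ω → Measure (Interlacement.TrajectoryMod d × ℝ)),
        Interlacement.IsRandomInterlacement μ N →
        ∀ (u : ℝ), 0 < u → ∀ (R : ℕ), 1 ≤ R →
          μ {ω | ε * u < |1 / (R : ℝ) ^ d *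
              (∑ x ∈ Fintype.piFinset (fun _ : Fin d => Finset.Ico (0 : ℤ) R),
                Interlacement.localTime (N ω) u (Interlacement.vertex x)).toReal - u|}
            ≤ ENNReal.ofReal (C * Real.exp (-c * (R : ℝ) ^ (d - 2) * u)) := by
  have : NeZero d := ⟨by omega⟩
  have hd0 : (0 : ℝ) < d := by exact_mod_cast NeZero.pos d
  obtain ⟨G, hG0, hG⟩ := Interlacement.exists_green_box_le hd
  refine ⟨ε ^ 2 * d / (4 * G), 2, by positivity, two_pos, ?_⟩
  intro Ω _ μ _ N hN u hu R hR
  have hR0 : (0 : ℝ) < R := by exact_mod_cast hR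
  set B : Finset (Fin d → ℤ) := Fintype.piFinset (fun _ : Fin d => Finset.Ico (0 : ℤ) R) with hB
  have hcard : (B.card : ℝ) = (R : ℝ) ^ d := by
    rw [hB, Fintype.card_piFinset]
    simp
  have hne : B.Nonempty := by
    rw [← Finset.card_pos]
    have : (0 : ℝ) < B.card := by rw [hcard]; positivity
    exact_mod_cast this
  have hA : ∀ x, Interlacement.greenPotential B x ≤ (2 * d : ℝ)⁻¹ * (G * R ^ 2) := fun x => by
    unfold Interlacement.greenPotential
    gcongr
    exact ENNReal.toReal_le_of_le_ofReal (by positivity) (hG R hR x)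
  have h := hN.measure_deviation_le hd hA hne (θ := ε * d / (2 * G * R ^ 2)) (by positivity) hu
    hε₀ hε₁ (le_of_eq (by field_simp; norm_num))
  rw [hcard] at h
  refine h.trans (ENNReal.ofReal_le_ofReal (le_of_eq ?_))
  have hpow : (R : ℝ) ^ d = R ^ (d - 2) * R ^ 2 := by rw [← pow_add]; congr 1; omega
  rw [hpow]
  congr 2
  field_simp
  norm_num
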